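/- \textbf{Subset Sum Ratio.} For a finite set $S$ of positive integers let $\Sigma(S)$ be the sum of its elements. Given a finite set $A=\{a_1<\dots<a_n\}$ of positive integers, $n\ge 2$, let $r_{\mathrm{opt}}$ be the minimum of $\max\{\Sigma(S_1),\Sigma(S_2)\}/\min\{\Sigma(S_1),\Sigma(S_2)\}$ over all disjoint nonempty $S_1,S_2\subseteq A$. (In general we call this quotient the ratio of $(S_1,S_2)$, with value $\infty$ if exactly one of the sums is $0$.) \textbf{Partition.} For a finite set $X$ of positive integers let $X^*\subseteq X$ be a set of maximal sum among the $Z\subseteq X$ with $\Sigma(Z)\le\Sigma(X)/2$. A $(1-\delta)$-approximate Partition solution on $X$ is a set $P\subseteq X$ with $(1-\delta)\Sigma(X^*)\le\Sigma(P)\le\Sigma(X^*)$. \textbf{ConstrainedSSR$(A,\varepsilon)$}, for $\varepsilon\in(0,1)$ and a nonempty finite set $A$ of positive integers with largest element $m$. Let $L=\{s\in A: s\ge\varepsilon m\}$ and $M=A\setminus L$. Distribute the subset sums of $L$ into the bins $[j\varepsilon^2m,(j+1)\varepsilon^2m)$, $j\ge0$. If two distinct $X,Y\subseteq L$ have sums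 in the same bin, return $(X\setminus Y,\,Y\setminus X)$ for one such pair. Otherwise, for every $X\subseteq L$ with $m\in X$, take a $(1-\varepsilon')$-approximate Partition solution $P$ on $X$ with $\varepsilon'=\varepsilon/(2+\varepsilon)$, put $Q=X\setminus P$, and add small elements to $P$: if $\Sigma(P)+\Sigma(M)\ge\Sigma(Q)$, let $R=P\cup M_k$, where $M_k$ consists of the $k$ smallest elements of $M$ and $k$ is such that $0\le\Sigma(R)-\Sigma(Q)\le\varepsilon m$; otherwise let $R=P\cup M$. Return a pair $(R,Q)$ of minimal ratio among the pairs obtained. \textbf{SSR$(A,\varepsilon)$}. Run ConstrainedSSR on each prefix $\{a_1,\dots,a_i\}$, $1\le i\le n$, with error margin $\varepsilon$, and return a pair of minimal ratio among the $n$ returned pairs. \textbf{Theorem.} (1) For every finite set $A$ of $n\ge2$ positive integers and every real $\varepsilon\in(0,1)$, whatever choices are made where the algorithm leaves them open, SSR$(A,\varepsilon)$ returns disjoint nonempty subsets $S_1,S_2\subseteq A$ whose ratio is at most $(1+\varepsilon)\,r_{\mathrm{opt}}$ (and a run always exists, i.e. the required approximate Partition solutions and indices $k$ exist). (2) SSR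 is an FPTAS with the following running time. There are a word RAM program and constants $K,C$ and $c<5$ such that for every finite set $A$ of $n\ge2$ positive integers, given in increasing order, and every rational $\varepsilon=p/q\in(0,1)$, given by positive integers $p<q$, the program, using only numbers below $(n+\max A+p+q)^K$ (machine words of logarithmic length, unit-cost arithmetic $+,-,\times,\lfloor\cdot/\cdot\rfloor$, comparisons and memory accesses), halts with an output of SSR$(A,\varepsilon)$, hence with a solution of ratio at most $(1+\varepsilon)r_{\mathrm{opt}}$, after at most $$C\cdot\min\Big\{\frac{n^{2.3}}{\varepsilon^{2.6}}\log\frac{n}{\varepsilon^2},\ \frac{n^2}{\varepsilon^3}\log\frac{n}{\varepsilon^2},\ \frac{n^2}{\varepsilon^2}\Big(\log\frac{n}{\varepsilon^2}+\frac{1}{\varepsilon^{1.5}}\log^2\frac{\log(n/\varepsilon^2)}{\varepsilon}\Big)\Big\}$$ steps ($\log=\log_2$), and after at most $C\cdot(n+1/\varepsilon)^c$ steps. -/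

import Mathlib

open scoped ENNReal

namespace SubsetSumRatio

noncomputable section

/-! ### The problem -/

/-- The sum `Σ(S)` of the elements of a set of naturals. -/
def total (S : Finset ℕ) : ℕ := ∑ s ∈ S, s

/-- The largest element `max(A)` (with value `0` on the empty set). -/
def maxElt (A : Finset ℕ) : ℕ := A.sup id

/-- The ratio `max {Σ(S₁), Σ(S₂)} / min {Σ(S₁), Σ(S₂)}`; it is `∞` if exactly one sum vanishes. -/
def ratio (S : Finset ℕ × Finset ℕ) : ℝ≥0∞ :=
  ((max (total S.1) (total S.2) : ℕ) : ℝ≥0∞) / ((min (total S.1) (total S.2) : ℕ) : ℝ≥0∞)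

/-- The feasible solutions: pairs of disjoint nonempty subsets of `A`. -/
def IsFeasible (A : Finset ℕ) (S : Finset ℕ × Finset ℕ) : Prop :=
  S.1 ⊆ A ∧ S.2 ⊆ A ∧ Disjoint S.1 S.2 ∧ S.1.Nonempty ∧ S.2.Nonempty

/-- The optimal subset sum ratio of `A`. -/
def optRatio (A : Finset ℕ) : ℝ≥0∞ := sInf (ratio '' {S | IsFeasible A S})

/-- Feasible, and of ratio at most `(1 + ε)` times the optimal one. -/
def IsApproxSolution (A : Finset ℕ) (ε : ℝ) (S : Finset ℕ × Finset ℕ) : Prop :=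
  IsFeasible A S ∧ ratio S ≤ ENNReal.ofReal (1 + ε) * optRatio A

/-! ### Partition -/

/-- `P` is an optimal solution of Partition on input `X`. -/
def IsPartition (X P : Finset ℕ) : Prop :=
  P ⊆ X ∧ 2 * total P ≤ total X ∧ ∀ Z ⊆ X, 2 * total Z ≤ total X → total Z ≤ total P

/-- `P` is a `(1 - δ)`-approximate solution of Partition on input `X`. -/
def IsApproxPartition (δ : ℝ) (X P : Finset ℕ) : Prop :=
  P ⊆ X ∧ ∃ Q, IsPartition X Q ∧
    (1 - δ) * (total Q : ℝ) ≤ (total P : ℝ) ∧ total P ≤ total Q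

/-! ### The algorithm

The algorithm leaves some choices open (which colliding pair is found first, which approximate
Partition solution the subroutine returns, how ties are broken). It is therefore described by the
relation between its input and its possible return values. -/

/-- The large elements of `A`. -/
def large (A : Finset ℕ) (ε : ℝ) : Finset ℕ := {s ∈ A | ε * (maxElt A : ℝ) ≤ (s : ℝ)}

/-- The small elements of `A`. -/
def small (A : Finset ℕ) (ε : ℝ) : Finset ℕ := {s ∈ A | (s : ℝ) < ε * (maxElt A : ℝ)}

/-- The `k` smallest elements of `M`. -/
def smallest (M : Finset ℕ) (k : ℕ) : Finset ℕ := ((M.sort (· ≤ ·)).take k).toFinset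

/-- The index of the bin that the sum of `X` falls into, for bins of size `ε² · max(A)`. -/
def bin (A : Finset ℕ) (ε : ℝ) (X : Finset ℕ) : ℕ :=
  ⌊(total X : ℝ) / (ε ^ 2 * (maxElt A : ℝ))⌋₊

/-- Two distinct sets of large elements whose sums fall into the same bin. -/
def Collide (A : Finset ℕ) (ε : ℝ) (X Y : Finset ℕ) : Prop :=
  X ⊆ large A ε ∧ Y ⊆ large A ε ∧ X ≠ Y ∧ bin A ε X = bin A ε Y

/-- `R` arises from `P` by greedily adding small elements of `A` in order to balance `Q`: if the
small elements suffice to close the gap, then an initial segment of them is added by which `P`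
overtakes `Q` by at most `ε · max(A)`; otherwise all of them are added. -/
def AddSmall (A : Finset ℕ) (ε : ℝ) (P Q R : Finset ℕ) : Prop :=
  if total Q ≤ total P + total (small A ε) then
    ∃ k, R = P ∪ smallest (small A ε) k ∧ total Q ≤ total R ∧
      (total R : ℝ) - (total Q : ℝ) ≤ ε * (maxElt A : ℝ)
  else R = P ∪ small A ε

/-- The sets of large elements that contain the largest element. -/
def IsLargeSubset (A : Finset ℕ) (ε : ℝ) (X : Finset ℕ) : Prop :=
  X ⊆ large A ε ∧ maxElt A ∈ X

/-- The possible return values of `ConstrainedSSR(A, ε)`: a solution from two colliding sums if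
there is a collision; otherwise the best one of the pairs obtained by solving Partition
approximately, with error margin `ε' = ε / (2 + ε)`, on each set `X` of large elements that contains
the largest element, and then adding small elements. Here `P X` is the set returned by the Partition
subroutine on input `X`, and `R X` is the result of adding small elements to it. -/
inductive ConstrainedSSR (A : Finset ℕ) (ε : ℝ) : Finset ℕ × Finset ℕ → Prop
  | collision (X Y : Finset ℕ) (h : Collide A ε X Y) : ConstrainedSSR A ε (X \ Y, Y \ X)
  | partitions (hno : ∀ X Y, ¬ Collide A ε X Y) (P R : Finset ℕ → Finset ℕ)
      (hP : ∀ X, IsLargeSubset A ε X → IsApproxPartition (ε / (2 + ε)) X (P X))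
      (hR : ∀ X, IsLargeSubset A ε X → AddSmall A ε (P X) (X \ P X) (R X))
      (X : Finset ℕ) (hX : IsLargeSubset A ε X)
      (hbest : ∀ Y, IsLargeSubset A ε Y → ratio (R X, X \ P X) ≤ ratio (R Y, Y \ P Y)) :
      ConstrainedSSR A ε (R X, X \ P X)

/-- The possible return values of `SSR(A, ε)`: the best one of the pairs `c a` that
`ConstrainedSSR` returns on the prefixes `{x ∈ A | x ≤ a}`, `a ∈ A`, of the sorted set `A`. -/
def SSR (A : Finset ℕ) (ε : ℝ) (S : Finset ℕ × Finset ℕ) : Prop :=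
  ∃ c : ℕ → Finset ℕ × Finset ℕ,
    (∀ a ∈ A, ConstrainedSSR {x ∈ A | x ≤ a} ε (c a)) ∧
    ∃ a ∈ A, S = c a ∧ ∀ b ∈ A, ratio (c a) ≤ ratio (c b)

/-- The claimed running time (up to a constant factor). -/
def timeBound (n ε : ℝ) : ℝ :=
  min (n ^ (23 / 10 : ℝ) / ε ^ (26 / 10 : ℝ) * Real.logb 2 (n / ε ^ 2))
    (min (n ^ 2 / ε ^ 3 * Real.logb 2 (n / ε ^ 2))
      (n ^ 2 / ε ^ 2 * (Real.logb 2 (n / ε ^ 2) +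
        1 / ε ^ (3 / 2 : ℝ) * Real.logb 2 (Real.logb 2 (n / ε ^ 2) / ε) ^ 2)))

end

/-! ### The machine model: a word RAM

Programs are structured programs over registers and a random access memory, both holding natural
numbers. Every elementary instruction and every test costs one step. All numbers that a
program computes have to be smaller than a bound `W` on the size of a machine word: a program that
produces a larger number gets stuck. -/

/-- The arithmetic operations (subtraction is truncated, division rounds down). -/
inductive Op
  | add | sub | mul | div

/-- The result of an arithmetic operation. -/
def Op.apply : Op → ℕ → ℕ → ℕ
  | .add, x, y => x + y
  | .sub, x, y => x - y
  | .mul, x, y => x * y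
  | .div, x, y => x / y

/-- Programs; `r`, `s`, `t` are names of registers. -/
inductive Prog
  /-- `r := c`. -/
  | const (r c : ℕ)
  /-- `r := s o t`. -/
  | arith (o : Op) (r s t : ℕ)
  /-- `r := memory[s]`. -/
  | load (r s : ℕ)
  /-- `memory[s] := t`. -/
  | store (s t : ℕ)
  /-- First `p`, then `q`. -/
  | seq (p q : Prog)
  /-- If `s < t` then `p` else `q`. -/
  | ite (s t : ℕ) (p q : Prog)
  /-- While `s < t` do `p`. -/
  | loop (s t : ℕ) (p : Prog)

/-- The contents of the registers and of the memory. -/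
structure State where
  reg : ℕ → ℕ
  mem : ℕ → ℕ

/-- The state after writing `v` to the register `r`. -/
def State.setReg (σ : State) (r v : ℕ) : State := ⟨Function.update σ.reg r v, σ.mem⟩

/-- The state after writing `v` to the memory cell `i`. -/
def State.setMem (σ : State) (i v : ℕ) : State := ⟨σ.reg, Function.update σ.mem i v⟩

/-- `Exec W p σ T τ`: with word bound `W`, the program `p` started in `σ` halts in `τ` after exactly
`T` steps. -/
inductive Exec (W : ℕ) : Prog → State → ℕ → State → Prop
  | const (σ : State) (r c : ℕ) (h : c < W) : Exec W (.const r c) σ 1 (σ.setReg r c)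
  | arith (σ : State) (o : Op) (r s t : ℕ) (h : o.apply (σ.reg s) (σ.reg t) < W) :
      Exec W (.arith o r s t) σ 1 (σ.setReg r (o.apply (σ.reg s) (σ.reg t)))
  | load (σ : State) (r s : ℕ) (h : σ.mem (σ.reg s) < W) :
      Exec W (.load r s) σ 1 (σ.setReg r (σ.mem (σ.reg s)))
  | store (σ : State) (s t : ℕ) (ha : σ.reg s < W) (h : σ.reg t < W) :
      Exec W (.store s t) σ 1 (σ.setMem (σ.reg s) (σ.reg t))
  | seq (σ τ υ : State) (p q : Prog) (T U : ℕ) (hp : Exec W p σ T τ) (hq : Exec W q τ U υ) :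
      Exec W (.seq p q) σ (T + U) υ
  | ite_pos (σ τ : State) (s t : ℕ) (p q : Prog) (T : ℕ) (h : σ.reg s < σ.reg t)
      (hp : Exec W p σ T τ) : Exec W (.ite s t p q) σ (T + 1) τ
  | ite_neg (σ τ : State) (s t : ℕ) (p q : Prog) (T : ℕ) (h : ¬ σ.reg s < σ.reg t)
      (hq : Exec W q σ T τ) : Exec W (.ite s t p q) σ (T + 1) τ
  | loop_done (σ : State) (s t : ℕ) (p : Prog) (h : ¬ σ.reg s < σ.reg t) :
      Exec W (.loop s t p) σ 1 σ
  | loop_step (σ τ υ : State) (s t : ℕ) (p : Prog) (T U : ℕ) (h : σ.reg s < σ.reg t)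
      (hp : Exec W p σ T τ) (hl : Exec W (.loop s t p) τ U υ) :
      Exec W (.loop s t p) σ (T + U + 1) υ

/-- The initial state for the set `A` and the error margin `p / q`: the registers `0`, `1`, `2` hold
`|A|`, `p`, `q`, and the memory holds the elements of `A` in increasing order, starting with cell
`0`; everything else is `0`. -/
def input (A : Finset ℕ) (p q : ℕ) : State where
  reg r := if r = 0 then A.card else if r = 1 then p else if r = 2 then q else 0
  mem i := (A.sort (· ≤ ·)).getD i 0

/-- The elements of `A` that a final state marks by `v`: the `i`-th smallest element
(counting from `0`) is marked by the content of the memory cell `i`. -/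
def marked (A : Finset ℕ) (σ : State) (v : ℕ) : Finset ℕ :=
  {x ∈ A | σ.mem {y ∈ A | y < x}.card = v}

/-- The pair of sets that a final state encodes: marks `1` and `2` stand for membership in the first
and in the second set. -/
def output (A : Finset ℕ) (σ : State) : Finset ℕ × Finset ℕ := (marked A σ 1, marked A σ 2)

/-- The magnitude of an input. A machine word holds a number bounded by a fixed power of it, that
is, it has a number of bits that is logarithmic in it. -/
def magnitude (A : Finset ℕ) (p q : ℕ) : ℕ := A.card + maxElt A + p + q

end SubsetSumRatio

/-! Approximation. Let O be an optimal pair, and consider the prefix of A whose largest element m is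
the largest element used by O. If two distinct sets of large elements collide, their sums differ by
less than ε²m. Neither set difference can be empty, so both differences have sum at least εm, and
their ratio is at most 1 + ε (`le_total_sdiff_of_collide`). Without a collision, let X be the set of
large elements used by O, and let P and Q be the parts into which the Partition step splits X. If
the small elements M close the gap between P and Q, the overshoot is at most εm ≤ εΣ(Q). Otherwise R
= P ∪ M. With z = Σ(X*), the smaller sum of O is at most z + Σ(M) and the larger one is at least
Σ(X) - z. The returned sums miss these values by factors of at worst 1 - δ and 1 + δ, where δ = ε/(2
+ ε), and (1 + δ)/(1 - δ) = 1 + ε (`ConstrainedSSR.ratio_le`). A pair with an empty side has ratio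
∞, so the best pair over all prefixes is feasible.

Running time. The subset sums of l large elements are at most lm, so without a collision the
pigeonhole principle gives 2^l ≤ l/ε² + 1 (`count_le_of_injective`). This bounds the enumeration of
subsets, and it yields l = O(log(n/ε²)) as well as l = O(1/ε²). Partition is solved exactly, for all
sets X containing m together, by meet in the middle. Subsets are bit masks, each mask is cut into a
low and a high half, the submasks of every half mask are listed in the order of their sums, and two
pointers run through the two lists of a mask. The lists have total length O(3^(l/2)). The searches
cost the sum over all masks of 2^|low| + 2^|high|, which is O(6^(l/2)) (`sum_subcount_split`,
`split_le`). Since 6^5 ≤ 2^13, this is O(l^1.3/ε^2.6) (`six_pow_le`). Evaluating the resulting pairs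
costs O(n·2^l) per prefix. Multiplied by the number of prefixes, these costs stay below each of the
three terms of the claimed minimum (`mul_six_pow_le`, `mul_logb_le_timeBound`). The first term alone
is O((n + 1/ε)^4.95) (`timeBound_le`).

Program. The code is written in a small language with variables and arrays whose runs carry a clock.
Compilation to the word RAM simulates runs and preserves the clock exactly (`Run.exec`), so
correctness and time are proved together by weakest preconditions with loop invariants (`wp_loop`).
The program keeps only the best pair seen so far. Because SSR is a relation with open choices, it
suffices that a best pair among those collected on all prefixes is a possible return value
(`SSR_of_candidateFamily`). -/

set_option linter.constructorNameAsVariable false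

namespace SubsetSumRatio

/-! ### A small imperative language on top of the word RAM -/

/-- The program variables. -/
inductive Var
  | p | q | i | m | s | l | e | cnt | hb | t | v | y | z | r | tg | j | b | mk | w1 | w2 | nu | de
  | bn | bd | g | H | unit | last | f | f0 | u | N | a | x | c | d | bm
  deriving DecidableEq

/-- The arrays; `inp` is the input array, whose length is the input size. -/
inductive Arr
  | inp | sum | bins | tab | list | num | cm | bm
  deriving DecidableEq

/-- The register of a variable. -/
def Var.reg (x : Var) : ℕ := x.ctorIdx + 1

theorem Var.reg_inj {x y : Var} (h : x.reg = y.reg) : x = y := by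
  revert h
  cases x <;> cases y <;> first | exact fun _ => rfl | exact fun h => absurd h (by decide)

theorem Var.reg_pos (x : Var) : 0 < x.reg := Nat.succ_pos _

theorem Var.reg_lt (x : Var) : x.reg < 64 := by cases x <;> decide

theorem Arr.ctorIdx_inj {a b : Arr} (h : a.ctorIdx = b.ctorIdx) : a = b := by
  revert h
  cases a <;> cases b <;> first | exact fun _ => rfl | exact fun h => absurd h (by decide)

theorem Arr.ctorIdx_lt (a : Arr) : a.ctorIdx < 16 := by cases a <;> decide

/-- Expressions. -/
inductive Expr
  | lit (c : ℕ)
  | len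
  | var (x : Var)
  | op (o : Op) (e f : Expr)
  | get (a : Arr) (e : Expr)

instance : Coe Var Expr := ⟨.var⟩
instance (n : ℕ) : OfNat Expr n := ⟨.lit n⟩
instance : Add Expr := ⟨.op .add⟩
instance : Sub Expr := ⟨.op .sub⟩
instance : Mul Expr := ⟨.op .mul⟩
instance : Div Expr := ⟨.op .div⟩

/-- The state of a program: the input length, the variables, the arrays, and a clock. -/
structure Store where
  len : ℕ
  var : Var → ℕ
  arr : Arr → ℕ → ℕ
  clk : ℕ

namespace Store

/-- Let `c` steps pass. -/
def tick (s : Store) (c : ℕ) : Store := { s with clk := s.clk + c }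

/-- Write `v` to the variable `x` in `c` steps. -/
def set (s : Store) (x : Var) (v c : ℕ) : Store :=
  { s with var := Function.update s.var x v, clk := s.clk + c }

/-- Write `v` to the cell `i` of the array `a` in `c` steps. -/
def put (s : Store) (a : Arr) (i v c : ℕ) : Store :=
  { s with arr := Function.update s.arr a (Function.update (s.arr a) i v), clk := s.clk + c }

variable (s : Store) (x y : Var) (a b : Arr) (i j v c : ℕ)

@[simp] theorem tick_len : (s.tick c).len = s.len := rfl
@[simp] theorem tick_var : (s.tick c).var = s.var := rfl
@[simp] theorem tick_arr : (s.tick c).arr = s.arr := rfl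
@[simp] theorem tick_clk : (s.tick c).clk = s.clk + c := rfl
@[simp] theorem set_len : (s.set x v c).len = s.len := rfl
@[simp] theorem set_arr : (s.set x v c).arr = s.arr := rfl
@[simp] theorem set_clk : (s.set x v c).clk = s.clk + c := rfl
@[simp] theorem put_len : (s.put a i v c).len = s.len := rfl
@[simp] theorem put_var : (s.put a i v c).var = s.var := rfl
@[simp] theorem put_clk : (s.put a i v c).clk = s.clk + c := rfl

@[simp] theorem set_var : (s.set x v c).var y = if y = x then v else s.var y := by
  simp [set, Function.update_apply]

@[simp] theorem put_arr :
    (s.put a i v c).arr b = if b = a then Function.update (s.arr a) i v else s.arr b := by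
  by_cases h : b = a
  · subst h; simp [put]
  · simp [put, h]

end Store

namespace Expr

/-- The value of an expression. -/
def eval (s : Store) : Expr → ℕ
  | lit c => c
  | len => s.len
  | var x => s.var x
  | op o e f => o.apply (e.eval s) (f.eval s)
  | get a e => s.arr a (e.eval s)

/-- Sums and products do not overflow, and the input array is read within its bounds. -/
def ok (V : ℕ) (s : Store) : Expr → Prop
  | lit c => c < V
  | len => True
  | var _ => True
  | op .add e f => e.ok V s ∧ f.ok V s ∧ e.eval s + f.eval s < V
  | op .mul e f => e.ok V s ∧ f.ok V s ∧ e.eval s * f.eval s < V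
  | op .sub e f => e.ok V s ∧ f.ok V s
  | op .div e f => e.ok V s ∧ f.ok V s
  | get a e => e.ok V s ∧ (a = .inp → e.eval s < s.len)

/-- The evaluation time. -/
def cost : Expr → ℕ
  | lit _ => 1
  | len => 2
  | var _ => 2
  | op _ e f => e.cost + f.cost + 1
  | get _ e => e.cost + 6

section
variable (V : ℕ) (s : Store) (e f : Expr) (x : Var) (a : Arr) (c : ℕ)

@[simp] theorem eval_ofNat : (no_index (OfNat.ofNat c) : Expr).eval s = OfNat.ofNat c := rfl
@[simp] theorem eval_len : Expr.len.eval s = s.len := rfl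
@[simp] theorem eval_var : (Expr.var x).eval s = s.var x := rfl
@[simp] theorem eval_add : (e + f).eval s = e.eval s + f.eval s := rfl
@[simp] theorem eval_sub : (e - f).eval s = e.eval s - f.eval s := rfl
@[simp] theorem eval_mul : (e * f).eval s = e.eval s * f.eval s := rfl
@[simp] theorem eval_div : (e / f).eval s = e.eval s / f.eval s := rfl
@[simp] theorem eval_get : (Expr.get a e).eval s = s.arr a (e.eval s) := rfl
@[simp] theorem ok_ofNat : (no_index (OfNat.ofNat c) : Expr).ok V s ↔ OfNat.ofNat c < V := Iff.rfl
@[simp] theorem ok_len : Expr.len.ok V s ↔ True := Iff.rfl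
@[simp] theorem ok_var : (Expr.var x).ok V s ↔ True := Iff.rfl
@[simp] theorem ok_add : (e + f).ok V s ↔ e.ok V s ∧ f.ok V s ∧ e.eval s + f.eval s < V := Iff.rfl
@[simp] theorem ok_mul : (e * f).ok V s ↔ e.ok V s ∧ f.ok V s ∧ e.eval s * f.eval s < V := Iff.rfl
@[simp] theorem ok_sub : (e - f).ok V s ↔ e.ok V s ∧ f.ok V s := Iff.rfl
@[simp] theorem ok_div : (e / f).ok V s ↔ e.ok V s ∧ f.ok V s := Iff.rfl
@[simp] theorem ok_get : (Expr.get a e).ok V s ↔ e.ok V s ∧ (a = .inp → e.eval s < s.len) := Iff.rfl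
@[simp] theorem cost_ofNat : (no_index (OfNat.ofNat c) : Expr).cost = 1 := rfl
@[simp] theorem cost_len : Expr.len.cost = 2 := rfl
@[simp] theorem cost_var : (Expr.var x).cost = 2 := rfl
@[simp] theorem cost_add : (e + f).cost = e.cost + f.cost + 1 := rfl
@[simp] theorem cost_sub : (e - f).cost = e.cost + f.cost + 1 := rfl
@[simp] theorem cost_mul : (e * f).cost = e.cost + f.cost + 1 := rfl
@[simp] theorem cost_div : (e / f).cost = e.cost + f.cost + 1 := rfl
@[simp] theorem cost_get : (Expr.get a e).cost = e.cost + 6 := rfl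

end

end Expr

/-- Commands. -/
inductive Cmd
  | assign (x : Var) (e : Expr)
  | put (a : Arr) (e f : Expr)
  | seq (c d : Cmd)
  | ite (e f : Expr) (c d : Cmd)
  | loop (e f : Expr) (c : Cmd)

/-- `Run V c s t`: the command `c`, started in `s`, halts in `t` (and all intermediate results are
below `V`). -/
inductive Run (V : ℕ) : Cmd → Store → Store → Prop
  | assign (s : Store) (x : Var) (e : Expr) (h : e.ok V s) :
      Run V (.assign x e) s (s.set x (e.eval s) (e.cost + 2))
  | put (s : Store) (a : Arr) (e f : Expr) (he : e.ok V s) (hf : f.ok V s)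
      (hi : a = .inp → e.eval s < s.len) :
      Run V (.put a e f) s (s.put a (e.eval s) (f.eval s) (e.cost + f.cost + 6))
  | seq (s t u : Store) (c d : Cmd) (hc : Run V c s t) (hd : Run V d t u) : Run V (.seq c d) s u
  | ite_pos (s t : Store) (e f : Expr) (c d : Cmd) (he : e.ok V s) (hf : f.ok V s)
      (h : e.eval s < f.eval s) (hc : Run V c (s.tick (e.cost + f.cost + 1)) t) :
      Run V (.ite e f c d) s t
  | ite_neg (s t : Store) (e f : Expr) (c d : Cmd) (he : e.ok V s) (hf : f.ok V s)
      (h : ¬ e.eval s < f.eval s) (hd : Run V d (s.tick (e.cost + f.cost + 1)) t) :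
      Run V (.ite e f c d) s t
  | loop_done (s : Store) (e f : Expr) (c : Cmd) (he : e.ok V s) (hf : f.ok V s)
      (h : ¬ e.eval s < f.eval s) : Run V (.loop e f c) s (s.tick (e.cost + f.cost + 1))
  | loop_step (s t u : Store) (e f : Expr) (c : Cmd) (he : e.ok V s) (hf : f.ok V s)
      (h : e.eval s < f.eval s) (hc : Run V c (s.tick (e.cost + f.cost + 1)) t)
      (hl : Run V (.loop e f c) t u) : Run V (.loop e f c) s u

/-! ### Compilation -/

/-- The address of the cell `i` of the array `a`, for input length `n`. -/
def addr (n : ℕ) (a : Arr) (i : ℕ) : ℕ :=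
  i * (if a = .inp then 1 else 16) + a.ctorIdx + (if a = .inp then 0 else n)

/-- The input array keeps the cells below n. All other arrays are interleaved with stride 16 from
cell n on, so the residue of the shifted address modulo 16 determines the array. The bound on input
indices keeps the two regions apart. -/
theorem addr_inj {n : ℕ} {a b : Arr} {i j : ℕ} (hi : a = .inp → i < n) (hj : b = .inp → j < n)
    (h : addr n a i = addr n b j) : a = b ∧ i = j := by
  have ha := a.ctorIdx_lt
  have hb := b.ctorIdx_lt
  have h0 : Arr.inp.ctorIdx = 0 := rfl
  unfold addr at h
  by_cases hai : a = .inp <;> by_cases hbi : b = .inp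
  · simp only [hai, hbi, if_true] at h
    exact ⟨hai.trans hbi.symm, by omega⟩
  · have := hi hai
    simp only [hai, hbi, if_true, if_false] at h
    omega
  · have := hj hbi
    simp only [hai, hbi, if_true, if_false] at h
    omega
  · simp only [hai, hbi, if_false] at h
    have : a.ctorIdx = b.ctorIdx := by omega
    exact ⟨Arr.ctorIdx_inj this, by omega⟩

/-- Turns the index in the register `r` into an address. -/
def addrCode (a : Arr) (r : ℕ) : Prog :=
  .seq (.const (r + 1) (if a = .inp then 1 else 16)) <| .seq (.arith .mul r r (r + 1)) <|
    .seq (.const (r + 1) a.ctorIdx) <| .seq (.arith .add r r (r + 1)) <|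
      -- For the input array the register `r + 1` holds its constructor index 0, so nothing is
      -- added. For the other arrays the offset is register 0, the input length.
      .arith .add r r (if a = .inp then r + 1 else 0)

/-- Evaluates an expression into the register `r`. -/
def Expr.compile : Expr → ℕ → Prog
  | .lit c, r => .const r c
  | .len, r => .seq (.const r 0) (.arith .add r r 0)
  | .var x, r => .seq (.const r 0) (.arith .add r r x.reg)
  | .op o e f, r => .seq (e.compile r) (.seq (f.compile (r + 1)) (.arith o r r (r + 1)))
  | .get a e, r => .seq (e.compile r) (.seq (addrCode a r) (.load r r))

/-- Compiles a command. -/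
def Cmd.compile : Cmd → Prog
  | .assign x e => .seq (e.compile 64) (.seq (.const 65 0) (.arith .add x.reg 64 65))
  | .put a e f =>
      .seq (f.compile 64) (.seq (e.compile 65) (.seq (addrCode a 65) (.store 65 64)))
  | .seq c d => .seq c.compile d.compile
  | .ite e f c d => .seq (.seq (e.compile 64) (f.compile 65)) (.ite 64 65 c.compile d.compile)
  | .loop e f c => .seq (.seq (e.compile 64) (f.compile 65))
      (.loop 64 65 (.seq c.compile (.seq (e.compile 64) (f.compile 65))))

/-- The machine state `σ` represents the program state `s`. -/
structure Rel (V : ℕ) (σ : State) (s : Store) : Prop where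
  len : σ.reg 0 = s.len
  var : ∀ x : Var, σ.reg x.reg = s.var x
  arr : ∀ a i, (a = .inp → i < s.len) → σ.mem (addr s.len a i) = s.arr a i
  len_lt : s.len < V
  var_lt : ∀ x, s.var x < V
  arr_lt : ∀ a i, s.arr a i < V

theorem Expr.eval_lt {V : ℕ} {σ : State} {s : Store} (hr : Rel V σ s) :
    ∀ e : Expr, e.ok V s → e.eval s < V
  | .lit _, h => h
  | .len, _ => hr.len_lt
  | .var x, _ => hr.var_lt x
  | .op .add _ _, h => h.2.2
  | .op .mul _ _, h => h.2.2
  | .op .sub e _, h => (Nat.sub_le _ _).trans_lt (e.eval_lt hr h.1)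
  | .op .div e _, h => (Nat.div_le_self _ _).trans_lt (e.eval_lt hr h.1)
  | .get a _, _ => hr.arr_lt a _

/-- With index and input length below V, every intermediate value is at most 16V + 16 + V. This is
where the requirement 18V + 32 ≤ W comes from. -/
theorem exec_addrCode {W V : ℕ} (hW : 18 * V + 32 ≤ W) {σ : State} (a : Arr) {r : ℕ} (hr : 0 < r)
    (hn : σ.reg 0 < V) (hi : σ.reg r < V) : ∃ τ, Exec W (addrCode a r) σ 5 τ ∧ τ.mem = σ.mem ∧
      (∀ k < r, τ.reg k = σ.reg k) ∧ τ.reg r = addr (σ.reg 0) a (σ.reg r) := by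
  have ha := a.ctorIdx_lt
  have h0 : (0 : ℕ) ≠ r := by omega
  by_cases h : a = .inp
  · subst h
    refine ⟨_, Exec.seq _ _ _ _ _ 1 4 (.const _ _ _ ?_) (.seq _ _ _ _ _ 1 3 (.arith _ _ _ _ _ ?_)
      (.seq _ _ _ _ _ 1 2 (.const _ _ _ ?_) (.seq _ _ _ _ _ 1 1 (.arith _ _ _ _ _ ?_)
      (.arith _ _ _ _ _ ?_)))), rfl, ?_, ?_⟩
    rotate_right 2
    · intro k hk
      have h1 : k ≠ r := by omega
      have h2 : k ≠ r + 1 := by omega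
      simp [State.setReg, h1, h2]
    · simp [State.setReg, Op.apply, addr]
      rfl
    all_goals try simp [State.setReg, Op.apply]
    all_goals omega
  · refine ⟨_, Exec.seq _ _ _ _ _ 1 4 (.const _ _ _ ?_) (.seq _ _ _ _ _ 1 3 (.arith _ _ _ _ _ ?_)
      (.seq _ _ _ _ _ 1 2 (.const _ _ _ ?_) (.seq _ _ _ _ _ 1 1 (.arith _ _ _ _ _ ?_)
      (.arith _ _ _ _ _ ?_)))), rfl, ?_, ?_⟩
    rotate_right 2
    · intro k hk
      have h1 : k ≠ r := by omega
      have h2 : k ≠ r + 1 := by omega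
      simp [State.setReg, h1, h2]
    · simp [State.setReg, Op.apply, addr, h, h0]
    all_goals try simp [State.setReg, Op.apply, h, h0]
    all_goals omega

/-- Registers from 64 on are scratch space for evaluating expressions and represent nothing. -/
theorem Rel.congr {V : ℕ} {σ τ : State} {s : Store} (h : Rel V σ s) (hm : τ.mem = σ.mem)
    (hr : ∀ k < 64, τ.reg k = σ.reg k) : Rel V τ s where
  len := (hr 0 (by norm_num)).trans h.len
  var x := (hr _ x.reg_lt).trans (h.var x)
  arr a i hi := by rw [hm]; exact h.arr a i hi
  len_lt := h.len_lt
  var_lt := h.var_lt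
  arr_lt := h.arr_lt

theorem exec_expr {W V : ℕ} (hW : 18 * V + 32 ≤ W) {s : Store} (e : Expr) :
    ∀ {σ : State} (_ : Rel V σ s) {r : ℕ} (_ : 64 ≤ r) (_ : e.ok V s),
      ∃ τ, Exec W (e.compile r) σ e.cost τ ∧ τ.mem = σ.mem ∧
        (∀ k < r, τ.reg k = σ.reg k) ∧ τ.reg r = e.eval s := by
  have key : ∀ {σ : State} {r k v : ℕ}, 64 ≤ r → k < 64 → σ.reg k = v → v < V →
      ∃ τ, Exec W (.seq (.const r 0) (.arith .add r r k)) σ 2 τ ∧ τ.mem = σ.mem ∧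
        (∀ k < r, τ.reg k = σ.reg k) ∧ τ.reg r = v := by
    intro σ r k v hr hk hv hvV
    have hkr : k ≠ r := by omega
    refine ⟨_, .seq _ _ _ _ _ 1 1 (.const _ _ _ (by omega)) (.arith _ _ _ _ _ ?_), rfl, ?_, ?_⟩
    · simp [State.setReg, Op.apply, hkr, hv]; omega
    · intro k' hk'
      have : k' ≠ r := by omega
      simp [State.setReg, this]
    · simp [State.setReg, Op.apply, hkr, hv]
  induction e with
  | lit c =>
    intro σ hσ r hr hok
    have hc : c < V := hok
    refine ⟨_, .const _ _ _ (by omega), rfl, ?_, ?_⟩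
    · intro k hk
      have : k ≠ r := by omega
      simp [State.setReg, this]
    · simp [State.setReg, Expr.eval]
  | len =>
    intro σ hσ r hr _
    exact key hr (by norm_num) hσ.len hσ.len_lt
  | var x =>
    intro σ hσ r hr _
    exact key hr x.reg_lt (hσ.var x) (hσ.var_lt x)
  | op o e f he hf =>
    intro σ hσ r hr hok
    have hoe : e.ok V s := by cases o <;> exact hok.1
    have hof : f.ok V s := by
      cases o
      · exact hok.2.1
      · exact hok.2
      · exact hok.2.1
      · exact hok.2
    obtain ⟨τ, hτ, hm, hk, hv⟩ := he hσ hr hoe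
    have hστ : Rel V τ s := hσ.congr hm fun k hk' => hk k (by omega)
    obtain ⟨υ, hυ, hm', hk', hv'⟩ := hf hστ (r := r + 1) (by omega) hof
    have hvr : υ.reg r = e.eval s := by rw [hk' r (by omega), hv]
    have hlt := Expr.eval_lt hσ _ hok
    have happ : o.apply (υ.reg r) (υ.reg (r + 1)) = (Expr.op o e f).eval s := by
      rw [hvr, hv']; rfl
    refine ⟨υ.setReg r (o.apply (υ.reg r) (υ.reg (r + 1))), ?_, hm'.trans hm, ?_,
      happ ▸ Function.update_self _ _ _⟩
    · have : (Expr.op o e f).cost = e.cost + (f.cost + 1) := by simp [Expr.cost, Nat.add_assoc]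
      rw [this]
      exact .seq _ _ _ _ _ _ _ hτ (.seq _ _ _ _ _ _ _ hυ (.arith _ _ _ _ _ (by omega)))
    · intro k hkr
      have : k ≠ r := by omega
      simp only [State.setReg, Function.update_of_ne this]
      rw [hk' k (by omega), hk k hkr]
  | get a e he =>
    intro σ hσ r hr hok
    obtain ⟨τ, hτ, hm, hk, hv⟩ := he hσ hr hok.1
    have hστ : Rel V τ s := hσ.congr hm fun k hk' => hk k (by omega)
    have hlt := Expr.eval_lt hσ _ hok.1
    obtain ⟨υ, hυ, hm', hk', hv'⟩ := exec_addrCode hW a (σ := τ) (r := r) (by omega)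
      (by rw [hστ.len]; exact hσ.len_lt) (by rw [hv]; exact hlt)
    have hval : υ.mem (υ.reg r) = s.arr a (e.eval s) := by
      rw [hm', hv', hστ.len, hv]
      exact hστ.arr _ _ hok.2
    have hlt' := hσ.arr_lt a (e.eval s)
    refine ⟨υ.setReg r (υ.mem (υ.reg r)), ?_, ?_, ?_, ?_⟩
    · have : (Expr.get a e).cost = e.cost + (5 + 1) := by simp [Expr.cost]
      rw [this]
      exact .seq _ _ _ _ _ _ _ hτ (.seq _ _ _ _ _ _ _ hυ (.load _ _ _ (by omega)))
    · exact hm'.trans hm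
    · intro k hkr
      have : k ≠ r := by omega
      simp only [State.setReg, Function.update_of_ne this]
      rw [hk' k (by omega), hk k hkr]
    · simp only [State.setReg, Function.update_self]
      exact hval

theorem exec_two {W V : ℕ} (hW : 18 * V + 32 ≤ W) {s : Store} {e f : Expr} {σ : State}
    (hσ : Rel V σ s) (he : e.ok V s) (hf : f.ok V s) (r : ℕ) (hr : 64 ≤ r) :
    ∃ τ, Exec W (.seq (e.compile r) (f.compile (r + 1))) σ (e.cost + f.cost) τ ∧ τ.mem = σ.mem ∧
      (∀ k < r, τ.reg k = σ.reg k) ∧ τ.reg r = e.eval s ∧ τ.reg (r + 1) = f.eval s := by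
  obtain ⟨τ, hτ, hm, hk, hv⟩ := exec_expr hW e hσ hr he
  obtain ⟨υ, hυ, hm', hk', hv'⟩ := exec_expr hW f (σ := τ)
    (hσ.congr hm fun k hk' => hk k (by omega)) (r := r + 1) (by omega) hf
  exact ⟨υ, .seq _ _ _ _ _ _ _ hτ hυ, hm'.trans hm,
    fun k hk'' => (hk' k (by omega)).trans (hk k hk''), (hk' r (by omega)).trans hv, hv'⟩

theorem Rel.tick {V : ℕ} {σ : State} {s : Store} (h : Rel V σ s) (c : ℕ) : Rel V σ (s.tick c) :=
  ⟨h.len, h.var, h.arr, h.len_lt, h.var_lt, h.arr_lt⟩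

/-- The compiled program simulates the command, and the clock counts its steps. -/
theorem Run.exec {W V : ℕ} (hW : 18 * V + 32 ≤ W) {c : Cmd} {s t : Store} (h : Run V c s t) :
    ∀ {σ : State}, Rel V σ s → ∃ T τ, Exec W c.compile σ T τ ∧ Rel V τ t ∧ t.clk = s.clk + T := by
  induction h with
  | assign s x e hok =>
    intro σ hσ
    obtain ⟨τ, hτ, hm, hk, hv⟩ := exec_expr hW e hσ le_rfl hok
    have hlt := Expr.eval_lt hσ _ hok
    have hx := x.reg_lt
    have hσ' : Rel V τ s := hσ.congr hm hk
    refine ⟨_, _, .seq _ _ _ _ _ _ _ hτ (.seq _ _ _ _ _ 1 1 (.const _ _ _ (by omega))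
      (.arith _ _ _ _ _ ?_)), ⟨?_, ?_, ?_, hσ.len_lt, ?_, hσ.arr_lt⟩, rfl⟩
    · simp [State.setReg, Op.apply, hv]; omega
    · have : (0 : ℕ) ≠ x.reg := x.reg_pos.ne
      simp [State.setReg, this, hσ'.len]
    · intro y
      have hy := y.reg_lt
      by_cases hyx : y = x
      · subst hyx; simp [State.setReg, Op.apply, hv]
      · have h1 : y.reg ≠ x.reg := fun h => hyx (Var.reg_inj h)
        have h2 : y.reg ≠ 65 := by omega
        simp [State.setReg, hyx, h1, h2, hσ'.var]
    · exact hσ'.arr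
    · intro y
      rw [Store.set_var]
      split_ifs
      · exact hlt
      · exact hσ.var_lt y
  | put s a e f he hf hi =>
    intro σ hσ
    obtain ⟨τ₀, h1, hm₀, hk₀, hv₀⟩ := exec_expr hW f hσ le_rfl hf
    have hσ₀ : Rel V τ₀ s := hσ.congr hm₀ hk₀
    obtain ⟨τ, h2, hm, hk, hv'⟩ := exec_expr hW e hσ₀ (r := 65) (by norm_num) he
    have hv : τ.reg 64 = f.eval s := (hk 64 (by norm_num)).trans hv₀
    have hlt := Expr.eval_lt hσ _ hf
    have hlt' := Expr.eval_lt hσ _ he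
    have hσ' : Rel V τ s := hσ₀.congr hm fun k hk' => hk k (by omega)
    obtain ⟨υ, hυ, hm', hk', hv''⟩ := exec_addrCode hW a (σ := τ) (r := 65) (by omega)
      (by rw [hσ'.len]; exact hσ.len_lt) (by rw [hv']; exact hlt')
    have hσ'' : Rel V υ s := hσ'.congr hm' fun k hk => hk' k (by omega)
    have hadd : addr s.len a (e.eval s) < W := by
      have := a.ctorIdx_lt
      have := hσ.len_lt
      unfold addr; split_ifs <;> omega
    rw [hσ'.len, hv'] at hv''
    have hv3 : υ.reg 64 = f.eval s := (hk' 64 (by omega)).trans hv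
    refine ⟨_, _, .seq _ _ _ _ _ _ _ h1 (.seq _ _ _ _ _ _ _ h2 (.seq _ _ _ _ _ _ _ hυ
      (.store _ _ _ (by omega) (by omega)))), ⟨?_, ?_, ?_, hσ.len_lt, hσ.var_lt, ?_⟩, ?_⟩
    · exact hσ''.len
    · exact hσ''.var
    · intro b j hj
      simp only [Store.put_len, State.setMem] at *
      rw [hv'', hv3]
      by_cases hab : b = a ∧ j = e.eval s
      · obtain ⟨rfl, rfl⟩ := hab
        simp
      · have : addr s.len b j ≠ addr s.len a (e.eval s) := fun h => hab (addr_inj hj hi h)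
        rw [Function.update_of_ne this, hσ''.arr b j hj, Store.put_arr]
        split_ifs with hb
        · subst hb
          rw [Function.update_of_ne]
          exact fun h => hab ⟨rfl, h⟩
        · rfl
    · intro b j
      rw [Store.put_arr]
      split_ifs with hb
      · rw [Function.update_apply]
        split_ifs
        · exact hlt
        · exact hσ.arr_lt _ _
      · exact hσ.arr_lt _ _
    · simp only [Store.put_clk]; omega
  | seq s t u c d _ _ ihc ihd =>
    intro σ hσ
    obtain ⟨T, τ, h1, h2, h3⟩ := ihc hσ
    obtain ⟨U, υ, h4, h5, h6⟩ := ihd h2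
    exact ⟨_, υ, .seq _ _ _ _ _ _ _ h1 h4, h5, by omega⟩
  | ite_pos s t e f c d he hf hlt _ ih =>
    intro σ hσ
    obtain ⟨τ, hτ, hm, hk, hv, hv'⟩ := exec_two hW hσ he hf 64 le_rfl
    obtain ⟨T, υ, h1, h2, h3⟩ := ih ((hσ.congr hm hk).tick _)
    exact ⟨_, υ, .seq _ _ _ _ _ _ _ hτ (.ite_pos _ _ _ _ _ _ _ (by rw [hv, hv']; exact hlt) h1), h2,
      by simp only [Store.tick_clk] at h3; omega⟩
  | ite_neg s t e f c d he hf hlt _ ih =>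
    intro σ hσ
    obtain ⟨τ, hτ, hm, hk, hv, hv'⟩ := exec_two hW hσ he hf 64 le_rfl
    obtain ⟨T, υ, h1, h2, h3⟩ := ih ((hσ.congr hm hk).tick _)
    exact ⟨_, υ, .seq _ _ _ _ _ _ _ hτ (.ite_neg _ _ _ _ _ _ _ (by rw [hv, hv']; exact hlt) h1), h2,
      by simp only [Store.tick_clk] at h3; omega⟩
  | loop_done s e f c he hf hlt =>
    intro σ hσ
    obtain ⟨τ, hτ, hm, hk, hv, hv'⟩ := exec_two hW hσ he hf 64 le_rfl
    exact ⟨_, τ, .seq _ _ _ _ _ _ _ hτ (.loop_done _ _ _ _ (by rw [hv, hv']; exact hlt)),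
      (hσ.congr hm hk).tick _, rfl⟩
  | loop_step s t u e f c he hf hlt _ _ ih ihl =>
    intro σ hσ
    obtain ⟨τ, hτ, hm, hk, hv, hv'⟩ := exec_two hW hσ he hf 64 le_rfl
    obtain ⟨T, υ, h1, h2, h3⟩ := ih ((hσ.congr hm hk).tick _)
    obtain ⟨U, ω, h4, h5, h6⟩ := ihl h2
    -- The compiled loop evaluates its test again at the end of the body, whereas the simulated
    -- remaining loop begins with that evaluation. Splitting the latter run allows its first half to
    -- be moved into the body.
    cases h4 with
    | seq _ υ' _ _ _ U₁ U₂ h7 h8 =>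
    exact ⟨_, ω, .seq _ _ _ _ _ _ _ hτ (.loop_step _ _ _ _ _ _ _ _ (by rw [hv, hv']; exact hlt)
      (.seq _ _ _ _ _ _ _ h1 h7) h8), h5, by simp only [Store.tick_clk] at h3; omega⟩

/-! ### Weakest preconditions -/

/-- From `s`, the command `c` halts in a state with property `Q`. -/
def wp (V : ℕ) (c : Cmd) (s : Store) (Q : Store → Prop) : Prop := ∃ t, Run V c s t ∧ Q t

section wp
variable {V : ℕ} {s : Store} {Q R : Store → Prop}

theorem wp.mono {c : Cmd} (h : wp V c s Q) (hQ : ∀ t, Q t → R t) : wp V c s R :=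
  let ⟨t, ht, hq⟩ := h
  ⟨t, ht, hQ t hq⟩

theorem wp_assign {x : Var} {e : Expr} :
    wp V (.assign x e) s Q ↔ e.ok V s ∧ Q (s.set x (e.eval s) (e.cost + 2)) := by
  constructor
  · rintro ⟨t, ht, hq⟩
    cases ht with
    | assign _ _ _ h => exact ⟨h, hq⟩
  · exact fun h => ⟨_, .assign _ _ _ h.1, h.2⟩

theorem wp_put {a : Arr} {e f : Expr} : wp V (.put a e f) s Q ↔ e.ok V s ∧ f.ok V s ∧
    (a = .inp → e.eval s < s.len) ∧ Q (s.put a (e.eval s) (f.eval s) (e.cost + f.cost + 6)) := by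
  constructor
  · rintro ⟨t, ht, hq⟩
    cases ht with
    | put _ _ _ _ h h' h'' => exact ⟨h, h', h'', hq⟩
  · exact fun h => ⟨_, .put _ _ _ _ h.1 h.2.1 h.2.2.1, h.2.2.2⟩

theorem wp_seq {c d : Cmd} : wp V (.seq c d) s Q ↔ wp V c s fun t => wp V d t Q := by
  constructor
  · rintro ⟨u, hu, hq⟩
    cases hu with
    | seq _ t _ _ _ h h' => exact ⟨t, h, u, h', hq⟩
  · rintro ⟨t, ht, u, hu, hq⟩
    exact ⟨u, .seq _ _ _ _ _ ht hu, hq⟩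

theorem wp_ite {e f : Expr} {c d : Cmd} : wp V (.ite e f c d) s Q ↔ e.ok V s ∧ f.ok V s ∧
    (e.eval s < f.eval s → wp V c (s.tick (e.cost + f.cost + 1)) Q) ∧
    (f.eval s ≤ e.eval s → wp V d (s.tick (e.cost + f.cost + 1)) Q) := by
  constructor
  · rintro ⟨t, ht, hq⟩
    cases ht with
    | ite_pos _ _ _ _ _ _ h h' h'' hc =>
      exact ⟨h, h', fun _ => ⟨_, hc, hq⟩, fun h3 => absurd h'' (not_lt.2 h3)⟩
    | ite_neg _ _ _ _ _ _ h h' h'' hc =>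
      exact ⟨h, h', fun h3 => absurd h3 h'', fun _ => ⟨_, hc, hq⟩⟩
  · rintro ⟨h, h', h1, h2⟩
    rcases lt_or_ge (e.eval s) (f.eval s) with hlt | hge
    · obtain ⟨t, ht, hq⟩ := h1 hlt
      exact ⟨t, .ite_pos _ _ _ _ _ _ h h' hlt ht, hq⟩
    · obtain ⟨t, ht, hq⟩ := h2 hge
      exact ⟨t, .ite_neg _ _ _ _ _ _ h h' (not_lt.2 hge) ht, hq⟩

/-- The variables that a command may change. -/
def Cmd.vars : Cmd → List Var
  | .assign x _ => [x]
  | .put _ _ _ => []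
  | .seq c d => c.vars ++ d.vars
  | .ite _ _ c d => c.vars ++ d.vars
  | .loop _ _ c => c.vars

/-- The arrays that a command may change. -/
def Cmd.arrs : Cmd → List Arr
  | .assign _ _ => []
  | .put a _ _ => [a]
  | .seq c d => c.arrs ++ d.arrs
  | .ite _ _ c d => c.arrs ++ d.arrs
  | .loop _ _ c => c.arrs

/-- `t` differs from `s` only in what `c` may change. -/
structure Frame (c : Cmd) (s t : Store) : Prop where
  len : t.len = s.len
  var : ∀ x, x ∉ c.vars → t.var x = s.var x
  arr : ∀ a, a ∉ c.arrs → t.arr a = s.arr a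

theorem Frame.refl (c : Cmd) (s : Store) : Frame c s s := ⟨rfl, fun _ _ => rfl, fun _ _ => rfl⟩

theorem Frame.trans {c : Cmd} {s t u : Store} (h : Frame c s t) (h' : Frame c t u) : Frame c s u :=
  ⟨h'.len.trans h.len, fun x hx => (h'.var x hx).trans (h.var x hx),
    fun x hx => (h'.arr x hx).trans (h.arr x hx)⟩

theorem Frame.weaken {c d : Cmd} {s t : Store} (h : Frame c s t) (hv : c.vars ⊆ d.vars)
    (ha : c.arrs ⊆ d.arrs) : Frame d s t :=
  ⟨h.len, fun x hx => h.var x fun h => hx (hv h), fun x hx => h.arr x fun h => hx (ha h)⟩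

theorem Frame.of_tick {c : Cmd} {s t : Store} {k : ℕ} (h : Frame c (s.tick k) t) : Frame c s t :=
  ⟨h.len, h.var, h.arr⟩

/-- Whether a name is assigned is decidable from the syntax. Loop invariants therefore need to
mention only what the body changes; everything else is recovered by `decide`. -/
theorem Run.frame {c : Cmd} {s t : Store} (h : Run V c s t) : Frame c s t := by
  induction h with
  | assign s x e _ =>
    refine ⟨rfl, fun y hy => ?_, fun _ _ => rfl⟩
    have : y ≠ x := fun h => hy (by simp [Cmd.vars, h])
    simp [this]
  | put s a e f _ _ _ =>
    refine ⟨rfl, fun _ _ => rfl, fun b hb => ?_⟩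
    have : b ≠ a := fun h => hb (by simp [Cmd.arrs, h])
    simp [this]
  | seq s t u c d _ _ h h' =>
    exact (h.weaken (by simp [Cmd.vars]) (by simp [Cmd.arrs])).trans
      (h'.weaken (by simp [Cmd.vars]) (by simp [Cmd.arrs]))
  | ite_pos s t e f c d _ _ _ _ h =>
    exact h.of_tick.weaken (by simp [Cmd.vars]) (by simp [Cmd.arrs])
  | ite_neg s t e f c d _ _ _ _ h =>
    exact h.of_tick.weaken (by simp [Cmd.vars]) (by simp [Cmd.arrs])
  | loop_done s e f c _ _ _ => exact ⟨rfl, fun _ _ => rfl, fun _ _ => rfl⟩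
  | loop_step s t u e f c _ _ _ _ _ h h' => exact Frame.trans ⟨h.len, h.var, h.arr⟩ h'

theorem wp.frame {c : Cmd} (h : wp V c s Q) : wp V c s fun t => Frame c s t ∧ Q t :=
  let ⟨t, ht, hq⟩ := h
  ⟨t, ht, ht.frame, hq⟩

/-- The rule for loops, with an invariant `I` and a decreasing quantity `μ`. -/
theorem wp_loop {e f : Expr} {c : Cmd} (I : Store → Prop) (μ : Store → ℕ) (h0 : I s)
    (hI : ∀ t, Frame c s t → I t → e.ok V t ∧ f.ok V t ∧
      (e.eval t < f.eval t → wp V c (t.tick (e.cost + f.cost + 1)) fun u =>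
        Frame c s u → I u ∧ μ u < μ t) ∧
      (f.eval t ≤ e.eval t → Q (t.tick (e.cost + f.cost + 1)))) :
    wp V (.loop e f c) s Q := by
  suffices ∀ k t, μ t = k → Frame c s t → I t → wp V (.loop e f c) t Q from
    this _ s rfl (Frame.refl _ _) h0
  intro k
  induction k using Nat.strong_induction_on with
  | _ k ih =>
  intro t hk hf ht
  obtain ⟨h1, h2, h3, h4⟩ := hI t hf ht
  rcases lt_or_ge (e.eval t) (f.eval t) with hlt | hge
  · obtain ⟨u, hu, hq⟩ := h3 hlt
    have hfu : Frame c s u := hf.trans hu.frame.of_tick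
    obtain ⟨hIu, hμ⟩ := hq hfu
    obtain ⟨w, hw, hq⟩ := ih _ (hk ▸ hμ) u rfl hfu hIu
    exact ⟨w, .loop_step _ _ _ _ _ _ h1 h2 hlt hu hw, hq⟩
  · exact ⟨_, .loop_done _ _ _ _ h1 h2 (not_lt.2 hge), h4 hge⟩

end wp

end SubsetSumRatio

namespace SubsetSumRatio

/-! ### The approximation guarantee -/

theorem le_maxElt {A : Finset ℕ} {x : ℕ} (h : x ∈ A) : x ≤ maxElt A := Finset.le_sup (f := id) h

theorem maxElt_mem {A : Finset ℕ} (h : A.Nonempty) : maxElt A ∈ A := by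
  obtain ⟨x, hx, h⟩ := Finset.exists_mem_eq_sup A h id
  exact (show maxElt A = x from h) ▸ hx

theorem maxElt_filter_le {A : Finset ℕ} {a : ℕ} (ha : a ∈ A) : maxElt {x ∈ A | x ≤ a} = a :=
  le_antisymm (Finset.sup_le fun _ hx => (Finset.mem_filter.1 hx).2)
    (le_maxElt (Finset.mem_filter.2 ⟨ha, le_rfl⟩))

theorem total_mono {S T : Finset ℕ} (h : S ⊆ T) : total S ≤ total T :=
  Finset.sum_le_sum_of_subset h

theorem le_total_of_mem {S : Finset ℕ} {x : ℕ} (h : x ∈ S) : x ≤ total S :=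
  Finset.single_le_sum (f := fun x : ℕ => x) (fun _ _ => Nat.zero_le _) h

theorem total_union {S T : Finset ℕ} (h : Disjoint S T) : total (S ∪ T) = total S + total T :=
  Finset.sum_union h

theorem total_union_le (S T : Finset ℕ) : total (S ∪ T) ≤ total S + total T := by
  have := Finset.sum_union_inter (s₁ := S) (s₂ := T) (f := fun x : ℕ => x)
  unfold total
  omega

theorem total_sdiff {S T : Finset ℕ} (h : S ⊆ T) : total (T \ S) + total S = total T :=
  Finset.sum_sdiff h

theorem total_sdiff_add_inter (S T : Finset ℕ) : total (S \ T) + total (S ∩ T) = total S := by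
  rw [← Finset.sdiff_inter_self_left S T]
  exact total_sdiff Finset.inter_subset_left

theorem total_pos {A S : Finset ℕ} (h0 : 0 ∉ A) (hS : S ⊆ A) (hne : S.Nonempty) : 0 < total S := by
  obtain ⟨x, hx⟩ := hne
  have : x ≠ 0 := fun h => h0 (h ▸ hS hx)
  have := le_total_of_mem hx
  omega

/-- The larger one of the two sums. -/
def maxSum (S : Finset ℕ × Finset ℕ) : ℕ := max (total S.1) (total S.2)

/-- The smaller one of the two sums. -/
def minSum (S : Finset ℕ × Finset ℕ) : ℕ := min (total S.1) (total S.2)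

/-- Cross-multiplication replaces quotients in `ℝ≥0∞` by real inequalities. If `minSum T` is 0, then
`h` forces `maxSum T` to be 0 as well, and 0/0 is 0. -/
theorem ratio_le_mul {S T : Finset ℕ × Finset ℕ} {c : ℝ} (hc : 0 ≤ c) (hS : 0 < minSum S)
    (h : (maxSum T : ℝ) * minSum S ≤ c * maxSum S * minSum T) :
    ratio T ≤ ENNReal.ofReal c * ratio S := by
  have hS' : (0 : ℝ) < minSum S := by exact_mod_cast hS
  refine ENNReal.div_le_of_le_mul ?_
  have h1 : ratio S = ENNReal.ofReal ((maxSum S : ℝ) / minSum S) := by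
    rw [ENNReal.ofReal_div_of_pos hS', ENNReal.ofReal_natCast, ENNReal.ofReal_natCast]
    rfl
  rw [h1, ← ENNReal.ofReal_mul hc]
  change (maxSum T : ℝ≥0∞) ≤ _ * (minSum T : ℝ≥0∞)
  rw [← ENNReal.ofReal_natCast (maxSum T), ← ENNReal.ofReal_natCast (minSum T),
    ← ENNReal.ofReal_mul (by positivity)]
  refine ENNReal.ofReal_le_ofReal ?_
  have : c * (↑(maxSum S) / ↑(minSum S)) * ↑(minSum T) =
      (c * maxSum S * minSum T) / (minSum S : ℝ) := by ring
  rw [this, le_div_iff₀ hS']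
  exact h

theorem ratio_eq_top {S : Finset ℕ × Finset ℕ} (h0 : minSum S = 0) (h : 0 < maxSum S) :
    ratio S = ⊤ := by
  have h1 : ratio S = (maxSum S : ℝ≥0∞) / (minSum S : ℝ≥0∞) := rfl
  rw [h1, h0, Nat.cast_zero, ENNReal.div_zero]
  exact_mod_cast h.ne'

theorem minSum_pos {A : Finset ℕ} (h0 : 0 ∉ A) {S : Finset ℕ × Finset ℕ} (h : IsFeasible A S) :
    0 < minSum S :=
  lt_min (total_pos h0 h.1 h.2.2.2.1) (total_pos h0 h.2.1 h.2.2.2.2)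

theorem ratio_ne_top {S : Finset ℕ × Finset ℕ} (h : 0 < minSum S) : ratio S ≠ ⊤ := by
  have h1 : ratio S = (maxSum S : ℝ≥0∞) / (minSum S : ℝ≥0∞) := rfl
  rw [h1]
  refine ENNReal.div_ne_top (ENNReal.natCast_ne_top _) ?_
  exact_mod_cast h.ne'

section constrained
variable {A : Finset ℕ} {ε : ℝ}

theorem disjoint_large_small : Disjoint (large A ε) (small A ε) := by
  rw [Finset.disjoint_left]
  intro x hx hx'
  exact absurd (Finset.mem_filter.1 hx').2 (not_lt.2 (Finset.mem_filter.1 hx).2)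

theorem large_union_small : large A ε ∪ small A ε = A := by
  ext x
  simp only [large, small, Finset.mem_union, Finset.mem_filter]
  rcases le_or_gt (ε * (maxElt A : ℝ)) x with h | h
  · simp [h, not_lt.2 h]
  · simp [h, not_le.2 h]

theorem large_subset : large A ε ⊆ A := Finset.filter_subset _ _

theorem small_subset : small A ε ⊆ A := Finset.filter_subset _ _

theorem smallest_subset (M : Finset ℕ) (k : ℕ) : smallest M k ⊆ M := by
  intro x hx
  rw [smallest, List.mem_toFinset] at hx
  exact (Finset.mem_sort _).1 (List.mem_of_mem_take hx)

theorem AddSmall.subset {P Q R : Finset ℕ} (h : AddSmall A ε P Q R) : R ⊆ P ∪ small A ε := by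
  unfold AddSmall at h
  split_ifs at h
  · obtain ⟨k, rfl, -⟩ := h
    exact Finset.union_subset_union le_rfl (smallest_subset _ _)
  · exact h.subset

theorem IsApproxPartition.two_mul_le {δ : ℝ} {X P : Finset ℕ} (h : IsApproxPartition δ X P) :
    2 * total P ≤ total X := by
  obtain ⟨-, Q, hQ, -, h⟩ := h
  have := hQ.2.1
  omega

theorem Collide.symm {X Y : Finset ℕ} (h : Collide A ε X Y) : Collide A ε Y X :=
  ⟨h.2.1, h.1, h.2.2.1.symm, h.2.2.2.symm⟩

theorem maxElt_pos (h0 : 0 ∉ A) (hne : A.Nonempty) : 0 < maxElt A :=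
  Nat.pos_of_ne_zero fun h => h0 (h ▸ maxElt_mem hne)

variable (h0 : 0 ∉ A) (hne : A.Nonempty) (hε : 0 < ε) (hε1 : ε < 1)
include h0 hne hε

/-- Sums in the same bin are close to each other. -/
theorem sub_lt_of_bin_eq {X Y : Finset ℕ} (h : bin A ε X = bin A ε Y) :
    (total X : ℝ) - total Y < ε ^ 2 * maxElt A := by
  have hm : (0 : ℝ) < maxElt A := by exact_mod_cast maxElt_pos h0 hne
  have hw : 0 < ε ^ 2 * (maxElt A : ℝ) := by positivity
  have h1 := Nat.lt_floor_add_one ((total X : ℝ) / (ε ^ 2 * maxElt A))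
  have h2 := Nat.floor_le (show 0 ≤ (total Y : ℝ) / (ε ^ 2 * maxElt A) by positivity)
  unfold bin at h
  rw [h] at h1
  have h3 : (total X : ℝ) / (ε ^ 2 * maxElt A) - total Y / (ε ^ 2 * maxElt A) < 1 := by linarith
  rw [← sub_div, div_lt_one hw] at h3
  exact h3

include hε1

/-- Every nonempty set of large elements has sum at least εm. If X \ Y were empty, then X ⊂ Y and
the sums would differ by at least εm, whereas sums in one bin differ by less than ε²m < εm. -/
theorem le_total_sdiff_of_collide {X Y : Finset ℕ} (h : Collide A ε X Y) :
    ε * maxElt A ≤ total (X \ Y) := by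
  obtain ⟨hX, hY, hXY, hb⟩ := h
  have hm : (0 : ℝ) < maxElt A := by exact_mod_cast maxElt_pos h0 hne
  have hlarge : ∀ Z ⊆ large A ε, Z.Nonempty → ε * maxElt A ≤ total Z := by
    rintro Z hZ ⟨z, hz⟩
    have h1 := (Finset.mem_filter.1 (hZ hz)).2
    have h2 : (z : ℝ) ≤ total Z := by exact_mod_cast le_total_of_mem hz
    linarith
  by_contra hlt
  have hXsub : X \ Y = ∅ := by
    by_contra hne'
    exact hlt (hlarge _ (Finset.sdiff_subset.trans hX) (Finset.nonempty_iff_ne_empty.2 hne'))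
  have hsub : X ⊆ Y := Finset.sdiff_eq_empty_iff_subset.1 hXsub
  have hYne : (Y \ X).Nonempty := by
    rw [Finset.sdiff_nonempty]
    exact fun h => hXY (hsub.antisymm h)
  have h1 := hlarge _ (Finset.sdiff_subset.trans hY) hYne
  have h2 := sub_lt_of_bin_eq h0 hne hε hb.symm
  have h3 : (total (Y \ X) : ℝ) + total X = total Y := by exact_mod_cast total_sdiff hsub
  nlinarith [mul_pos (mul_pos hε hm) (sub_pos.2 hε1)]

/-- The returned sets are disjoint, and the second one is not empty. -/
theorem ConstrainedSSR.subset {T : Finset ℕ × Finset ℕ} (h : ConstrainedSSR A ε T) :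
    T.1 ⊆ A ∧ T.2 ⊆ A ∧ Disjoint T.1 T.2 ∧ 0 < total T.2 := by
  have hm := maxElt_pos h0 hne
  cases h with
  | collision X Y h =>
    refine ⟨Finset.sdiff_subset.trans (h.1.trans large_subset),
      Finset.sdiff_subset.trans (h.2.1.trans large_subset), disjoint_sdiff_sdiff, ?_⟩
    have h1 := le_total_sdiff_of_collide h0 hne hε hε1 (h.symm)
    have hm' : (0 : ℝ) < maxElt A := by exact_mod_cast hm
    have : (0 : ℝ) < total (Y \ X) := by nlinarith
    exact_mod_cast this
  | partitions _ P R hP hR X hX _ =>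
    have hPX := (hP X hX).1
    refine ⟨(hR X hX).subset.trans (Finset.union_subset (hPX.trans (hX.1.trans large_subset))
      small_subset), Finset.sdiff_subset.trans (hX.1.trans large_subset), ?_, ?_⟩
    · refine Finset.disjoint_of_subset_left (hR X hX).subset ?_
      rw [Finset.disjoint_union_left]
      exact ⟨Finset.disjoint_sdiff,
        (disjoint_large_small.mono_left (Finset.sdiff_subset.trans hX.1)).symm⟩
    · have h1 := (hP X hX).two_mul_le
      have h2 := total_sdiff hPX
      have h3 := le_total_of_mem hX.2
      simp only
      omega

/-- Compared with a solution that uses the largest element, the returned pair is good. -/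
theorem ConstrainedSSR.ratio_le {S T : Finset ℕ × Finset ℕ} (hS : IsFeasible A S)
    (hmS : maxElt A ∈ S.1 ∪ S.2) (h : ConstrainedSSR A ε T) :
    ratio T ≤ ENNReal.ofReal (1 + ε) * ratio S := by
  have hmS0 := minSum_pos h0 hS
  have hm : (0 : ℝ) < maxElt A := by exact_mod_cast maxElt_pos h0 hne
  have of_le : ∀ T : Finset ℕ × Finset ℕ, (total T.1 : ℝ) ≤ (1 + ε) * total T.2 →
      (total T.2 : ℝ) ≤ (1 + ε) * total T.1 → ratio T ≤ ENNReal.ofReal (1 + ε) * ratio S := by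
    intro T h1 h2
    refine ratio_le_mul (by linarith) hmS0 ?_
    have h3 : (maxSum T : ℝ) ≤ (1 + ε) * minSum T := by
      have ha : (0 : ℝ) ≤ total T.1 := Nat.cast_nonneg _
      have hb : (0 : ℝ) ≤ total T.2 := Nat.cast_nonneg _
      unfold maxSum minSum
      push_cast
      rcases le_total (total T.1 : ℝ) (total T.2) with h | h
      · rw [max_eq_right h, min_eq_left h]; exact h2
      · rw [max_eq_left h, min_eq_right h]; exact h1
    have h4 : (minSum S : ℝ) ≤ maxSum S := by exact_mod_cast min_le_max
    calc (maxSum T : ℝ) * minSum S ≤ ((1 + ε) * minSum T) * maxSum S := by gcongr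
      _ = _ := by ring
  cases h with
  | collision X Y h =>
    have h1 := le_total_sdiff_of_collide h0 hne hε hε1 h
    have h2 := le_total_sdiff_of_collide h0 hne hε hε1 (h.symm)
    have h3 := sub_lt_of_bin_eq h0 hne hε h.2.2.2
    have h4 := sub_lt_of_bin_eq h0 hne hε h.2.2.2.symm
    have h5 : (total (X \ Y) : ℝ) + total (X ∩ Y) = total X := by
      exact_mod_cast total_sdiff_add_inter X Y
    have h6 : (total (Y \ X) : ℝ) + total (X ∩ Y) = total Y := by
      rw [Finset.inter_comm]
      exact_mod_cast total_sdiff_add_inter Y X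
    -- The common part X ∩ Y cancels: the difference of the two sums is below ε·(εm), and εm is at
    -- most either sum.
    apply of_le <;> simp only <;> nlinarith
  | partitions _ P R hP hR X₁ hX₁ hbest =>
    -- The algorithm has also treated the set of large elements used by S, and its best pair is no
    -- worse than the pair obtained from that set.
    have hX : IsLargeSubset A ε ((S.1 ∪ S.2) ∩ large A ε) := by
      refine ⟨Finset.inter_subset_right, Finset.mem_inter.2 ⟨hmS, ?_⟩⟩
      refine Finset.mem_filter.2 ⟨maxElt_mem hne, ?_⟩
      nlinarith
    refine (hbest _ hX).trans ?_
    generalize hXdef : (S.1 ∪ S.2) ∩ large A ε = X at hX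
    obtain ⟨hPX, Z, hZ, hPZ, hPZ'⟩ := hP X hX
    have hadd := hR X hX
    have htwo := (hP X hX).two_mul_le
    generalize R X = R at hadd
    generalize P X = P at *
    have hQ := total_sdiff hPX
    have hmX := le_total_of_mem hX.2
    unfold AddSmall at hadd
    split_ifs at hadd with hif
    · obtain ⟨k, -, h1, h2⟩ := hadd
      have h3 : (total P : ℝ) + total P ≤ total X := by exact_mod_cast (by omega)
      -- If the largest element lies in P, then Σ(P) ≥ m, and Σ(Q) ≥ Σ(P) because P has at most half
      -- of the sum of X. Hence an overshoot of εm is at most εΣ(Q).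
      have hmQ : (maxElt A : ℝ) ≤ total (X \ P) := by
        have : maxElt A ≤ total (X \ P) := by
          by_cases hmP : maxElt A ∈ P
          · have := le_total_of_mem hmP
            omega
          · exact le_total_of_mem (Finset.mem_sdiff.2 ⟨hX.2, hmP⟩)
        exact_mod_cast this
      have h1' : (total (X \ P) : ℝ) ≤ total R := by exact_mod_cast h1
      apply of_le <;> simp only <;> nlinarith
    · subst hadd
      have hPM : total (P ∪ small A ε) = total P + total (small A ε) :=
        total_union (disjoint_large_small.mono_left (hPX.trans hX.1))
      -- the two parts of `X` in the given solution
      have key : ∀ U V : Finset ℕ, Disjoint U V → U ⊆ A → (U ∪ V) ∩ large A ε = X →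
          total (U ∩ large A ε) ≤ total (V ∩ large A ε) →
          total U ≤ total Z + total (small A ε) ∧ total X ≤ total V + total Z := by
        intro U V hUV hU hUVX hle
        have hd : Disjoint (U ∩ large A ε) (V ∩ large A ε) :=
          hUV.mono Finset.inter_subset_left Finset.inter_subset_left
        have h1 : total X = total (U ∩ large A ε) + total (V ∩ large A ε) := by
          rw [← total_union hd, ← Finset.union_inter_distrib_right, hUVX]
        -- The lighter of the two parts of X is feasible for Partition.
        have h2 : total (U ∩ large A ε) ≤ total Z := by
          refine hZ.2.2 _ ?_ (by omega)
          rw [← hUVX]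
          exact Finset.inter_subset_inter_right Finset.subset_union_left
        have h3 : total U ≤ total (U ∩ large A ε) + total (small A ε) := by
          refine (total_mono ?_).trans (total_union_le _ _)
          intro x hx
          have := hU hx
          rw [← large_union_small (A := A) (ε := ε), Finset.mem_union] at this
          rcases this with h | h
          · exact Finset.mem_union_left _ (Finset.mem_inter.2 ⟨hx, h⟩)
          · exact Finset.mem_union_right _ h
        have h4 : total (V ∩ large A ε) ≤ total V := total_mono Finset.inter_subset_left
        omega
      have key' : minSum S ≤ total Z + total (small A ε) ∧ total X ≤ maxSum S + total Z := by
        unfold minSum maxSum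
        rcases le_total (total (S.1 ∩ large A ε)) (total (S.2 ∩ large A ε)) with h | h
        · have := key _ _ hS.2.2.1 hS.1 hXdef h
          omega
        · have := key _ _ hS.2.2.1.symm hS.2.1 (by rw [Finset.union_comm]; exact hXdef) h
          omega
      have hlt : total (P ∪ small A ε) ≤ total (X \ P) := by omega
      refine ratio_le_mul (by linarith) hmS0 ?_
      have e1 : maxSum (P ∪ small A ε, X \ P) = total (X \ P) := max_eq_right hlt
      have e2 : minSum (P ∪ small A ε, X \ P) = total (P ∪ small A ε) := min_eq_left hlt
      rw [e1, e2, hPM]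
      have hZ2 := hZ.2.1
      have r1 : (minSum S : ℝ) ≤ total Z + total (small A ε) := by exact_mod_cast key'.1
      have r2 : (total X : ℝ) ≤ maxSum S + total Z := by exact_mod_cast key'.2
      have r3 : (total (X \ P) : ℝ) + total P = total X := by exact_mod_cast hQ
      have r4 : (total Z : ℝ) + total Z ≤ total X := by exact_mod_cast (by omega)
      push_cast
      have hM0 : (0 : ℝ) ≤ total (small A ε) := Nat.cast_nonneg _
      have hZ0 : (0 : ℝ) ≤ total Z := Nat.cast_nonneg _
      have hP0 : (0 : ℝ) ≤ total P := Nat.cast_nonneg _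
      have hS0 : (0 : ℝ) ≤ minSum S := Nat.cast_nonneg _
      have hδ : ε / (2 + ε) * (2 + ε) = ε := div_mul_cancel₀ _ (by linarith)
      have hδ0 : 0 ≤ ε / (2 + ε) := by positivity
      generalize ε / (2 + ε) = δ at *
      generalize (total (small A ε) : ℝ) = M at *
      generalize (total Z : ℝ) = z at *
      generalize (total P : ℝ) = p at *
      generalize (total (X \ P) : ℝ) = q at *
      generalize (total X : ℝ) = x at *
      generalize (minSum S : ℝ) = a at *
      generalize (maxSum S : ℝ) = b at *
      have hδ1 : 0 ≤ 1 - δ := by nlinarith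
      -- Here q = x - p ≤ (x - z) + δz, and z ≤ x - z because z is at most half of x.
      have hq : q ≤ (1 + δ) * (x - z) := by nlinarith
      have hb : x - z ≤ b := by linarith
      have hx : 0 ≤ x - z := by linarith
      calc q * a ≤ ((1 + δ) * (x - z)) * (z + M) := by gcongr
        _ = (1 + ε) * (x - z) * ((1 - δ) * (z + M)) := by
          -- This identity is the reason for the error margin δ = ε/(2 + ε).
          have : 1 + δ = (1 + ε) * (1 - δ) := by linarith
          rw [this]; ring
        _ ≤ (1 + ε) * b * (p + M) := by
          gcongr
          all_goals nlinarith [mul_nonneg hδ0 hM0]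

end constrained

/-! ### Existence of runs, and runs described by families of candidate pairs -/

section exists_run
variable {A : Finset ℕ} {ε : ℝ}

theorem exists_isPartition (X : Finset ℕ) : ∃ P, IsPartition X P := by
  obtain ⟨P, hP, hmax⟩ := Finset.exists_max_image (X.powerset.filter fun Z => 2 * total Z ≤ total X)
    total ⟨∅, Finset.mem_filter.2 ⟨Finset.empty_mem_powerset _, by simp [total]⟩⟩
  simp only [Finset.mem_filter, Finset.mem_powerset] at hP hmax
  exact ⟨P, hP.1, hP.2, fun Z hZ h => hmax Z ⟨hZ, h⟩⟩

theorem IsPartition.isApproxPartition {X P : Finset ℕ} (h : IsPartition X P) {δ : ℝ} (hδ : 0 ≤ δ) :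
    IsApproxPartition δ X P :=
  ⟨h.1, P, h, by nlinarith [(Nat.cast_nonneg (total P) : (0 : ℝ) ≤ _)], le_rfl⟩

theorem total_smallest (M : Finset ℕ) (k : ℕ) :
    total (smallest M k) = ((M.sort (· ≤ ·)).take k).sum := by
  unfold total smallest
  rw [List.sum_toFinset _ ((Finset.sort_nodup _ _).sublist (List.take_sublist _ _))]
  simp

theorem smallest_card (M : Finset ℕ) : smallest M M.card = M := by
  unfold smallest
  rw [List.take_of_length_le (by simp)]
  simp

/-- The least k with which P overtakes Q works: for k = 0 there is no overshoot because Σ(P) ≤ Σ(Q),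
and otherwise the overshoot is at most the last small element added, which is below εm. -/
theorem exists_addSmall {X P : Finset ℕ} (hX : X ⊆ large A ε) (hPX : P ⊆ X)
    (h2 : 2 * total P ≤ total X) (hε : 0 ≤ ε) : ∃ R, AddSmall A ε P (X \ P) R := by
  unfold AddSmall
  split_ifs with hif
  swap
  · exact ⟨_, rfl⟩
  have hPQ := total_sdiff hPX
  have hd : ∀ k, total (P ∪ smallest (small A ε) k) =
      total P + ((Finset.sort (small A ε) (· ≤ ·)).take k).sum := fun k => by
    rw [total_union, total_smallest]
    exact disjoint_large_small.mono (hPX.trans hX) (smallest_subset _ _)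
  have hex : ∃ k, total (X \ P) ≤ total (P ∪ smallest (small A ε) k) := by
    refine ⟨(small A ε).card, hif.trans_eq ?_⟩
    rw [hd, ← total_smallest, smallest_card]
  refine ⟨_, Nat.find hex, rfl, Nat.find_spec hex, ?_⟩
  have hm0 : (0 : ℝ) ≤ ε * maxElt A := mul_nonneg hε (Nat.cast_nonneg _)
  rcases hk : Nat.find hex with _ | k
  · have : total (P ∪ smallest (small A ε) 0) ≤ total (X \ P) := by
      rw [hd]; simp; omega
    have : (total (P ∪ smallest (small A ε) 0) : ℝ) ≤ total (X \ P) := by exact_mod_cast this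
    linarith
  · have hlt := Nat.find_min hex (m := k) (by omega)
    have hle := Nat.find_spec hex
    rw [hk] at hle
    rw [hd] at hle hlt
    rw [hd]
    by_cases hkl : k < (Finset.sort (small A ε) (· ≤ ·)).length
    · rw [List.sum_take_succ _ _ hkl] at hle ⊢
      have hmem : (Finset.sort (small A ε) (· ≤ ·))[k] ∈ small A ε :=
        (Finset.mem_sort _).1 (List.getElem_mem hkl)
      have h3 := (Finset.mem_filter.1 hmem).2
      have h4 : ((total P + ((Finset.sort (small A ε) (· ≤ ·)).take k).sum : ℕ) : ℝ) ≤
        total (X \ P) := by exact_mod_cast (not_le.1 hlt).le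
      push_cast at h4 ⊢
      linarith
    · rw [List.take_of_length_le (by omega)] at hle hlt
      exact absurd hle hlt

/-- `F` is the set of all pairs obtained in a run of `ConstrainedSSR`. -/
def CandidateFamily (A : Finset ℕ) (ε : ℝ) (F : Set (Finset ℕ × Finset ℕ)) : Prop :=
  (∃ S ∈ F, ConstrainedSSR A ε S) ∧
    ∀ S ∈ F, (∀ T ∈ F, ratio S ≤ ratio T) → ConstrainedSSR A ε S

/-- The pair `S` is obtained from the set `X` of large elements. -/
def IsCandidate (A : Finset ℕ) (ε : ℝ) (X : Finset ℕ) (S : Finset ℕ × Finset ℕ) : Prop :=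
  ∃ P R, IsApproxPartition (ε / (2 + ε)) X P ∧ AddSmall A ε P (X \ P) R ∧ S = (R, X \ P)

theorem candidateFamily_of_collide {X Y : Finset ℕ} (h : Collide A ε X Y) :
    CandidateFamily A ε {(X \ Y, Y \ X)} := by
  refine ⟨⟨_, rfl, .collision X Y h⟩, ?_⟩
  rintro S rfl -
  exact .collision X Y h

/-- Describes the non-collision case without choice functions: it is enough to collect at least one
pair for each X and nothing but such pairs. This is all that an incremental program can guarantee.
-/
theorem candidateFamily_of_forall_not_collide (hne : A.Nonempty) (hε1 : ε ≤ 1)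
    (hno : ∀ X Y, ¬ Collide A ε X Y) {F : Set (Finset ℕ × Finset ℕ)}
    (h1 : ∀ X, IsLargeSubset A ε X → ∃ S ∈ F, IsCandidate A ε X S)
    (h2 : ∀ S ∈ F, ∃ X, IsLargeSubset A ε X ∧ IsCandidate A ε X S) : CandidateFamily A ε F := by
  have h1' : ∀ X, ∃ P R, IsLargeSubset A ε X → IsApproxPartition (ε / (2 + ε)) X P ∧
      AddSmall A ε P (X \ P) R ∧ (R, X \ P) ∈ F := by
    intro X
    by_cases hX : IsLargeSubset A ε X
    · obtain ⟨S, hS, P, R, hP, hR, rfl⟩ := h1 X hX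
      exact ⟨P, R, fun _ => ⟨hP, hR, hS⟩⟩
    · exact ⟨∅, ∅, fun h => absurd h hX⟩
  choose P R hPR using h1'
  constructor
  · classical
    obtain ⟨X, hX, hmin⟩ := Finset.exists_min_image
      ((large A ε).powerset.filter fun X => maxElt A ∈ X) (fun X => ratio (R X, X \ P X)) (by
        refine ⟨{maxElt A}, Finset.mem_filter.2 ⟨Finset.mem_powerset.2 ?_, by simp⟩⟩
        rw [Finset.singleton_subset_iff]
        refine Finset.mem_filter.2 ⟨maxElt_mem hne, ?_⟩
        exact mul_le_of_le_one_left (Nat.cast_nonneg _) hε1)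
    simp only [Finset.mem_filter, Finset.mem_powerset] at hX hmin
    exact ⟨_, (hPR X hX).2.2, .partitions hno P R (fun X hX => (hPR X hX).1)
      (fun X hX => (hPR X hX).2.1) X hX hmin⟩
  · intro S hS hmin
    obtain ⟨X, hX, P₁, R₁, hP₁, hR₁, rfl⟩ := h2 S hS
    -- The arbitrary choice functions are redefined at the one set X from which S stems, so that S
    -- becomes the pair chosen there.
    have := ConstrainedSSR.partitions (A := A) (ε := ε) hno (Function.update P X P₁)
      (Function.update R X R₁) ?_ ?_ X hX ?_
    · simpa using this
    · intro Y hY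
      by_cases hYX : Y = X
      · subst hYX; simpa using hP₁
      · simpa [hYX] using (hPR Y hY).1
    · intro Y hY
      by_cases hYX : Y = X
      · subst hYX; simpa using hR₁
      · simpa [hYX] using (hPR Y hY).2.1
    · intro Y hY
      by_cases hYX : Y = X
      · subst hYX; simp
      · simpa [hYX] using hmin _ (hPR Y hY).2.2

theorem exists_candidateFamily (hne : A.Nonempty) (hε : 0 < ε) (hε1 : ε ≤ 1) :
    ∃ F, CandidateFamily A ε F := by
  by_cases h : ∃ X Y, Collide A ε X Y
  · obtain ⟨X, Y, h⟩ := h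
    exact ⟨_, candidateFamily_of_collide h⟩
  · push Not at h
    refine ⟨{S | ∃ X, IsLargeSubset A ε X ∧ IsCandidate A ε X S},
      candidateFamily_of_forall_not_collide hne hε1 h ?_ fun S hS => hS⟩
    intro X hX
    obtain ⟨P, hP⟩ := exists_isPartition X
    have hP' := hP.isApproxPartition (δ := ε / (2 + ε)) (by positivity)
    obtain ⟨R, hR⟩ := exists_addSmall hX.1 hP.1 hP.2.1 hε.le
    have hc : IsCandidate A ε X (R, X \ P) := ⟨P, R, hP', hR, rfl⟩
    exact ⟨_, ⟨X, hX, hc⟩, hc⟩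

/-- The best pair among all those obtained on the prefixes is a possible return value. -/
theorem SSR_of_candidateFamily {F : ℕ → Set (Finset ℕ × Finset ℕ)}
    (hF : ∀ a ∈ A, CandidateFamily {x ∈ A | x ≤ a} ε (F a)) {a : ℕ} (ha : a ∈ A)
    {S : Finset ℕ × Finset ℕ} (hS : S ∈ F a) (hmin : ∀ b ∈ A, ∀ T ∈ F b, ratio S ≤ ratio T) :
    SSR A ε S := by
  have h1 : ∀ b, ∃ T, b ∈ A → T ∈ F b ∧ ConstrainedSSR {x ∈ A | x ≤ b} ε T := by
    intro b
    by_cases hb : b ∈ A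
    · obtain ⟨T, hT, h⟩ := (hF b hb).1
      exact ⟨T, fun _ => ⟨hT, h⟩⟩
    · exact ⟨(∅, ∅), fun h => absurd h hb⟩
  choose c hc using h1
  refine ⟨Function.update c a S, fun b hb => ?_, a, ha, by simp, fun b hb => ?_⟩
  · by_cases hba : b = a
    · subst hba
      simpa using (hF b hb).2 S hS fun T hT => hmin b hb T hT
    · simpa [hba] using (hc b hb).2
  · by_cases hba : b = a
    · subst hba; simp
    · simpa [hba] using hmin b hb _ (hc b hb).1

theorem exists_SSR (hne : A.Nonempty) (hε : 0 < ε) (hε1 : ε ≤ 1) : ∃ S, SSR A ε S := by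
  have h1 : ∀ b, ∃ T, b ∈ A → ConstrainedSSR {x ∈ A | x ≤ b} ε T := by
    intro b
    by_cases hb : b ∈ A
    · obtain ⟨F, ⟨T, -, hT⟩, -⟩ := exists_candidateFamily (A := {x ∈ A | x ≤ b}) (ε := ε)
        ⟨b, by simp [hb]⟩ hε hε1
      exact ⟨T, fun _ => hT⟩
    · exact ⟨(∅, ∅), fun h => absurd h hb⟩
  choose c hc using h1
  obtain ⟨a, ha, hmin⟩ := Finset.exists_min_image A (fun a => ratio (c a)) hne
  exact ⟨_, c, hc, a, ha, rfl, hmin⟩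

/-- Every run of the algorithm returns a `(1 + ε)`-approximate solution. -/
theorem SSR.isApproxSolution {S : Finset ℕ × Finset ℕ} (h0 : 0 ∉ A) (hcard : 2 ≤ A.card)
    (hε : 0 < ε) (hε1 : ε < 1) (h : SSR A ε S) : IsApproxSolution A ε S := by
  -- There are finitely many feasible pairs, so the infimum is attained by some O.
  have hfin : (ratio '' {S | IsFeasible A S}).Finite := by
    refine Set.Finite.image _ (((A.powerset ×ˢ A.powerset).finite_toSet).subset ?_)
    intro S hS
    simp [hS.1, hS.2.1]
  have hnef : (ratio '' {S | IsFeasible A S}).Nonempty := by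
    obtain ⟨a, ha, b, hb, hab⟩ := Finset.one_lt_card.1 hcard
    exact ⟨_, ({a}, {b}), ⟨by simpa, by simpa, by simpa, by simp, by simp⟩, rfl⟩
  obtain ⟨O, hO, hOr⟩ := hnef.csInf_mem hfin
  change ratio O = optRatio A at hOr
  obtain ⟨c, hc, a, ha, rfl, hmin⟩ := h
  have hU : (O.1 ∪ O.2).Nonempty := hO.2.2.2.1.mono Finset.subset_union_left
  have hmU := maxElt_mem hU
  have hmA : maxElt (O.1 ∪ O.2) ∈ A := Finset.union_subset hO.1 hO.2.1 hmU
  have hle : ratio (c a) ≤ ENNReal.ofReal (1 + ε) * ratio O := by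
    -- The relevant prefix ends at the largest element that O uses; O is feasible there and contains
    -- the maximum.
    refine (hmin _ hmA).trans ((hc _ hmA).ratio_le ?_ ?_ hε hε1 ?_ ?_)
    · simp [h0]
    · exact ⟨_, Finset.mem_filter.2 ⟨hmA, le_rfl⟩⟩
    · refine ⟨fun x hx => Finset.mem_filter.2 ⟨hO.1 hx, le_maxElt (Finset.mem_union_left _ hx)⟩,
        fun x hx => Finset.mem_filter.2 ⟨hO.2.1 hx, le_maxElt (Finset.mem_union_right _ hx)⟩,
        hO.2.2⟩
    · rw [maxElt_filter_le hmA]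
      exact hmU
  obtain ⟨h1, h2, h3, h4⟩ := (hc a ha).subset
    (A := {x ∈ A | x ≤ a}) (by simp [h0]) ⟨a, Finset.mem_filter.2 ⟨ha, le_rfl⟩⟩ hε hε1
  refine ⟨⟨h1.trans (Finset.filter_subset _ _), h2.trans (Finset.filter_subset _ _), h3, ?_, ?_⟩,
    hOr ▸ hle⟩
  · rw [Finset.nonempty_iff_ne_empty]
    intro hempty
    -- The second set has positive sum, so an empty first set would give ratio ∞, against the finite
    -- bound just proved.
    have : ratio (c a) = ⊤ := ratio_eq_top (by simp [minSum, hempty, total])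
      (h4.trans_le (le_max_right _ _))
    rw [this, top_le_iff] at hle
    exact ENNReal.mul_ne_top ENNReal.ofReal_ne_top (ratio_ne_top (minSum_pos h0 hO)) hle
  · rw [Finset.nonempty_iff_ne_empty]
    intro hempty
    rw [hempty] at h4
    simp [total] at h4

end exists_run

end SubsetSumRatio

namespace SubsetSumRatio

/-! ### Bit masks -/

/-- The positions of the ones in the binary representation. -/
def bits (v : ℕ) : Finset ℕ := {t ∈ Finset.range v | v.testBit t}

theorem mem_bits {v t : ℕ} : t ∈ bits v ↔ v.testBit t = true := by
  simp only [bits, Finset.mem_filter, Finset.mem_range, and_iff_right_iff_imp]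
  intro h
  exact Nat.lt_two_pow_self.trans_le (Nat.ge_two_pow_of_testBit h)

theorem bits_injective {v w : ℕ} (h : bits v = bits w) : v = w :=
  Nat.eq_of_testBit_eq fun t => by
    have : t ∈ bits v ↔ t ∈ bits w := by rw [h]
    rw [mem_bits, mem_bits] at this
    exact Bool.eq_iff_iff.2 this

@[simp] theorem bits_zero : bits 0 = ∅ := rfl

theorem lt_of_mem_bits {v l t : ℕ} (h : v < 2 ^ l) (ht : t ∈ bits v) : t < l := by
  by_contra hlt
  have h1 := Nat.ge_two_pow_of_testBit (mem_bits.1 ht)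
  have h2 : 2 ^ l ≤ 2 ^ t := Nat.pow_le_pow_right (by norm_num) (not_lt.1 hlt)
  omega

theorem lt_two_pow_of_bits {v l : ℕ} (h : ∀ t ∈ bits v, t < l) : v < 2 ^ l :=
  Nat.lt_pow_two_of_testBit v fun t ht => by
    by_contra hne
    exact absurd (h t (mem_bits.2 (by simpa using hne))) (not_lt.2 ht)

/-- No carry occurs because u lies below the new top bit. This recursion on the top bit drives the
enumeration of sums, the counting of submasks and the merging of lists. -/
theorem bits_two_pow_add {t u : ℕ} (hu : u < 2 ^ t) : bits (2 ^ t + u) = insert t (bits u) := by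
  ext k
  have h := Nat.testBit_two_pow_mul_add 1 hu k
  rw [mul_one] at h
  rw [Finset.mem_insert, mem_bits, mem_bits, h]
  split_ifs with hk
  · simp [hk.ne]
  · have : u.testBit k = false :=
      Nat.testBit_lt_two_pow (hu.trans_le (Nat.pow_le_pow_right (by norm_num) (not_lt.1 hk)))
    rw [this]
    rcases (not_lt.1 hk).eq_or_lt with h | h
    · subst h; simp
    · have h1 : k ≠ t := h.ne'
      have h2 : k - t ≠ 0 := by omega
      simp [h1, Nat.testBit_one_eq_true_iff_self_eq_zero, h2]

theorem notMem_bits {t u : ℕ} (hu : u < 2 ^ t) : t ∉ bits u := fun h =>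
  lt_irrefl _ (lt_of_mem_bits hu h)

theorem exists_bits_eq {l : ℕ} : ∀ {S : Finset ℕ}, S ⊆ Finset.range l → ∃ v < 2 ^ l, bits v = S := by
  induction l with
  | zero =>
    intro S hS
    exact ⟨0, by simp, (Finset.subset_empty.1 (by simpa using hS)).symm ▸ bits_zero⟩
  | succ l ih =>
    intro S hS
    have hsub : S.erase l ⊆ Finset.range l := by
      intro t ht
      have h1 := Finset.mem_range.1 (hS (Finset.mem_of_mem_erase ht))
      have h2 := Finset.ne_of_mem_erase ht
      exact Finset.mem_range.2 (by omega)
    obtain ⟨v, hv, hvS⟩ := ih hsub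
    have h2 : 2 ^ (l + 1) = 2 ^ l + 2 ^ l := by ring
    by_cases hl : l ∈ S
    · exact ⟨2 ^ l + v, by omega, by rw [bits_two_pow_add hv, hvS, Finset.insert_erase hl]⟩
    · exact ⟨v, by omega, by rw [hvS, Finset.erase_eq_of_notMem hl]⟩

theorem bits_add {h c d : ℕ} (hc : c < 2 ^ h) :
    bits (c + 2 ^ h * d) = bits c ∪ bits (2 ^ h * d) := by
  ext k
  have h0 := Nat.testBit_two_pow_mul_add d (Nat.two_pow_pos h) k
  rw [add_zero] at h0
  rw [Finset.mem_union, mem_bits, mem_bits, mem_bits, add_comm, Nat.testBit_two_pow_mul_add d hc, h0]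
  split_ifs with hk
  · simp
  · have : c.testBit k = false :=
      Nat.testBit_lt_two_pow (hc.trans_le (Nat.pow_le_pow_right (by norm_num) (not_lt.1 hk)))
    simp [this]

theorem disjoint_bits {h c d : ℕ} (hc : c < 2 ^ h) : Disjoint (bits c) (bits (2 ^ h * d)) := by
  rw [Finset.disjoint_left]
  intro k hk hk'
  have hkh := lt_of_mem_bits hc hk
  have h0 := Nat.testBit_two_pow_mul_add d (Nat.two_pow_pos h) k
  rw [add_zero, if_pos hkh] at h0
  rw [mem_bits, h0] at hk'
  simp at hk'

theorem bits_mod (h v : ℕ) : bits (v % 2 ^ h) = (bits v).filter (· < h) := by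
  ext k
  simp [mem_bits, Nat.testBit_mod_two_pow, and_comm]

theorem bits_mul_div (h v : ℕ) : bits (2 ^ h * (v / 2 ^ h)) = (bits v).filter (h ≤ ·) := by
  ext k
  have h0 := Nat.testBit_two_pow_mul_add (v / 2 ^ h) (Nat.two_pow_pos h) k
  rw [add_zero] at h0
  rw [Finset.mem_filter, mem_bits, mem_bits, h0]
  split_ifs with hk
  · simp [hk]
  · rw [Nat.testBit_div_two_pow, Nat.sub_add_cancel (not_lt.1 hk)]
    simp [not_lt.1 hk]

/-- The number of subsets of the set encoded by a mask. -/
def subcount (v : ℕ) : ℕ := 2 ^ (bits v).card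

theorem subcount_pos (v : ℕ) : 0 < subcount v := Nat.two_pow_pos _

theorem subcount_two_pow_add {t u : ℕ} (hu : u < 2 ^ t) :
    subcount (2 ^ t + u) = subcount u + subcount u := by
  rw [subcount, bits_two_pow_add hu, Finset.card_insert_of_notMem (notMem_bits hu), pow_succ,
    subcount]
  ring

theorem subcount_le {v l : ℕ} (h : v < 2 ^ l) : subcount v ≤ 2 ^ l := by
  refine Nat.pow_le_pow_right (by norm_num) ?_
  have : bits v ⊆ Finset.range l := fun t ht => Finset.mem_range.2 (lt_of_mem_bits h ht)
  simpa using Finset.card_le_card this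

/-- Counts pairs of a mask and a submask on t positions: each position is in neither, in the mask
only, or in both. In the induction the new top bit keeps the old sum and adds twice the old sum. The
factor 2^h shifts everything to the high half. -/
theorem sum_subcount (h t : ℕ) : ∑ k ∈ Finset.range (2 ^ t), subcount (2 ^ h * k) = 3 ^ t := by
  induction t with
  | zero => simp [subcount]
  | succ t ih =>
    have h2 : 2 ^ (t + 1) = 2 ^ t + 2 ^ t := by ring
    have h3 : ∀ k ∈ Finset.range (2 ^ t), subcount (2 ^ h * (2 ^ t + k)) =
        subcount (2 ^ h * k) + subcount (2 ^ h * k) := by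
      intro k hk
      have : 2 ^ h * (2 ^ t + k) = 2 ^ (h + t) + 2 ^ h * k := by ring
      rw [this, subcount_two_pow_add]
      rw [pow_add]
      exact Nat.mul_lt_mul_of_pos_left (Finset.mem_range.1 hk) (Nat.two_pow_pos h)
    rw [h2, Finset.sum_range_add, Finset.sum_congr rfl h3, Finset.sum_add_distrib, ih]
    ring

/-- Total length of the lists scanned when all masks are searched: each low half occurs with 2^k
high halves and each high half with 2^h low halves. -/
theorem sum_subcount_split (h k : ℕ) :
    ∑ x ∈ Finset.range (2 ^ (h + k)),
      (subcount (x % 2 ^ h) + subcount (2 ^ h * (x / 2 ^ h))) = 2 ^ k * 3 ^ h + 2 ^ h * 3 ^ k := by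
  have key : ∀ K, ∑ x ∈ Finset.range (2 ^ h * K),
      (subcount (x % 2 ^ h) + subcount (2 ^ h * (x / 2 ^ h))) =
      K * 3 ^ h + 2 ^ h * ∑ d ∈ Finset.range K, subcount (2 ^ h * d) := by
    intro K
    induction K with
    | zero => simp
    | succ K ih =>
      have h3 : ∀ c ∈ Finset.range (2 ^ h), (subcount ((2 ^ h * K + c) % 2 ^ h) +
          subcount (2 ^ h * ((2 ^ h * K + c) / 2 ^ h))) = subcount (2 ^ 0 * c) + subcount (2 ^ h * K) := by
        intro c hc
        rw [Nat.mul_add_mod, Nat.mod_eq_of_lt (Finset.mem_range.1 hc), Nat.mul_add_div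
          (Nat.two_pow_pos h), Nat.div_eq_of_lt (Finset.mem_range.1 hc), pow_zero, one_mul, add_zero]
      rw [mul_add, mul_one, Finset.sum_range_add, ih, Finset.sum_congr rfl h3,
        Finset.sum_add_distrib, sum_subcount, Finset.sum_range_succ]
      simp only [Finset.sum_const, Finset.card_range, smul_eq_mul]
      ring
  rw [pow_add, key, sum_subcount]

/-- The sum of the values `b t` over the positions `t` of a mask. -/
def maskSum (b : ℕ → ℕ) (v : ℕ) : ℕ := ∑ t ∈ bits v, b t

@[simp] theorem maskSum_zero (b : ℕ → ℕ) : maskSum b 0 = 0 := rfl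

theorem maskSum_two_pow_add (b : ℕ → ℕ) {t u : ℕ} (hu : u < 2 ^ t) :
    maskSum b (2 ^ t + u) = maskSum b u + b t := by
  rw [maskSum, bits_two_pow_add hu, Finset.sum_insert (notMem_bits hu), add_comm, maskSum]

theorem maskSum_add (b : ℕ → ℕ) {h c d : ℕ} (hc : c < 2 ^ h) :
    maskSum b (c + 2 ^ h * d) = maskSum b c + maskSum b (2 ^ h * d) := by
  rw [maskSum, bits_add hc, Finset.sum_union (disjoint_bits hc), maskSum, maskSum]

theorem maskSum_le {b : ℕ → ℕ} {l v B : ℕ} (hv : v < 2 ^ l) (hB : ∀ t < l, b t ≤ B) :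
    maskSum b v ≤ l * B := by
  have hsub : bits v ⊆ Finset.range l := fun t ht => Finset.mem_range.2 (lt_of_mem_bits hv ht)
  calc maskSum b v ≤ ∑ t ∈ Finset.range l, b t := Finset.sum_le_sum_of_subset hsub
    _ ≤ ∑ t ∈ Finset.range l, B := Finset.sum_le_sum fun t ht => hB t (Finset.mem_range.1 ht)
    _ = l * B := by simp

/-- The submasks of 2^t + u are those of u together with their shifts by 2^t. Both families have the
same sorted order, since the shift adds the constant `b t` to every sum, so one merge produces the
new list. -/
theorem bits_subset_two_pow_add {t u c : ℕ} (hu : u < 2 ^ t) :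
    bits c ⊆ bits (2 ^ t + u) ↔
      bits c ⊆ bits u ∨ ∃ c', bits c' ⊆ bits u ∧ c = c' + 2 ^ t := by
  rw [bits_two_pow_add hu]
  constructor
  · intro h
    by_cases ht : t ∈ bits c
    · right
      have hl : ∀ k ∈ bits c, k < t + 1 := by
        intro k hk
        rcases Finset.mem_insert.1 (h hk) with rfl | h'
        · omega
        · have := lt_of_mem_bits hu h'
          omega
      obtain ⟨c', hc', hb⟩ := exists_bits_eq (l := t) (S := (bits c).erase t) (by
        intro k hk
        have h1 := hl k (Finset.mem_of_mem_erase hk)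
        have h2 := Finset.ne_of_mem_erase hk
        exact Finset.mem_range.2 (by omega))
      refine ⟨c', ?_, ?_⟩
      · rw [hb]
        intro k hk
        rcases Finset.mem_insert.1 (h (Finset.mem_of_mem_erase hk)) with rfl | h'
        · exact absurd rfl (Finset.ne_of_mem_erase hk)
        · exact h'
      · apply bits_injective
        rw [add_comm, bits_two_pow_add hc', hb, Finset.insert_erase ht]
    · left
      intro k hk
      rcases Finset.mem_insert.1 (h hk) with rfl | h'
      · exact absurd hk ht
      · exact h'
  · rintro (h | ⟨c', h, rfl⟩)
    · exact h.trans (Finset.subset_insert _ _)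
    · have : c' < 2 ^ t := lt_two_pow_of_bits fun k hk => lt_of_mem_bits hu (h hk)
      rw [add_comm, bits_two_pow_add this]
      exact Finset.insert_subset_insert _ h

theorem lt_of_bits_subset {c v l : ℕ} (h : bits c ⊆ bits v) (hv : v < 2 ^ l) : c < 2 ^ l :=
  lt_two_pow_of_bits fun _ hk => lt_of_mem_bits hv (h hk)

/-- `L` lists the `N` submasks of `v` in the order of their sums. -/
structure SortedSubmasks (b : ℕ → ℕ) (v : ℕ) (L : ℕ → ℕ) (N : ℕ) : Prop where
  length : N = subcount v
  sub : ∀ k < N, bits (L k) ⊆ bits v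
  mono : ∀ k k', k ≤ k' → k' < N → maskSum b (L k) ≤ maskSum b (L k')
  exists_eq : ∀ c, bits c ⊆ bits v → ∃ k < N, L k = c

theorem SortedSubmasks.congr {b L L' : ℕ → ℕ} {v N : ℕ} (h : SortedSubmasks b v L N)
    (hL : ∀ k < N, L' k = L k) : SortedSubmasks b v L' N where
  length := h.length
  sub k hk := by rw [hL k hk]; exact h.sub k hk
  mono k k' hkk hk := by rw [hL k (by omega), hL k' hk]; exact h.mono k k' hkk hk
  exists_eq c hc := by
    obtain ⟨k, hk, hkc⟩ := h.exists_eq c hc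
    exact ⟨k, hk, by rw [hL k hk, hkc]⟩

theorem sortedSubmasks_zero (b : ℕ → ℕ) {L : ℕ → ℕ} (h : L 0 = 0) : SortedSubmasks b 0 L 1 where
  length := by simp [subcount]
  sub k hk := by
    obtain rfl : k = 0 := by omega
    simp [h]
  mono k k' hkk hk := by
    obtain rfl : k = 0 := by omega
    obtain rfl : k' = 0 := by omega
    rfl
  exists_eq c hc := ⟨0, by norm_num, by
    rw [h]
    exact bits_injective (by rw [bits_zero]; exact (Finset.subset_empty.1 (by simpa using hc)).symm)⟩

/-- The state of merging `L` and `L + 2 ^ t` into `O`, after the first `i` elements of the former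
and the first `j` elements of the latter list. -/
structure Merged (b : ℕ → ℕ) (t : ℕ) (L : ℕ → ℕ) (N : ℕ) (O : ℕ → ℕ) (i j : ℕ) : Prop where
  le : j ≤ i
  le_length : i ≤ N
  mem : ∀ k < i + j, (∃ k' < i, O k = L k') ∨ ∃ k' < j, O k = L k' + 2 ^ t
  mono : ∀ k k', k ≤ k' → k' < i + j → maskSum b (O k) ≤ maskSum b (O k')
  left : ∀ k < i, ∃ k' < i + j, O k' = L k
  right : ∀ k < j, ∃ k' < i + j, O k' = L k + 2 ^ t
  le_left : ∀ k < i + j, i < N → maskSum b (O k) ≤ maskSum b (L i)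
  le_right : ∀ k < i + j, j < N → maskSum b (O k) ≤ maskSum b (L j + 2 ^ t)

theorem Merged.init (b : ℕ → ℕ) (t : ℕ) (L : ℕ → ℕ) (N : ℕ) (O : ℕ → ℕ) : Merged b t L N O 0 0 := by
  constructor <;> simp

/-! ### Merging a sorted list of submasks with its shift -/

section merge
variable {b : ℕ → ℕ} {t u : ℕ} {L O : ℕ → ℕ} {N i j : ℕ}

theorem maskSum_add_two_pow (hu : u < 2 ^ t) {c : ℕ} (hc : bits c ⊆ bits u) :
    maskSum b (c + 2 ^ t) = maskSum b c + b t := by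
  rw [add_comm, maskSum_two_pow_add b (lt_of_bits_subset hc hu)]

theorem Merged.takeLeft (hL : SortedSubmasks b u L N) (h : Merged b t L N O i j)
    (hi : i < N) (hle : maskSum b (L i) ≤ maskSum b (L j + 2 ^ t)) :
    Merged b t L N (Function.update O (i + j) (L i)) (i + 1) j := by
  have hji := h.le
  have old : ∀ k < i + j, Function.update O (i + j) (L i) k = O k := fun k hk =>
    Function.update_of_ne hk.ne _ _
  have new : Function.update O (i + j) (L i) (i + j) = L i := Function.update_self _ _ _
  have cases : ∀ k < i + 1 + j, k < i + j ∨ k = i + j := fun k hk => by omega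
  constructor
  · omega
  · omega
  · intro k hk
    rcases cases k hk with hk | rfl
    · rw [old k hk]
      rcases h.mem k hk with ⟨k', h1, h2⟩ | h1
      · exact .inl ⟨k', by omega, h2⟩
      · exact .inr h1
    · exact .inl ⟨i, by omega, new⟩
  · intro k k' hkk hk'
    rcases cases k' hk' with hk' | rfl
    · rw [old k (by omega), old k' hk']
      exact h.mono k k' hkk hk'
    · rw [new]
      rcases cases k (by omega) with hk | rfl
      · rw [old k hk]
        exact h.le_left k hk hi
      · rw [new]
  · intro k hk
    rcases Nat.lt_succ_iff_lt_or_eq.1 hk with hk | rfl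
    · obtain ⟨k', h1, h2⟩ := h.left k hk
      exact ⟨k', by omega, by rw [old k' h1, h2]⟩
    · exact ⟨k + j, by omega, new⟩
  · intro k hk
    obtain ⟨k', h1, h2⟩ := h.right k hk
    exact ⟨k', by omega, by rw [old k' h1, h2]⟩
  · intro k hk hi'
    have hm := hL.mono i (i + 1) (by omega) hi'
    rcases cases k hk with hk | rfl
    · rw [old k hk]
      exact (h.le_left k hk hi).trans hm
    · rw [new]
      exact hm
  · intro k hk hj
    rcases cases k hk with hk | rfl
    · rw [old k hk]
      exact h.le_right k hk hj
    · rw [new]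
      exact hle

theorem Merged.takeRight (hu : u < 2 ^ t) (hL : SortedSubmasks b u L N) (h : Merged b t L N O i j)
    (hij : i + j < N + N) (hle : i < N → maskSum b (L j + 2 ^ t) < maskSum b (L i)) :
    Merged b t L N (Function.update O (i + j) (L j + 2 ^ t)) i (j + 1) := by
  have hji := h.le
  have hiN := h.le_length
  -- A shifted element never precedes the element it comes from, since shifting does not decrease
  -- the sum and ties are resolved in favour of the unshifted list. Hence the second pointer always
  -- stays within its list.
  have hji' : j < i := by
    rcases hji.lt_or_eq with h' | rfl
    · exact h'
    · have := hle (by omega)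
      rw [maskSum_add_two_pow hu (hL.sub j (by omega))] at this
      omega
  have old : ∀ k < i + j, Function.update O (i + j) (L j + 2 ^ t) k = O k := fun k hk =>
    Function.update_of_ne hk.ne _ _
  have new : Function.update O (i + j) (L j + 2 ^ t) (i + j) = L j + 2 ^ t :=
    Function.update_self _ _ _
  have cases : ∀ k < i + (j + 1), k < i + j ∨ k = i + j := fun k hk => by omega
  constructor
  · omega
  · omega
  · intro k hk
    rcases cases k hk with hk | rfl
    · rw [old k hk]
      rcases h.mem k hk with h1 | ⟨k', h1, h2⟩
      · exact .inl h1
      · exact .inr ⟨k', by omega, h2⟩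
    · exact .inr ⟨j, by omega, new⟩
  · intro k k' hkk hk'
    rcases cases k' hk' with hk' | rfl
    · rw [old k (by omega), old k' hk']
      exact h.mono k k' hkk hk'
    · rw [new]
      rcases cases k (by omega) with hk | rfl
      · rw [old k hk]
        exact h.le_right k hk (by omega)
      · rw [new]
  · intro k hk
    obtain ⟨k', h1, h2⟩ := h.left k hk
    exact ⟨k', by omega, by rw [old k' h1, h2]⟩
  · intro k hk
    rcases Nat.lt_succ_iff_lt_or_eq.1 hk with hk | rfl
    · obtain ⟨k', h1, h2⟩ := h.right k hk
      exact ⟨k', by omega, by rw [old k' h1, h2]⟩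
    · exact ⟨i + k, by omega, new⟩
  · intro k hk hi'
    rcases cases k hk with hk | rfl
    · rw [old k hk]
      exact h.le_left k hk hi'
    · rw [new]
      exact (hle hi').le
  · intro k hk hj
    have hm := hL.mono j (j + 1) (by omega) hj
    have e1 := maskSum_add_two_pow (b := b) hu (hL.sub j (by omega))
    have e2 := maskSum_add_two_pow (b := b) hu (hL.sub (j + 1) hj)
    rcases cases k hk with hk | rfl
    · rw [old k hk]
      have := h.le_right k hk (by omega)
      omega
    · rw [new]
      omega

theorem Merged.sortedSubmasks (hu : u < 2 ^ t) (hL : SortedSubmasks b u L N)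
    (h : Merged b t L N O i j) (hij : N + N ≤ i + j) :
    SortedSubmasks b (2 ^ t + u) O (N + N) := by
  have h1 := h.le
  have h2 := h.le_length
  obtain rfl : j = i := by omega
  obtain rfl : j = N := by omega
  refine ⟨?_, ?_, h.mono, ?_⟩
  · rw [subcount_two_pow_add hu, hL.length]
  · intro k hk
    rw [bits_subset_two_pow_add hu]
    rcases h.mem k hk with ⟨k', h3, h4⟩ | ⟨k', h3, h4⟩
    · exact .inl (h4 ▸ hL.sub k' h3)
    · exact .inr ⟨_, hL.sub k' h3, h4⟩
  · intro c hc
    rcases (bits_subset_two_pow_add hu).1 hc with h3 | ⟨c', h3, rfl⟩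
    · obtain ⟨k, hk, rfl⟩ := hL.exists_eq c h3
      exact h.left k hk
    · obtain ⟨k, hk, rfl⟩ := hL.exists_eq c' h3
      exact h.right k hk

end merge

/-- The state of the two-pointer search for a submask of `c + d` with the largest sum that is at
most half of the sum of `x`; `L` is scanned from the left and `M` from the right. -/
structure Searched (b : ℕ → ℕ) (x : ℕ) (L : ℕ → ℕ) (N : ℕ) (M : ℕ → ℕ) (K : ℕ) (i j best : ℕ) :
    Prop where
  le_left : i ≤ N
  le_right : j ≤ K
  sub : bits best ⊆ bits x
  feasible : 2 * maskSum b best ≤ maskSum b x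
  best : ∀ i' < N, ∀ j' < K, i' < i ∨ j ≤ j' → 2 * maskSum b (L i' + M j') ≤ maskSum b x →
    maskSum b (L i' + M j') ≤ maskSum b best

/-! ### Meet in the middle with two pointers -/

section search
variable {b : ℕ → ℕ} {h c d x : ℕ} {L M : ℕ → ℕ} {N K i j best : ℕ}

theorem Searched.init : Searched b x L N M K 0 K 0 :=
  ⟨by simp, le_rfl, by simp, by simp, fun _ _ _ hj h => absurd h (by omega)⟩

/-- Submasks of a high half have no low bits, so adding a submask of the low half causes no carry.
-/
theorem SortedSubmasks.eq_mul (hM : SortedSubmasks b (2 ^ h * d) M K) {j : ℕ} (hj : j < K) :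
    ∃ d', M j = 2 ^ h * d' := by
  refine ⟨M j / 2 ^ h, bits_injective ?_⟩
  rw [bits_mul_div, Finset.filter_true_of_mem]
  intro k hk
  have h1 := hM.sub j hj hk
  by_contra hlt
  have h0 := Nat.testBit_two_pow_mul_add d (Nat.two_pow_pos h) k
  rw [add_zero, if_pos (not_le.1 hlt)] at h0
  rw [mem_bits, h0] at h1
  simp at h1

variable (hc : c < 2 ^ h) (hL : SortedSubmasks b c L N) (hM : SortedSubmasks b (2 ^ h * d) M K)
include hc hL hM

theorem maskSum_pair {i j : ℕ} (hi : i < N) (hj : j < K) :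
    maskSum b (L i + M j) = maskSum b (L i) + maskSum b (M j) := by
  obtain ⟨d', hd'⟩ := hM.eq_mul hj
  rw [hd', maskSum_add b (lt_of_bits_subset (hL.sub i hi) hc)]

theorem bits_pair_subset {i j : ℕ} (hi : i < N) (hj : j < K) :
    bits (L i + M j) ⊆ bits (c + 2 ^ h * d) := by
  obtain ⟨d', hd'⟩ := hM.eq_mul hj
  rw [hd', bits_add (lt_of_bits_subset (hL.sub i hi) hc), bits_add hc, ← hd']
  exact Finset.union_subset_union (hL.sub i hi) (hM.sub j hj)

/-- If `L i + M (j - 1)` exceeds half of the sum, then so does every later `L i'` together with `M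
(j - 1)`, which can therefore be discarded. -/
theorem Searched.moveRight (hs : Searched b x L N M K i j best) (hi : i < N) (hj : 0 < j)
    (hgt : maskSum b x < maskSum b (L i + M (j - 1)) + maskSum b (L i + M (j - 1))) :
    Searched b x L N M K i (j - 1) best := by
  have hjK := hs.le_right
  refine ⟨hs.le_left, by omega, hs.sub, hs.feasible, fun i' hi' j' hj' hor hle => ?_⟩
  by_cases hold : i' < i ∨ j ≤ j'
  · exact hs.best i' hi' j' hj' hold hle
  · obtain rfl : j' = j - 1 := by omega
    have h1 := hL.mono i i' (by omega) hi'
    rw [maskSum_pair hc hL hM hi hj'] at hgt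
    rw [maskSum_pair hc hL hM hi' hj'] at hle
    omega

/-- If `L i + M (j - 1)` is feasible, it is the best pair with first component `L i` among the
remaining ones, so `L i` is settled once this pair has been considered. -/
theorem Searched.moveLeft (hx : x = c + 2 ^ h * d) (hs : Searched b x L N M K i j best)
    (hi : i < N) (hj : 0 < j) {best' : ℕ}
    (hle : maskSum b (L i + M (j - 1)) + maskSum b (L i + M (j - 1)) ≤ maskSum b x)
    (hbest : best' = best ∨ best' = L i + M (j - 1)) (h1 : maskSum b best ≤ maskSum b best')
    (h2 : maskSum b (L i + M (j - 1)) ≤ maskSum b best') :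
    Searched b x L N M K (i + 1) j best' := by
  have hjK := hs.le_right
  refine ⟨by omega, hs.le_right, ?_, ?_, fun i' hi' j' hj' hor hle' => ?_⟩
  · rcases hbest with rfl | rfl
    · exact hs.sub
    · rw [hx]
      exact bits_pair_subset hc hL hM hi (by omega)
  · rcases hbest with rfl | rfl
    · exact hs.feasible
    · omega
  · by_cases hold : i' < i ∨ j ≤ j'
    · exact (hs.best i' hi' j' hj' hold hle').trans h1
    · obtain rfl : i' = i := by omega
      have h3 := hM.mono j' (j - 1) (by omega) (by omega)
      have e1 := maskSum_pair hc hL hM hi hj'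
      have e2 := maskSum_pair hc hL hM hi (show j - 1 < K by omega)
      omega

theorem Searched.le_best (hx : x = c + 2 ^ h * d) (hs : Searched b x L N M K i j best)
    (hdone : N ≤ i ∨ j = 0) {P : ℕ} (hP : bits P ⊆ bits x)
    (hle : 2 * maskSum b P ≤ maskSum b x) : maskSum b P ≤ maskSum b best := by
  have hmod : P = P % 2 ^ h + 2 ^ h * (P / 2 ^ h) := (Nat.mod_add_div P _).symm
  have hxm : x % 2 ^ h = c := by rw [hx, Nat.add_mul_mod_self_left, Nat.mod_eq_of_lt hc]
  have hxd : x / 2 ^ h = d := by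
    rw [hx, Nat.add_mul_div_left _ _ (Nat.two_pow_pos h), Nat.div_eq_of_lt hc, zero_add]
  obtain ⟨i', hi', hLi⟩ := hL.exists_eq (P % 2 ^ h) (by
    rw [← hxm, bits_mod, bits_mod]
    exact Finset.filter_subset_filter _ hP)
  obtain ⟨j', hj', hMj⟩ := hM.exists_eq (2 ^ h * (P / 2 ^ h)) (by
    rw [← hxd, bits_mul_div, bits_mul_div]
    exact Finset.filter_subset_filter _ hP)
  have := hs.best i' hi' j' hj' (by omega)
  rw [hLi, hMj, ← hmod] at this
  exact this hle

end search

end SubsetSumRatio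

namespace SubsetSumRatio

/-! ### The program -/

infixr:60 " ;; " => Cmd.seq

/-- Does nothing of interest. -/
abbrev skipCmd : Cmd := .assign .mk 0

section
open Var

/-- Replaces the best pair so far by the pair marked in the array `cm` if the latter is as good. -/
def considerCmd : Cmd :=
  .assign w1 0 ;; .assign w2 0 ;; .assign j 0 ;;
  .loop j .len (
    .assign mk (.get .cm j) ;;
    -- On the marks 0, 1, 2 the factor `mk * (2 - mk)` is the indicator of 1, and `mk / 2` is the
    -- indicator of 2.
    .assign w1 (w1 + .get .inp j * (mk * (2 - mk))) ;;
    .assign w2 (w2 + .get .inp j * (mk / 2)) ;;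
    .assign j (j + 1)) ;;
  -- Maximum and minimum, expressed by truncated subtraction.
  .assign nu (w1 + (w2 - w1)) ;; .assign de (w1 - (w1 - w2)) ;;
  -- Initially `bn` and `bd` are both 0, so the strict test fails and the first pair is always
  -- stored.
  .ite (bn * de) (nu * bd) skipCmd (
    .assign bn nu ;; .assign bd de ;; .assign j 0 ;;
    .loop j .len (.put .bm j (.get .cm j) ;; .assign j (j + 1)))

/-- Marks the pair that is given by the masks `v` and `y` (where `z` is the mark of the elements in
both), adds small elements to the first set as long as `r < tg`, and considers the result. -/
def candidateCmd : Cmd :=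
  .assign j 0 ;;
  .loop j s (
    .ite r tg (.put .cm j 1 ;; .assign r (r + .get .inp j)) (.put .cm j 0) ;;
    .assign j (j + 1)) ;;
  .loop j .len (
    .assign w1 (v - (v / 2 + v / 2)) ;; .assign w2 (y - (y / 2 + y / 2)) ;;
    -- `w1` and `w2` are the lowest bits of the two masks: mark 1 for `v` only, 2 for `y` only, `z`
    -- for both. In the Partition case `v` encodes P ⊆ X and `z` is 1; for a collision `z` is 0,
    -- which drops the intersection.
    .put .cm j (w1 * (1 - w2) + 2 * (w2 * (1 - w1)) + z * (w1 * w2)) ;;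
    .assign v (v / 2) ;; .assign y (y / 2) ;; .assign j (j + 1)) ;;
  considerCmd

/-- Enumerates the subset sums of the large elements until two of them are in the same bin. -/
def enumerateCmd : Cmd :=
  .put .sum 0 0 ;; .put .bins 0 0 ;; .put .tab 0 0 ;;
  .assign cnt 1 ;; .assign hb 1 ;; .assign t 0 ;; .assign e l ;;
  .loop t e (
    -- `hb` is the highest power of two in the mask `cnt`, so removing it leaves a mask whose sum is
    -- already known.
    .put .sum cnt (.get .sum (cnt - hb) + .get .inp (s + t)) ;;
    .assign b (.get .sum cnt * (q * q) / (p * p * m)) ;;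
    .put .bins cnt b ;;
    -- This is the minimum of the table entry and `cnt`. The table is never cleared between
    -- prefixes, so an entry may be stale. The following test trusts it only if it names an earlier
    -- mask, `v < cnt`, whose recorded bin is indeed `b`.
    .assign v (.get .tab b - (.get .tab b - cnt)) ;;
    .ite (v + 1 - cnt + (.get .bins v - b + (b - .get .bins v))) 1
      (.assign e 0)
      (.put .tab b cnt ;; .assign cnt (cnt + 1) ;;
        .ite cnt (hb + hb) skipCmd (.assign hb (hb + hb) ;; .assign t (t + 1))))

/-- Merges the list of `f0` and its shift by `hb` into the list of `f`. -/
def mergeCmd : Cmd :=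
  .loop (a + b) (N + N) (
    -- The index is the minimum of `a` and `N - 1`, which keeps the read inside the row after the
    -- unshifted list is exhausted. The sum two lines below is 0 exactly if `a < N` and the sum of
    -- `x` is at most that of `y`.
    .assign x (.get .list (f0 * H + (a - (a + 1 - N)))) ;;
    .assign y (.get .list (f0 * H + b) + hb) ;;
    .ite (a + 1 - N + (.get .sum x - .get .sum y)) 1
      (.put .list (f * H + (a + b)) x ;; .assign a (a + 1))
      (.put .list (f * H + (a + b)) y ;; .assign b (b + 1)))

/-- Computes the sorted lists of submasks of the multiples of `unit` below `last`. -/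
def buildCmd : Cmd :=
  .assign f unit ;; .assign hb unit ;;
  .loop f last (
    .assign f0 (f - hb) ;; .assign N (.get .num f0) ;; .assign a 0 ;; .assign b 0 ;;
    mergeCmd ;;
    .put .num f (N + N) ;; .assign f (f + unit) ;;
    .ite f (hb + hb) skipCmd (.assign hb (hb + hb)))

/-- Solves Partition on the set `x`. -/
def searchCmd : Cmd :=
  .assign c (x - x / g * g) ;; .assign d (x / g * g) ;;
  .assign N (.get .num c) ;; .assign b (.get .num d) ;; .assign a 0 ;; .assign bm 0 ;;
  -- The test holds exactly if `a < N` and `0 < b`.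
  .loop (a + 1 - N + (1 - b)) 1 (
    .assign y (.get .list (c * H + a) + .get .list (d * H + (b - 1))) ;;
    .ite (.get .sum x) (.get .sum y + .get .sum y)
      (.assign b (b - 1))
      (.ite (.get .sum bm) (.get .sum y) (.assign bm y) skipCmd ;; .assign a (a + 1)))

/-- Solves Partition on all sets of large elements that contain the largest one, and considers the
resulting pairs. -/
def partitionsCmd : Cmd :=
  .assign g 1 ;; .assign t 0 ;; .loop t (l / 2) (.assign g (g + g) ;; .assign t (t + 1)) ;;
  .assign H cnt ;; .put .list 0 0 ;; .put .num 0 1 ;;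
  .assign unit 1 ;; .assign last g ;; buildCmd ;;
  .assign unit g ;; .assign last cnt ;; buildCmd ;;
  -- The masks from 2^(l-1) on are those with the top bit, that is, the sets containing the largest
  -- element.
  .assign x (cnt / 2) ;;
  .loop x cnt (
    searchCmd ;;
    .assign v bm ;; .assign y x ;; .assign z 1 ;; .assign r (.get .sum bm) ;;
    .assign tg (.get .sum x - .get .sum bm) ;;
    candidateCmd ;;
    .assign x (x + 1))

/-- Treats the prefix with largest element number `i`. -/
def prefixCmd : Cmd :=
  .assign m (.get .inp i) ;; .assign s 0 ;;
  .loop (q * .get .inp s) (p * m) (.assign s (s + 1)) ;;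
  .assign l (i + 1 - s) ;;
  enumerateCmd ;;
  -- `e` has been set to 0 exactly if a collision was found; the colliding masks are then `v` and
  -- `cnt`. Setting `r` and `tg` to 0 prevents small elements from being added.
  .ite e 1
    (.assign y cnt ;; .assign z 0 ;; .assign r 0 ;; .assign tg 0 ;; candidateCmd)
    partitionsCmd

/-- The whole algorithm. -/
def mainCmd : Cmd :=
  .assign i 0 ;; .loop i .len (prefixCmd ;; .assign i (i + 1)) ;;
  .assign j 0 ;; .loop j .len (.put .inp j (.get .bm j) ;; .assign j (j + 1))

end

/-! ### Verification -/

/-- The static assumptions: the input is a positive increasing sequence `a` of length `n`, all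
relevant numbers are at most `U`, and the word bound is `V`. -/
structure Setting (a : ℕ → ℕ) (n p q U V : ℕ) : Prop where
  two_le : 2 ≤ n
  pos : ∀ j < n, 0 < a j
  lt : ∀ i j, i < j → j < n → a i < a j
  p_pos : 0 < p
  p_lt : p < q
  sum_le : ∑ j ∈ Finset.range n, a j ≤ U
  count_le : n * (q * q) + 2 ≤ U
  word : 16 * (U * U) ≤ V

namespace Setting
variable {a : ℕ → ℕ} {n p q U V : ℕ} (h : Setting a n p q U V)
include h

theorem le_U {j : ℕ} (hj : j < n) : a j ≤ U :=
  (Finset.single_le_sum (f := a) (fun _ _ => Nat.zero_le _) (Finset.mem_range.2 hj)).trans h.sum_le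

theorem q_sq_le : q * q ≤ U := by
  have h1 := h.two_le
  have h2 := h.count_le
  nlinarith

theorem q_le : q ≤ U := (Nat.le_mul_self q).trans h.q_sq_le

theorem n_add_two_le : n + 2 ≤ U := by
  have h1 := h.p_lt
  have h2 := h.count_le
  have : 1 ≤ q * q := Nat.mul_pos (by omega) (by omega)
  nlinarith

theorem mul_lt {x y : ℕ} (hx : x ≤ U) (hy : y ≤ U) : 16 * (x * y) ≤ V :=
  (Nat.mul_le_mul_left _ (Nat.mul_le_mul hx hy)).trans h.word

theorem lt_V : 16 * U ≤ V ∧ 64 ≤ V := by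
  have h1 := h.n_add_two_le
  have h2 := h.two_le
  have h3 := h.word
  constructor <;> nlinarith

theorem inj {i j : ℕ} (hi : i < n) (hj : j < n) (hij : a i = a j) : i = j := by
  rcases Nat.lt_trichotomy i j with h1 | h1 | h1
  · exact absurd hij (h.lt i j h1 hj).ne
  · exact h1
  · exact absurd hij (h.lt j i h1 hi).ne'

end Setting

/-- The input is stored where it should be. -/
structure HasInput (a : ℕ → ℕ) (n p q : ℕ) (s : Store) : Prop where
  len : s.len = n
  p : s.var .p = p
  q : s.var .q = q
  inp : ∀ j < n, s.arr .inp j = a j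

theorem HasInput.frame {a : ℕ → ℕ} {n p q : ℕ} {s t : Store} {c : Cmd} (h : HasInput a n p q s)
    (hf : Frame c s t) (hp : .p ∉ c.vars) (hq : .q ∉ c.vars) (hi : .inp ∉ c.arrs) :
    HasInput a n p q t :=
  ⟨hf.len.trans h.len, (hf.var _ hp).trans h.p, (hf.var _ hq).trans h.q,
    fun j hj => (congrFun (hf.arr _ hi) j).trans (h.inp j hj)⟩

section
variable {a : ℕ → ℕ} {n p q : ℕ} {s : Store}

@[simp] theorem hasInput_tick (k : ℕ) : HasInput a n p q (s.tick k) ↔ HasInput a n p q s :=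
  ⟨fun h => ⟨h.len, h.p, h.q, h.inp⟩, fun h => ⟨h.len, h.p, h.q, h.inp⟩⟩

@[simp] theorem hasInput_set {x : Var} {v k : ℕ} (hp : x ≠ .p) (hq : x ≠ .q) :
    HasInput a n p q (s.set x v k) ↔ HasInput a n p q s :=
  ⟨fun h => ⟨h.len, by simpa [hp.symm] using h.p, by simpa [hq.symm] using h.q, h.inp⟩,
    fun h => ⟨h.len, by simpa [hp.symm] using h.p, by simpa [hq.symm] using h.q, h.inp⟩⟩

@[simp] theorem hasInput_put {A : Arr} {i v k : ℕ} (hA : A ≠ .inp) :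
    HasInput a n p q (s.put A i v k) ↔ HasInput a n p q s :=
  ⟨fun h => ⟨h.len, h.p, h.q, by simpa [hA.symm] using h.inp⟩,
    fun h => ⟨h.len, h.p, h.q, by simpa [hA.symm] using h.inp⟩⟩

end

/-- The elements marked by `v`. -/
def pick (a : ℕ → ℕ) (n : ℕ) (cm : ℕ → ℕ) (v : ℕ) : Finset ℕ :=
  ((Finset.range n).filter fun j => cm j = v).image a

/-- The pair encoded by the marks `1` and `2`. -/
def picks (a : ℕ → ℕ) (n : ℕ) (cm : ℕ → ℕ) : Finset ℕ × Finset ℕ := (pick a n cm 1, pick a n cm 2)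

theorem pick_congr {a : ℕ → ℕ} {n : ℕ} {cm cm' : ℕ → ℕ} (h : ∀ j < n, cm j = cm' j) (v : ℕ) :
    pick a n cm v = pick a n cm' v := by
  unfold pick
  congr 1
  exact Finset.filter_congr fun j hj => by rw [h j (Finset.mem_range.1 hj)]

theorem picks_congr {a : ℕ → ℕ} {n : ℕ} {cm cm' : ℕ → ℕ} (h : ∀ j < n, cm j = cm' j) :
    picks a n cm = picks a n cm' := by
  rw [picks, picks, pick_congr h, pick_congr h]

/-- The sum of the first elements that are marked by `v`. -/
def markSum (a cm : ℕ → ℕ) (v j : ℕ) : ℕ := ∑ k ∈ Finset.range j, if cm k = v then a k else 0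

theorem total_image {a : ℕ → ℕ} {n p q U V : ℕ} (h : Setting a n p q U V) {I : Finset ℕ}
    (hI : I ⊆ Finset.range n) : total (I.image a) = ∑ j ∈ I, a j :=
  Finset.sum_image fun _ hi _ hj hij =>
    h.inj (Finset.mem_range.1 (hI hi)) (Finset.mem_range.1 (hI hj)) hij

theorem total_pick {a : ℕ → ℕ} {n p q U V : ℕ} (h : Setting a n p q U V) (cm : ℕ → ℕ) (v : ℕ) :
    total (pick a n cm v) = markSum a cm v n := by
  rw [pick, total_image h (Finset.filter_subset _ _), Finset.sum_filter, markSum]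

theorem markSum_succ (a cm : ℕ → ℕ) (v j : ℕ) :
    markSum a cm v (j + 1) = markSum a cm v j + if cm j = v then a j else 0 :=
  Finset.sum_range_succ _ _

theorem markSum_le {a : ℕ → ℕ} {n p q U V : ℕ} (h : Setting a n p q U V) (cm : ℕ → ℕ) (v : ℕ)
    {j : ℕ} (hj : j ≤ n) : markSum a cm v j ≤ U := by
  refine le_trans ?_ h.sum_le
  calc markSum a cm v j ≤ ∑ k ∈ Finset.range j, a k :=
        Finset.sum_le_sum fun k _ => by split_ifs <;> simp
    _ ≤ _ := Finset.sum_le_sum_of_subset (Finset.range_subset_range.2 hj)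

theorem ratio_le_ratio {S T : Finset ℕ × Finset ℕ} (hT : 0 < maxSum T)
    (h : maxSum S * minSum T ≤ maxSum T * minSum S) : ratio S ≤ ratio T := by
  rcases Nat.eq_zero_or_pos (minSum T) with h0 | h0
  · rw [ratio_eq_top h0 hT]
    exact le_top
  · have := ratio_le_mul (S := T) (T := S) zero_le_one h0 (by rw [one_mul]; exact_mod_cast h)
    simpa using this

/-- The stored pair is the best one in `G`. -/
def Best (a : ℕ → ℕ) (n : ℕ) (G : Set (Finset ℕ × Finset ℕ)) (s : Store) : Prop :=
  (G = ∅ ∧ s.var .bn = 0 ∧ s.var .bd = 0) ∨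
    (picks a n (s.arr .bm) ∈ G ∧ s.var .bn = maxSum (picks a n (s.arr .bm)) ∧
      s.var .bd = minSum (picks a n (s.arr .bm)) ∧ 0 < maxSum (picks a n (s.arr .bm)) ∧
      ∀ T ∈ G, ratio (picks a n (s.arr .bm)) ≤ ratio T)

theorem Best.congr {a : ℕ → ℕ} {n : ℕ} {G : Set (Finset ℕ × Finset ℕ)} {s t : Store}
    (h : Best a n G s) (h1 : t.var .bn = s.var .bn) (h2 : t.var .bd = s.var .bd)
    (h3 : t.arr .bm = s.arr .bm) : Best a n G t := by
  unfold Best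
  rw [h1, h2, h3]
  exact h

theorem maxSum_picks_le {a : ℕ → ℕ} {n p q U V : ℕ} (h : Setting a n p q U V) (cm : ℕ → ℕ) :
    maxSum (picks a n cm) ≤ U := by
  unfold maxSum picks
  simp only [total_pick h]
  exact max_le (markSum_le h _ _ le_rfl) (markSum_le h _ _ le_rfl)

theorem minSum_le_maxSum (S : Finset ℕ × Finset ℕ) : minSum S ≤ maxSum S := min_le_max

section verification
variable {a : ℕ → ℕ} {n p q U V : ℕ} (h : Setting a n p q U V)
include h

theorem Best.le {G : Set (Finset ℕ × Finset ℕ)} {s : Store} (hb : Best a n G s) :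
    s.var .bn ≤ U ∧ s.var .bd ≤ U := by
  rcases hb with ⟨-, h1, h2⟩ | ⟨-, h1, h2, -⟩
  · omega
  · have := maxSum_picks_le h (s.arr .bm)
    have := minSum_le_maxSum (picks a n (s.arr .bm))
    omega

theorem wp_considerCmd {s : Store} (hs : HasInput a n p q s) {G : Set (Finset ℕ × Finset ℕ)}
    (hb : Best a n G s) (hcm : ∀ j < n, s.arr .cm j ≤ 2)
    (hpos : 0 < maxSum (picks a n (s.arr .cm))) :
    wp V considerCmd s fun t => Best a n (insert (picks a n (s.arr .cm)) G) t ∧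
      t.clk ≤ s.clk + 100 * (n + 1) := by
  have hn := h.n_add_two_le
  obtain ⟨hV, hV'⟩ := h.lt_V
  unfold considerCmd
  simp only [wp_seq, wp_assign]
  refine ⟨by simp; omega, by simp; omega, by simp; omega, ?_⟩
  refine wp.mono (wp.frame (wp_loop (fun t => t.var .j ≤ n ∧
    t.var .w1 = markSum a (s.arr .cm) 1 (t.var .j) ∧ t.var .w2 = markSum a (s.arr .cm) 2 (t.var .j) ∧
    t.clk ≤ s.clk + 60 * t.var .j + 20) (fun t => n - t.var .j) (Q := fun t =>
    t.var .w1 = markSum a (s.arr .cm) 1 n ∧ t.var .w2 = markSum a (s.arr .cm) 2 n ∧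
    t.clk ≤ s.clk + 60 * n + 30) ?_ ?_)) ?_
  · simp [markSum]
  · rintro t hf ⟨h1, h2, h3, h4⟩
    have hin : HasInput a n p q t := HasInput.frame (by simp [hs]) hf
      (by decide) (by decide) (by decide)
    have hcmt : t.arr .cm = s.arr .cm := hf.arr _ (by decide)
    refine ⟨by simp, by simp, fun hlt => ?_, fun hge => ?_⟩
    · simp [hin.len] at hlt
      have hj := h.le_U hlt
      have hm := hcm _ hlt
      have e1 := markSum_succ a (s.arr .cm) 1 (t.var .j)
      have e2 := markSum_succ a (s.arr .cm) 2 (t.var .j)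
      have b1 := markSum_le h (s.arr .cm) 1 (j := t.var .j + 1) hlt
      have b2 := markSum_le h (s.arr .cm) 2 (j := t.var .j + 1) hlt
      simp [wp_seq, wp_assign, hin.len, hin.inp _ hlt, hlt, hcmt, h2, h3]
      generalize s.arr .cm (t.var .j) = k at *
      interval_cases k <;> simp at * <;> omega
    · simp [hin.len] at hge
      have : t.var .j = n := by omega
      rw [this] at h2 h3 h4
      simp [h2, h3]
      omega
  · rintro t ⟨hf, h1, h2, h3⟩
    have hin : HasInput a n p q t := HasInput.frame (by simp [hs]) hf
      (by decide) (by decide) (by decide)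
    have hcmt : t.arr .cm = s.arr .cm := hf.arr _ (by decide)
    have hbmt : t.arr .bm = s.arr .bm := hf.arr _ (by decide)
    have hbn : t.var .bn = s.var .bn := by simpa using hf.var .bn (by decide)
    have hbd : t.var .bd = s.var .bd := by simpa using hf.var .bd (by decide)
    have hbt : Best a n G t := hb.congr hbn hbd hbmt
    obtain ⟨l1, l2⟩ := hbt.le h
    have e1 : t.var .w1 + (t.var .w2 - t.var .w1) = maxSum (picks a n (s.arr .cm)) := by
      simp only [maxSum, picks, total_pick h, h1, h2]; omega
    have e2 : t.var .w1 - (t.var .w1 - t.var .w2) = minSum (picks a n (s.arr .cm)) := by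
      simp only [minSum, picks, total_pick h, h1, h2]; omega
    have l3 := maxSum_picks_le h (s.arr .cm)
    have l4 := minSum_le_maxSum (picks a n (s.arr .cm))
    have m1 := h.mul_lt l1 (l4.trans l3)
    have m2 := h.mul_lt l3 l2
    simp only [wp_seq, wp_assign, wp_ite]
    simp only [Expr.eval_add, Expr.eval_sub, Expr.eval_var, Expr.eval_mul, Expr.ok_add, Expr.ok_sub,
      Expr.ok_var, Expr.ok_mul, Store.set_var, Store.set_clk, Expr.cost_var, Expr.cost_add,
      Expr.cost_sub, Expr.cost_mul, e1, e2, reduceCtorEq, if_false, if_true, true_and, Store.tick_var,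
      Store.tick_clk, Expr.eval_ofNat, Expr.ok_ofNat, Expr.cost_ofNat]
    refine ⟨by omega, by omega, by omega, fun hlt => ⟨by omega, ?_, by omega⟩, fun hle => ⟨by omega, ?_⟩⟩
    · have : Best a n (insert (picks a n (s.arr .cm)) G) t := by
        rcases hbt with ⟨-, h4, h5⟩ | ⟨hG, h4, h5, h6, h7⟩
        · simp [h4, h5] at hlt
        · refine .inr ⟨Set.mem_insert_of_mem _ hG, h4, h5, h6, fun T hT => ?_⟩
          rcases hT with rfl | hT
          · exact ratio_le_ratio hpos (by rw [← h4, ← h5]; exact hlt.le)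
          · exact h7 T hT
      exact this.congr (by simp) (by simp) rfl
    · refine wp.mono (wp.frame (wp_loop (fun u => u.var .j ≤ n ∧
        (∀ k < u.var .j, u.arr .bm k = s.arr .cm k) ∧ u.clk ≤ s.clk + 60 * n + 30 * u.var .j + 90)
        (fun u => n - u.var .j) (Q := fun u => (∀ k < n, u.arr .bm k = s.arr .cm k) ∧
        u.clk ≤ s.clk + 100 * (n + 1)) ?_ ?_)) ?_
      · simp; omega
      · rintro u hfu ⟨h4, h5, h6⟩
        have hu : HasInput a n p q u := HasInput.frame (by simp [hin]) hfu
          (by decide) (by decide) (by decide)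
        have hcmu : u.arr .cm = s.arr .cm := (hfu.arr _ (by decide)).trans hcmt
        refine ⟨by simp, by simp, fun hlt => ?_, fun hge => ?_⟩
        · simp [hu.len] at hlt
          simp [wp_seq, wp_assign, wp_put, hu.len, hcmu]
          refine ⟨by omega, fun _ => ⟨⟨by omega, fun k hk => ?_, by omega⟩, by omega⟩⟩
          rcases hk.lt_or_eq with hk | rfl
          · rw [Function.update_of_ne hk.ne, h5 k hk]
          · simp
        · simp [hu.len] at hge
          have : u.var .j = n := by omega
          rw [this] at h5 h6
          simp
          exact ⟨h5, by omega⟩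
      · rintro u ⟨hfu, h4, h5⟩
        have e3 : picks a n (u.arr .bm) = picks a n (s.arr .cm) := picks_congr h4
        have e4 : u.var .bn = maxSum (picks a n (s.arr .cm)) := by
          simpa using hfu.var .bn (by decide)
        have e5 : u.var .bd = minSum (picks a n (s.arr .cm)) := by
          simpa using hfu.var .bd (by decide)
        refine ⟨.inr ?_, h5⟩
        rw [e3, e4, e5]
        refine ⟨Set.mem_insert _ _, rfl, rfl, hpos, fun T hT => ?_⟩
        rcases hT with rfl | hT
        · exact le_rfl
        · rcases hbt with ⟨h6, -⟩ | ⟨-, h6, h7, h8, h9⟩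
          · simp [h6] at hT
          · refine le_trans (ratio_le_ratio h8 ?_) (h9 T hT)
            rw [← h6, ← h7]
            exact hle

end verification

end SubsetSumRatio

/-! ### Marking and evaluating a candidate pair -/

namespace SubsetSumRatio

/-- The mark of an element from its membership in two masks. -/
def markOf (z : ℕ) (b₁ b₂ : Bool) : ℕ := if b₁ then (if b₂ then z else 1) else if b₂ then 2 else 0

/-- The marks of the first `j` of `k₀` small elements: the first `k` are added. -/
structure SmallMarks (a : ℕ → ℕ) (r tg j : ℕ) (cm : ℕ → ℕ) (k : ℕ) : Prop where
  le : k ≤ j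
  eq : ∀ i < j, cm i = if i < k then 1 else 0
  stop_of : k = j ∨ tg ≤ r + ∑ i ∈ Finset.range k, a i
  not_before : k = 0 ∨ r + ∑ i ∈ Finset.range (k - 1), a i < tg

/-- The marks computed by `candidateCmd`. -/
structure CandidateMarks (a : ℕ → ℕ) (n s₀ v y z r tg : ℕ) (cm : ℕ → ℕ) : Prop where
  small : ∃ k, SmallMarks a r tg s₀ cm k
  large : ∀ j, s₀ ≤ j → j < n → cm j = markOf z (v.testBit (j - s₀)) (y.testBit (j - s₀))

section verification
variable {a : ℕ → ℕ} {n p q U V : ℕ} (h : Setting a n p q U V)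
include h

theorem wp_candidateCmd {s : Store} (hs : HasInput a n p q s) {G : Set (Finset ℕ × Finset ℕ)}
    (hb : Best a n G s) {s₀ v y z r tg : ℕ} (hs₀ : s.var .s = s₀) (hv : s.var .v = v)
    (hy : s.var .y = y) (hz : s.var .z = z) (hr : s.var .r = r) (htg : s.var .tg = tg)
    (hs₀n : s₀ ≤ n) (hvU : v ≤ U) (hyU : y ≤ U) (hz1 : z ≤ 1) (htU : tg ≤ U)
    (hpos : ∀ cm, CandidateMarks a n s₀ v y z r tg cm → 0 < maxSum (picks a n cm)) :
    wp V candidateCmd s fun t => ∃ cm, CandidateMarks a n s₀ v y z r tg cm ∧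
      Best a n (insert (picks a n cm) G) t ∧ t.clk ≤ s.clk + 300 * (n + 1) := by
  have hn := h.n_add_two_le
  obtain ⟨hV, hV'⟩ := h.lt_V
  unfold candidateCmd
  simp only [wp_seq, wp_assign]
  refine ⟨by simp; omega, ?_⟩
  refine wp.mono (wp.frame (wp_loop (fun t => t.var .j ≤ s₀ ∧
    (∃ k, SmallMarks a r tg (t.var .j) (t.arr .cm) k ∧
      t.var .r = r + ∑ i ∈ Finset.range k, a i) ∧
    t.clk ≤ s.clk + 60 * t.var .j + 10) (fun t => s₀ - t.var .j) (Q := fun t =>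
    t.var .j = s₀ ∧ (∃ k, SmallMarks a r tg s₀ (t.arr .cm) k) ∧ t.clk ≤ s.clk + 60 * s₀ + 20)
    ?_ ?_)) ?_
  · simp
    exact ⟨0, ⟨le_rfl, by simp, by simp, by simp⟩, by simp [hr]⟩
  · rintro t hf ⟨h1, ⟨k, hk, h2⟩, h3⟩
    have hin : HasInput a n p q t := HasInput.frame (by simp [hs]) hf
      (by decide) (by decide) (by decide)
    have hts : t.var .s = s₀ := by simpa [hs₀] using hf.var .s (by decide)
    have httg : t.var .tg = tg := by simpa [htg] using hf.var .tg (by decide)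
    refine ⟨by simp, by simp, fun hlt => ?_, fun hge => ?_⟩
    · simp [hts] at hlt
      have hjn : t.var .j < n := by omega
      have hj := h.le_U hjn
      have hkj := hk.le
      simp [wp_seq, wp_assign, wp_put, wp_ite, hin.len, hin.inp _ hjn, hjn, httg]
      refine ⟨fun hlt' => ⟨by omega, by omega, by omega, fun _ => ?_⟩,
        fun hge => ⟨by omega, by omega, fun _ => ?_⟩⟩
      · have hkj : k = t.var .j := by
          rcases hk.stop_of with h4 | h4
          · exact h4
          · omega
        refine ⟨⟨by omega, ⟨k + 1, ⟨by omega, fun i hi => ?_, .inl (by omega), .inr ?_⟩, ?_⟩,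
          by omega⟩, by omega⟩
        · rcases (Nat.lt_succ_iff.1 hi).lt_or_eq with hi | rfl
          · rw [Function.update_of_ne hi.ne, hk.eq i hi]
            simp [show i < k by omega, show i < k + 1 by omega]
          · simp [hkj]
        · simp only [Nat.add_sub_cancel]
          omega
        · rw [Finset.sum_range_succ, h2, hkj]
          omega
      · refine ⟨⟨by omega, ⟨k, ⟨by omega, fun i hi => ?_, .inr (by omega), hk.not_before⟩, h2⟩,
          by omega⟩, by omega⟩
        rcases (Nat.lt_succ_iff.1 hi).lt_or_eq with hi | rfl
        · rw [Function.update_of_ne hi.ne, hk.eq i hi]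
        · simp [hkj]
    · simp [hts] at hge
      have : t.var .j = s₀ := by omega
      rw [this] at hk h3
      simp [this]
      exact ⟨⟨k, hk⟩, by omega⟩
  rintro t ⟨hf, hj, ⟨k, hk⟩, hclk⟩
  have hin : HasInput a n p q t := HasInput.frame (by simp [hs]) hf
    (by decide) (by decide) (by decide)
  have hv' : t.var .v = v := by simpa [hv] using hf.var .v (by decide)
  have hy' : t.var .y = y := by simpa [hy] using hf.var .y (by decide)
  have hz' : t.var .z = z := by simpa [hz] using hf.var .z (by decide)
  have hbt : Best a n G t := hb.congr (by simpa using hf.var .bn (by decide))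
    (by simpa using hf.var .bd (by decide)) (hf.arr _ (by decide))
  -- The masks are consumed bit by bit: after j - s₀ rounds they have been shifted right j - s₀
  -- times, and their lowest bits belong to element j.
  refine wp.mono (wp.frame (wp_loop (fun u => s₀ ≤ u.var .j ∧ u.var .j ≤ n ∧
    u.var .v = v / 2 ^ (u.var .j - s₀) ∧ u.var .y = y / 2 ^ (u.var .j - s₀) ∧
    (∀ i < s₀, u.arr .cm i = t.arr .cm i) ∧
    (∀ i, s₀ ≤ i → i < u.var .j →
      u.arr .cm i = markOf z (v.testBit (i - s₀)) (y.testBit (i - s₀))) ∧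
    u.clk ≤ s.clk + 120 * u.var .j + 30) (fun u => n - u.var .j) (Q := fun u =>
    CandidateMarks a n s₀ v y z r tg (u.arr .cm) ∧ u.clk ≤ s.clk + 120 * n + 40)
    ?_ ?_)) ?_
  · simp [hj, hs₀n, hv', hy']
    exact ⟨fun i h1 h2 => by omega, by omega⟩
  · rintro u hfu ⟨h1, h2, h3, h4, h5, h6, h7⟩
    have hu : HasInput a n p q u := hin.frame hfu (by decide) (by decide) (by decide)
    have hz'' : u.var .z = z := by simpa [hz'] using hfu.var .z (by decide)
    refine ⟨by simp, by simp, fun hlt => ?_, fun hge => ?_⟩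
    · simp [hu.len] at hlt
      have e1 : v.testBit (u.var .j - s₀) = decide (u.var .v % 2 = 1) := by
        rw [Nat.testBit_eq_decide_div_mod_eq, h3]
      have e2 : y.testBit (u.var .j - s₀) = decide (u.var .y % 2 = 1) := by
        rw [Nat.testBit_eq_decide_div_mod_eq, h4]
      have l1 : u.var .v ≤ U := h3 ▸ (Nat.div_le_self _ _).trans hvU
      have l2 : u.var .y ≤ U := h4 ▸ (Nat.div_le_self _ _).trans hyU
      have f1 : u.var .v - (u.var .v / 2 + u.var .v / 2) = u.var .v % 2 := by omega
      have f2 : u.var .y - (u.var .y / 2 + u.var .y / 2) = u.var .y % 2 := by omega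
      have f3 : u.var .v / 2 = v / 2 ^ (u.var .j + 1 - s₀) := by
        rw [h3, Nat.div_div_eq_div_mul, ← pow_succ]
        congr 2; omega
      have f4 : u.var .y / 2 = y / 2 ^ (u.var .j + 1 - s₀) := by
        rw [h4, Nat.div_div_eq_div_mul, ← pow_succ]
        congr 2; omega
      simp only [wp_seq, wp_assign, wp_put]
      simp [f1, f2, hz'', ← f3, ← f4]
      have g1 : u.var .v % 2 = 0 ∨ u.var .v % 2 = 1 := by omega
      have g2 : u.var .y % 2 = 0 ∨ u.var .y % 2 = 1 := by omega
      refine ⟨by omega, by omega, ?_, by omega, by omega, fun _ => ?_⟩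
      · rcases g1 with g1 | g1 <;> rcases g2 with g2 | g2 <;> simp [g1, g2] <;> omega
      · refine ⟨⟨by omega, by omega, fun i hi => ?_, fun i hi hi' => ?_, by omega⟩, by omega⟩
        · rw [Function.update_of_ne (by omega), h5 i hi]
        · rcases hi'.lt_or_eq with hi' | rfl
          · rw [Function.update_of_ne hi'.ne, h6 i hi hi']
          · rw [e1, e2, Function.update_self]
            rcases g1 with g1 | g1 <;> rcases g2 with g2 | g2 <;> simp [g1, g2, markOf]
    · simp [hu.len] at hge
      have : u.var .j = n := by omega
      rw [this] at h6 h7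
      refine ⟨⟨⟨k, hk.le, fun i hi => ?_, hk.stop_of, hk.not_before⟩, fun i hi hi' => ?_⟩, ?_⟩
      · simp [h5 i hi, hk.eq i hi]
      · simp [h6 i hi hi']
      · simp; omega
  rintro u ⟨hfu, hcm, hclk'⟩
  have hu : HasInput a n p q u := hin.frame hfu (by decide) (by decide) (by decide)
  have hbu : Best a n G u := hbt.congr (hfu.var .bn (by decide))
    (hfu.var .bd (by decide)) (hfu.arr _ (by decide))
  refine (wp_considerCmd h hu hbu (fun j hj => ?_) (hpos _ hcm)).mono fun w hw => ⟨_, hcm, hw.1, ?_⟩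
  · rcases lt_or_ge j s₀ with h1 | h1
    · obtain ⟨k, hk⟩ := hcm.small
      rw [hk.eq j h1]
      split_ifs <;> omega
    · rw [hcm.large j h1 hj, markOf]
      split_ifs <;> omega
  · have := hw.2
    omega

end verification

end SubsetSumRatio

/-! ### Masks as sets of large elements, and enumeration up to the first collision -/

namespace SubsetSumRatio

/-- The large elements among `a 0, …, a i` are those from number `s₀` on. -/
structure PrefixSetting (a : ℕ → ℕ) (n p q i s₀ : ℕ) : Prop where
  lt : i < n
  le : s₀ ≤ i
  small : ∀ j < s₀, q * a j < p * a i
  large : p * a i ≤ q * a s₀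

/-- The first elements of the input. -/
def initial (a : ℕ → ℕ) (k : ℕ) : Finset ℕ := (Finset.range k).image a

/-- The set of large elements that is encoded by a mask. -/
def elems (a : ℕ → ℕ) (s₀ v : ℕ) : Finset ℕ := (bits v).image fun t => a (s₀ + t)

/-- The bin of a sum. -/
def binOf (p q m y : ℕ) : ℕ := y * (q * q) / (p * p * m)

section prefix_setting
variable {a : ℕ → ℕ} {n p q U V : ℕ} (h : Setting a n p q U V)
include h

theorem strictMonoOn_le {i j : ℕ} (hij : i ≤ j) (hj : j < n) : a i ≤ a j := by
  rcases hij.lt_or_eq with h1 | rfl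
  · exact (h.lt i j h1 hj).le
  · exact le_rfl

theorem mem_initial {k j : ℕ} (hk : k ≤ n) (hj : j < n) : a j ∈ initial a k ↔ j < k := by
  simp only [initial, Finset.mem_image, Finset.mem_range]
  constructor
  · rintro ⟨j', hj', he⟩
    rwa [← h.inj (by omega) hj he]
  · exact fun hjk => ⟨j, hjk, rfl⟩

theorem total_initial {k : ℕ} (hk : k ≤ n) : total (initial a k) = ∑ j ∈ Finset.range k, a j :=
  total_image h (Finset.range_subset_range.2 hk)

theorem sort_initial {k : ℕ} (hk : k ≤ n) :
    (initial a k).sort (· ≤ ·) = (List.range k).map a := by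
  have hnd : ((List.range k).map a).Nodup := by
    refine List.Nodup.map_on (fun x hx y hy hxy => ?_) List.nodup_range
    exact h.inj ((List.mem_range.1 hx).trans_le hk) ((List.mem_range.1 hy).trans_le hk) hxy
  have hs : ((List.range k).map a).Pairwise (· ≤ ·) := by
    rw [List.pairwise_map]
    refine List.pairwise_lt_range.imp_of_mem fun {x y} _ hy hxy => ?_
    exact strictMonoOn_le h hxy.le ((List.mem_range.1 hy).trans_le hk)
  have he : initial a k = ((List.range k).map a).toFinset := by
    ext x; simp [initial]
  rw [he]
  exact (List.toFinset_sort (· ≤ ·) hnd).2 hs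

theorem smallest_initial {k s₀ : ℕ} (hs : s₀ ≤ n) (hk : k ≤ s₀) :
    smallest (initial a s₀) k = initial a k := by
  rw [smallest, sort_initial h hs, ← List.map_take, List.take_range, min_eq_left hk]
  ext x; simp [initial]

theorem eps_mul_le_iff {x y : ℕ} : (p : ℝ) / q * x ≤ y ↔ p * x ≤ q * y := by
  have hq : (0 : ℝ) < q := by
    have := h.p_lt
    exact_mod_cast (by omega : 0 < q)
  rw [div_mul_eq_mul_div, div_le_iff₀ hq, mul_comm (y : ℝ)]
  exact_mod_cast Iff.rfl

variable {i s₀ : ℕ} (hp : PrefixSetting a n p q i s₀)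
include hp

theorem maxElt_initial : maxElt (initial a (i + 1)) = a i := by
  refine le_antisymm (Finset.sup_le fun x hx => ?_) (le_maxElt ?_)
  · obtain ⟨j, hj, rfl⟩ := Finset.mem_image.1 hx
    exact strictMonoOn_le h (Nat.lt_succ_iff.1 (Finset.mem_range.1 hj)) hp.lt
  · exact (mem_initial h hp.lt hp.lt).2 (Nat.lt_succ_self i)

theorem mul_le_iff {j : ℕ} (hj : j ≤ i) : p * a i ≤ q * a j ↔ s₀ ≤ j := by
  constructor
  · intro hle
    by_contra hlt
    exact absurd (hp.small j (not_le.1 hlt)) (not_lt.2 hle)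
  · intro hle
    exact hp.large.trans (Nat.mul_le_mul_left _ (strictMonoOn_le h hle (hj.trans_lt hp.lt)))

theorem large_initial :
    large (initial a (i + 1)) ((p : ℝ) / q) = (Finset.Ico s₀ (i + 1)).image a := by
  ext x
  rw [large, Finset.mem_filter, maxElt_initial h hp, eps_mul_le_iff h]
  simp only [initial, Finset.mem_image, Finset.mem_range, Finset.mem_Ico]
  constructor
  · rintro ⟨⟨j, hj, rfl⟩, hle⟩
    exact ⟨j, ⟨(mul_le_iff h hp (by omega)).1 hle, hj⟩, rfl⟩
  · rintro ⟨j, ⟨h1, h2⟩, rfl⟩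
    exact ⟨⟨j, h2, rfl⟩, (mul_le_iff h hp (by omega)).2 h1⟩

theorem small_initial : small (initial a (i + 1)) ((p : ℝ) / q) = initial a s₀ := by
  ext x
  rw [small, Finset.mem_filter, maxElt_initial h hp, ← not_le, eps_mul_le_iff h]
  simp only [initial, Finset.mem_image, Finset.mem_range]
  constructor
  · rintro ⟨⟨j, hj, rfl⟩, hle⟩
    exact ⟨j, not_le.1 fun h' => hle ((mul_le_iff h hp (by omega)).2 h'), rfl⟩
  · rintro ⟨j, h1, rfl⟩
    have := hp.le
    exact ⟨⟨j, by omega, rfl⟩, fun h' => absurd ((mul_le_iff h hp (by omega)).1 h') (by omega)⟩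

theorem elems_inj_on {v : ℕ} (hv : v < 2 ^ (i + 1 - s₀)) :
    Set.InjOn (fun t => a (s₀ + t)) (bits v) := by
  intro t ht t' ht' he
  have h1 := lt_of_mem_bits hv ht
  have h2 := lt_of_mem_bits hv ht'
  have h3 := hp.lt
  have := h.inj (by omega) (by omega) he
  omega

theorem total_elems {v : ℕ} (hv : v < 2 ^ (i + 1 - s₀)) :
    total (elems a s₀ v) = maskSum (fun t => a (s₀ + t)) v :=
  Finset.sum_image (elems_inj_on h hp hv)

theorem mem_elems {v j : ℕ} (hv : v < 2 ^ (i + 1 - s₀)) (hj : j < n) :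
    a j ∈ elems a s₀ v ↔ s₀ ≤ j ∧ v.testBit (j - s₀) = true := by
  simp only [elems, Finset.mem_image]
  have h3 := hp.lt
  constructor
  · rintro ⟨t, ht, he⟩
    have h1 := lt_of_mem_bits hv ht
    have := h.inj (by omega) hj he
    subst this
    exact ⟨by omega, by simpa using mem_bits.1 ht⟩
  · rintro ⟨h1, h2⟩
    exact ⟨j - s₀, mem_bits.2 h2, by congr 1; omega⟩

theorem elems_subset_initial {v : ℕ} (hv : v < 2 ^ (i + 1 - s₀)) : elems a s₀ v ⊆ initial a n := by
  intro x hx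
  obtain ⟨t, ht, rfl⟩ := Finset.mem_image.1 hx
  have h1 := lt_of_mem_bits hv ht
  have h3 := hp.lt
  exact (mem_initial h le_rfl (by omega)).2 (by omega)

theorem elems_subset_iff {v w : ℕ} (hv : v < 2 ^ (i + 1 - s₀)) (hw : w < 2 ^ (i + 1 - s₀)) :
    elems a s₀ v ⊆ elems a s₀ w ↔ bits v ⊆ bits w := by
  constructor
  · intro hsub t ht
    have h1 := lt_of_mem_bits hv ht
    have h3 := hp.lt
    have := hsub (Finset.mem_image_of_mem (fun t => a (s₀ + t)) ht)
    have := ((mem_elems h hp hw (by omega)).1 this).2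
    rw [mem_bits]
    simpa using this
  · exact fun hsub => Finset.image_subset_image hsub

theorem elems_subset_large {v : ℕ} (hv : v < 2 ^ (i + 1 - s₀)) :
    elems a s₀ v ⊆ large (initial a (i + 1)) ((p : ℝ) / q) := by
  rw [large_initial h hp]
  intro x hx
  obtain ⟨t, ht, rfl⟩ := Finset.mem_image.1 hx
  have h1 := lt_of_mem_bits hv ht
  exact Finset.mem_image_of_mem _ (Finset.mem_Ico.2 ⟨by omega, by omega⟩)

theorem exists_elems_eq {X : Finset ℕ} (hX : X ⊆ large (initial a (i + 1)) ((p : ℝ) / q)) :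
    ∃ v < 2 ^ (i + 1 - s₀), elems a s₀ v = X := by
  rw [large_initial h hp] at hX
  obtain ⟨v, hv, hvS⟩ := exists_bits_eq (l := i + 1 - s₀)
    (S := (Finset.range (i + 1 - s₀)).filter fun t => a (s₀ + t) ∈ X) (Finset.filter_subset _ _)
  refine ⟨v, hv, ?_⟩
  ext x
  rw [elems, hvS]
  simp only [Finset.mem_image, Finset.mem_filter, Finset.mem_range]
  constructor
  · rintro ⟨t, ⟨-, ht⟩, rfl⟩
    exact ht
  · intro hx
    obtain ⟨j, hj, rfl⟩ := Finset.mem_image.1 (hX hx)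
    have := Finset.mem_Ico.1 hj
    have e : s₀ + (j - s₀) = j := by omega
    exact ⟨j - s₀, ⟨by omega, by rwa [e]⟩, by rw [e]⟩

theorem bin_elems {v : ℕ} (hv : v < 2 ^ (i + 1 - s₀)) :
    bin (initial a (i + 1)) ((p : ℝ) / q) (elems a s₀ v) =
      binOf p q (a i) (maskSum (fun t => a (s₀ + t)) v) := by
  have hq : (q : ℝ) ≠ 0 := by
    have := h.p_lt
    exact_mod_cast (by omega : q ≠ 0)
  have hpp : (p : ℝ) ≠ 0 := by
    have := h.p_pos
    exact_mod_cast this.ne'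
  have ha : (a i : ℝ) ≠ 0 := by exact_mod_cast (h.pos i hp.lt).ne'
  rw [bin, maxElt_initial h hp, total_elems h hp hv, binOf, ← Nat.floor_div_eq_div (K := ℝ)]
  congr 1
  push_cast
  field_simp

/-- The largest element sits at the top position i - s₀, and a mask below twice 2^(i-s₀) has that
bit exactly if it is at least 2^(i-s₀). -/
theorem isLargeSubset_elems {v : ℕ} (hv : v < 2 ^ (i + 1 - s₀)) :
    IsLargeSubset (initial a (i + 1)) ((p : ℝ) / q) (elems a s₀ v) ↔ 2 ^ (i - s₀) ≤ v := by
  have hle := hp.le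
  have e : i + 1 - s₀ = i - s₀ + 1 := by omega
  rw [IsLargeSubset, maxElt_initial h hp, mem_elems h hp hv hp.lt]
  constructor
  · exact fun h' => Nat.ge_two_pow_of_testBit h'.2.2
  · intro h'
    refine ⟨elems_subset_large h hp hv, hle, ?_⟩
    rw [e] at hv
    have : v = 2 ^ (i - s₀) * 1 + (v - 2 ^ (i - s₀)) := by omega
    rw [this, Nat.testBit_two_pow_mul_add _ (by rw [pow_succ] at hv; omega)]
    simp

theorem maskSum_le_U {v : ℕ} (hv : v < 2 ^ (i + 1 - s₀)) :
    maskSum (fun t => a (s₀ + t)) v ≤ U := by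
  rw [← total_elems h hp hv]
  refine (total_mono (elems_subset_initial h hp hv)).trans ?_
  rw [total_initial h le_rfl]
  exact h.sum_le

/-- No element exceeds `a i`, which cancels against the bin width, so the number of bins does not
depend on the size of the numbers. -/
theorem binOf_maskSum_le {v : ℕ} (hv : v < 2 ^ (i + 1 - s₀)) :
    binOf p q (a i) (maskSum (fun t => a (s₀ + t)) v) ≤ (i + 1 - s₀) * (q * q) / (p * p) := by
  have h1 : maskSum (fun t => a (s₀ + t)) v ≤ (i + 1 - s₀) * a i :=
    maskSum_le hv fun t ht => strictMonoOn_le h (by omega) hp.lt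
  calc binOf p q (a i) (maskSum (fun t => a (s₀ + t)) v)
      ≤ (i + 1 - s₀) * a i * (q * q) / (p * p * a i) :=
        Nat.div_le_div_right (Nat.mul_le_mul_right _ h1)
    _ = ((i + 1 - s₀) * (q * q)) * a i / (p * p * a i) := by congr 1; ring
    _ = _ := Nat.mul_div_mul_right _ _ (h.pos i hp.lt)

/-- While there is no collision, only few masks have been enumerated. -/
theorem count_le_of_injective {k : ℕ} (hk : k ≤ 2 ^ (i + 1 - s₀)) (tab : ℕ → ℕ)
    (htab : ∀ v < k, tab (binOf p q (a i) (maskSum (fun t => a (s₀ + t)) v)) = v) :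
    k ≤ (i + 1 - s₀) * (q * q) / (p * p) + 1 := by
  have := Finset.card_le_card_of_injOn (s := Finset.range k)
    (t := Finset.range ((i + 1 - s₀) * (q * q) / (p * p) + 1))
    (fun v => binOf p q (a i) (maskSum (fun t => a (s₀ + t)) v)) (by
      intro v hv
      have hv' := Finset.mem_range.1 hv
      exact Finset.mem_coe.2 (Finset.mem_range.2 (Nat.lt_succ_of_le
        (binOf_maskSum_le h hp (hv'.trans_le hk))))) (by
      intro v hv w hw he
      have hv' := Finset.mem_range.1 (Finset.mem_coe.1 hv)
      have hw' := Finset.mem_range.1 (Finset.mem_coe.1 hw)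
      rw [← htab v hv', ← htab w hw']
      exact congrArg tab he)
  simpa using this

theorem count_bound_lt : (i + 1 - s₀) * (q * q) / (p * p) + 2 ≤ U := by
  have h1 := h.count_le
  have h2 := hp.lt
  have h3 : (i + 1 - s₀) * (q * q) ≤ n * (q * q) := Nat.mul_le_mul_right _ (by omega)
  have := Nat.div_le_self ((i + 1 - s₀) * (q * q)) (p * p)
  omega

/-- The result of `enumerateCmd`. -/
structure Enumerated (a : ℕ → ℕ) (p q i s₀ : ℕ) (t : Store) : Prop where
  sum : ∀ v < t.var .cnt, t.arr .sum v = maskSum (fun k => a (s₀ + k)) v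
  cnt_le : t.var .cnt ≤ (i + 1 - s₀) * (q * q) / (p * p) + 1
  result : (t.var .e = 0 ∧ t.var .v < t.var .cnt ∧ t.var .cnt < 2 ^ (i + 1 - s₀) ∧
      binOf p q (a i) (maskSum (fun k => a (s₀ + k)) (t.var .v)) =
        binOf p q (a i) (maskSum (fun k => a (s₀ + k)) (t.var .cnt))) ∨
    (0 < t.var .e ∧ t.var .cnt = 2 ^ (i + 1 - s₀) ∧ ∀ v < t.var .cnt, ∀ w < t.var .cnt,
      binOf p q (a i) (maskSum (fun k => a (s₀ + k)) v) =
        binOf p q (a i) (maskSum (fun k => a (s₀ + k)) w) → v = w)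

/-- On the masks enumerated so far, `tab` inverts the map from masks to bins. Hence that map is
injective, and the pigeonhole bound limits both the running time and the numbers that occur. -/
theorem wp_enumerateCmd {s : Store} (hs : HasInput a n p q s) (hm : s.var .m = a i)
    (hss : s.var .s = s₀) (hl : s.var .l = i + 1 - s₀) :
    wp V enumerateCmd s fun t => Enumerated a p q i s₀ t ∧
      t.clk ≤ s.clk + 300 * ((i + 1 - s₀) * (q * q) / (p * p) + 2) := by
  have hn := h.n_add_two_le
  obtain ⟨hV, hV'⟩ := h.lt_V
  have hle := hp.le
  have hlt := hp.lt
  have hcb := count_bound_lt h hp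
  have hpos := h.p_pos
  generalize hlen : i + 1 - s₀ = l at *
  generalize hBdef : l * (q * q) / (p * p) = B at *
  set b : ℕ → ℕ := fun t => a (s₀ + t) with hb
  unfold enumerateCmd
  simp only [wp_seq, wp_assign, wp_put]
  simp [hl]
  refine ⟨by omega, by omega, by omega, ?_⟩
  refine wp.mono (wp.frame (wp_loop (fun t => t.var .t ≤ l ∧ t.var .hb = 2 ^ t.var .t ∧
    2 ^ t.var .t ≤ t.var .cnt ∧ t.var .cnt < 2 ^ (t.var .t + 1) ∧
    (t.var .t = l → t.var .cnt = 2 ^ l) ∧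
    (∀ v < t.var .cnt, t.arr .sum v = maskSum b v) ∧
    (∀ v < t.var .cnt, t.arr .bins v = binOf p q (a i) (maskSum b v)) ∧
    (∀ v < t.var .cnt, t.arr .tab (binOf p q (a i) (maskSum b v)) = v) ∧
    ((t.var .e = l ∧ t.clk ≤ s.clk + 300 * t.var .cnt) ∨ (t.var .e = 0 ∧ t.var .v < t.var .cnt ∧
      t.var .cnt < 2 ^ l ∧ binOf p q (a i) (maskSum b (t.var .v)) =
        binOf p q (a i) (maskSum b (t.var .cnt)) ∧ t.clk ≤ s.clk + 300 * t.var .cnt + 150)))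
    (fun t => if t.var .e = 0 then 0 else 2 ^ l + 1 - t.var .cnt) (Q := fun t =>
      Enumerated a p q i s₀ t ∧ t.clk ≤ s.clk + 300 * (B + 2)) ?_ ?_)) fun t ht => ht.2
  · simp [binOf]
    omega
  · rintro t hf ⟨h1, h2, h3, h4, h5, h6, h7, h8, h9⟩
    have hin : HasInput a n p q t := HasInput.frame (by simp [hs]) hf
      (by decide) (by decide) (by decide)
    have htm : t.var .m = a i := by simpa [hm] using hf.var .m (by decide)
    have hts : t.var .s = s₀ := by simpa [hss] using hf.var .s (by decide)
    have hcl : t.var .cnt ≤ 2 ^ l := by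
      rcases h1.lt_or_eq with h1 | h1
      · exact h4.le.trans (Nat.pow_le_pow_right (by norm_num) h1)
      · exact (h5 h1).le
    have hcB : t.var .cnt ≤ B + 1 := by
      have := count_le_of_injective h hp (k := t.var .cnt) (by rw [hlen]; exact hcl) (t.arr .tab) h8
      rwa [hlen, hBdef] at this
    refine ⟨by simp, by simp, fun hlt' => ?_, fun hge => ?_⟩
    · simp at hlt'
      rcases h9 with ⟨h9, h10⟩ | ⟨h9, -⟩
      swap
      · omega
      have htl : t.var .t < l := by omega
      have hcl' : t.var .cnt < 2 ^ l :=
        h4.trans_le (Nat.pow_le_pow_right (by norm_num) htl)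
      have hcsum : maskSum b (t.var .cnt) =
          maskSum b (t.var .cnt - 2 ^ t.var .t) + a (s₀ + t.var .t) := by
        have : t.var .cnt = 2 ^ t.var .t + (t.var .cnt - 2 ^ t.var .t) := by omega
        conv_lhs => rw [this]
        rw [maskSum_two_pow_add]
        rw [pow_succ] at h4
        omega
      have hp2 : 0 < 2 ^ t.var .t := Nat.two_pow_pos _
      have g1 := h6 (t.var .cnt - 2 ^ t.var .t) (by omega)
      have g2 := hin.inp (s₀ + t.var .t) (by omega)
      have g3 : maskSum b (t.var .cnt) ≤ U := maskSum_le_U h hp (by rw [hlen]; exact hcl')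
      have g4 := h.mul_lt g3 h.q_sq_le
      have hpp : p * p ≤ U := (Nat.mul_le_mul h.p_lt.le h.p_lt.le).trans h.q_sq_le
      have g5 := h.mul_lt hpp (h.le_U hp.lt)
      have hbB : binOf p q (a i) (maskSum b (t.var .cnt)) ≤ B := by
        have := binOf_maskSum_le h hp (v := t.var .cnt) (by rw [hlen]; exact hcl')
        rwa [hlen, hBdef] at this
      have hdiv : ∀ x, x * (q * q) / (p * p * a i) = binOf p q (a i) x := fun x => rfl
      have hqq := h.q_sq_le
      simp only [wp_seq, wp_assign, wp_put, wp_ite]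
      simp [hin.p, hin.q, htm, hts, h2, g1, g2, ← hcsum, hdiv, hin.len]
      generalize hβ : binOf p q (a i) (maskSum b (t.var .cnt)) = β at *
      generalize hw : t.arr .tab β - (t.arr .tab β - t.var .cnt) = w
      have hwc : w ≤ t.var .cnt := by omega
      have hwt : w < t.var .cnt → t.arr .tab β = w := by omega
      generalize hval : Function.update (t.arr .bins) (t.var .cnt) β w = val
      have hval' : (w < t.var .cnt → val = binOf p q (a i) (maskSum b w)) ∧
          (w = t.var .cnt → val = β) ∧ val ≤ B := by
        rcases hwc.lt_or_eq with hwc | rfl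
        · rw [Function.update_of_ne hwc.ne, h7 w hwc] at hval
          refine ⟨fun _ => hval.symm, by omega, ?_⟩
          have := binOf_maskSum_le h hp (v := w) (by rw [hlen]; omega)
          rwa [hlen, hBdef, hval] at this
        · rw [Function.update_self] at hval
          exact ⟨by omega, fun _ => hval.symm, by omega⟩
      refine ⟨⟨⟨by omega, by omega⟩, by omega⟩, ⟨⟨by omega, by omega⟩, by omega, by omega⟩,
        ⟨⟨by omega, by omega⟩, by omega, by omega⟩, by omega, ?_, ?_⟩
      · intro h11 h12 h13
        have hwc' : w < t.var .cnt := by omega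
        refine ⟨by omega, fun _ => ⟨⟨h1, h3, h4, h5, fun v hv => ?_, fun v hv => ?_, h8, .inr
          ⟨hwc', hcl', ?_, by omega⟩⟩, ?_⟩⟩
        · rw [Function.update_of_ne hv.ne, h6 v hv]
        · rw [Function.update_of_ne hv.ne, h7 v hv]
        · rw [← hval'.1 hwc']
          omega
        · rw [if_neg (by omega)]
          omega
      · intro h11
        -- An earlier mask in the same bin would be the table entry of that bin and would have
        -- passed the test.
        have hne : ∀ v < t.var .cnt, binOf p q (a i) (maskSum b v) ≠ β := by
          intro v hv he
          have h12 := h8 v hv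
          rw [he] at h12
          have h13 : w = v := by omega
          have h14 := hval'.1 (by omega)
          rw [h13, he] at h14
          omega
        have f6 : ∀ v ≤ t.var .cnt, Function.update (t.arr .sum) (t.var .cnt)
            (maskSum b (t.var .cnt)) v = maskSum b v := by
          intro v hv
          rcases hv.lt_or_eq with hv | rfl
          · rw [Function.update_of_ne hv.ne, h6 v hv]
          · rw [Function.update_self]
        have f7 : ∀ v ≤ t.var .cnt, Function.update (t.arr .bins) (t.var .cnt) β v =
            binOf p q (a i) (maskSum b v) := by
          intro v hv
          rcases hv.lt_or_eq with hv | rfl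
          · rw [Function.update_of_ne hv.ne, h7 v hv]
          · rw [Function.update_self, hβ]
        have f8 : ∀ v ≤ t.var .cnt, Function.update (t.arr .tab) β (t.var .cnt)
            (binOf p q (a i) (maskSum b v)) = v := by
          intro v hv
          rcases hv.lt_or_eq with hv | rfl
          · rw [Function.update_of_ne (hne v hv), h8 v hv]
          · rw [hβ, Function.update_self]
        have hl0 : t.var .e ≠ 0 := by omega
        have e2 : 2 ^ (t.var .t + 1) = 2 ^ t.var .t + 2 ^ t.var .t := by ring
        refine ⟨⟨by omega, by omega⟩, by omega, fun h12 => ⟨by omega, fun _ => ⟨⟨h1, by omega,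
          by omega, by omega, f6, f7, f8, .inl ⟨h9, by omega⟩⟩, ?_⟩⟩, fun h12 => ?_⟩
        · rw [if_neg hl0, if_neg hl0]
          omega
        · have e3 : 2 ^ (t.var .t + 1 + 1) = 2 ^ (t.var .t + 1) + 2 ^ (t.var .t + 1) := by ring
          have h14 : t.var .cnt + 1 = 2 ^ (t.var .t + 1) := by omega
          have h15 : t.var .t < 2 ^ t.var .t := Nat.lt_two_pow_self
          refine ⟨by omega, ⟨by omega, by omega⟩, fun _ => ⟨⟨htl, by omega, by omega, by omega,
            fun h16 => by rw [h14, h16], f6, f7, f8, .inl ⟨h9, by omega⟩⟩, ?_⟩⟩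
          rw [if_neg hl0, if_neg hl0]
          omega
    · simp at hge
      rcases h9 with ⟨h9, h10⟩ | ⟨h9, h10, h11, h12, h13⟩
      · have h14 : t.var .t = l := by omega
        have h15 := h5 h14
        refine ⟨⟨h6, by simpa [hlen, hBdef] using hcB, .inr ⟨by simp; omega, by simpa [hlen] using h15,
          fun v hv w hw he => ?_⟩⟩, by simp; omega⟩
        rw [← h8 v hv, ← h8 w hw]
        exact congrArg _ he
      · exact ⟨⟨h6, by simpa [hlen, hBdef] using hcB, .inl ⟨h9, h10, by simpa [hlen] using h11, h12⟩⟩,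
          by simp; omega⟩

end prefix_setting

end SubsetSumRatio

/-! ### Computing the sorted lists and solving Partition -/

namespace SubsetSumRatio

/-- The row of `f` in the table of lists, with rows of length `H`. -/
def row (s : Store) (H f : ℕ) : ℕ → ℕ := fun k => s.arr .list (f * H + k)

theorem row_ne {H f f' k k' : ℕ} (hk : k < H) (hk' : k' < H) (hf : f ≠ f') :
    f * H + k ≠ f' * H + k' := by
  intro he
  have h1 : (f * H + k) / H = f := by
    rw [mul_comm, Nat.mul_add_div (by omega), Nat.div_eq_of_lt hk, add_zero]
  have h2 : (f' * H + k') / H = f' := by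
    rw [mul_comm, Nat.mul_add_div (by omega), Nat.div_eq_of_lt hk', add_zero]
  rw [he, h2] at h1
  exact hf h1.symm

/-- All subset sums are tabulated. -/
structure HasSums (b : ℕ → ℕ) (l U : ℕ) (s : Store) : Prop where
  sum : ∀ v < 2 ^ l, s.arr .sum v = maskSum b v
  le : ∀ v < 2 ^ l, maskSum b v ≤ U
  two_pow_le : 2 ^ l ≤ U
  H : s.var .H = 2 ^ l

/-- The list of submasks of `f` has been computed. -/
def HasList (b : ℕ → ℕ) (l : ℕ) (s : Store) (f : ℕ) : Prop :=
  SortedSubmasks b f (row s (2 ^ l) f) (s.arr .num f)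

theorem HasList.congr {b : ℕ → ℕ} {l f : ℕ} {s t : Store} (hl : HasList b l s f) (hf : f < 2 ^ l)
    (h1 : ∀ k < 2 ^ l, t.arr .list (f * 2 ^ l + k) = s.arr .list (f * 2 ^ l + k))
    (h2 : t.arr .num f = s.arr .num f) : HasList b l t f := by
  unfold HasList
  rw [h2]
  refine SortedSubmasks.congr hl fun k hk => h1 k ?_
  rw [hl.length] at hk
  exact hk.trans_le (subcount_le hf)

section verification
variable {a : ℕ → ℕ} {n p q U V : ℕ} (h : Setting a n p q U V)
include h

theorem wp_mergeCmd {b : ℕ → ℕ} {l : ℕ} {s : Store} (hs : HasSums b l U s) {t u f : ℕ}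
    (hu : u < 2 ^ t) (htl : t < l) (hf : f = 2 ^ t + u) (hsf : s.var .f = f) (hsu : s.var .f0 = u)
    (hhb : s.var .hb = 2 ^ t) (hN : s.var .N = s.arr .num u) (hlu : HasList b l s u)
    (ha : s.var .a = 0) (hb : s.var .b = 0) {Q : Store → Prop}
    (hQ : ∀ r, SortedSubmasks b f (row r (2 ^ l) f) (s.arr .num u + s.arr .num u) →
      (∀ f' ≠ f, ∀ k < 2 ^ l, r.arr .list (f' * 2 ^ l + k) = s.arr .list (f' * 2 ^ l + k)) →
      r.clk ≤ s.clk + 200 * (s.arr .num u + s.arr .num u) + 20 → Q r) :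
    wp V mergeCmd s Q := by
  obtain ⟨hV, hV'⟩ := h.lt_V
  have h2t : 2 ^ (t + 1) ≤ 2 ^ l := Nat.pow_le_pow_right (by norm_num) htl
  have h2t' : 2 ^ (t + 1) = 2 ^ t + 2 ^ t := by ring
  have hCU := hs.two_pow_le
  have hfC : f < 2 ^ l := by omega
  have huC : u < 2 ^ l := by omega
  have hNf : s.arr .num u + s.arr .num u ≤ 2 ^ l := by
    rw [hlu.length, ← subcount_two_pow_add hu, ← hf]
    exact subcount_le hfC
  have hNpos : 0 < s.arr .num u := hlu.length ▸ subcount_pos u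
  have m1 := h.mul_lt (hfC.le.trans hCU) hCU
  have m2 := h.mul_lt (huC.le.trans hCU) hCU
  have hsub := hlu.sub
  refine wp_loop (fun r => Merged b t (row s (2 ^ l) u) (s.arr .num u) (row r (2 ^ l) f)
      (r.var .a) (r.var .b) ∧
    (∀ f' ≠ f, ∀ k < 2 ^ l, r.arr .list (f' * 2 ^ l + k) = s.arr .list (f' * 2 ^ l + k)) ∧
    r.clk ≤ s.clk + 200 * (r.var .a + r.var .b)) (fun r => s.arr .num u + s.arr .num u -
      (r.var .a + r.var .b)) ?_ ?_
  · rw [ha, hb]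
    exact ⟨Merged.init _ _ _ _ _, fun _ _ _ _ => rfl, by omega⟩
  rintro r hfr ⟨h1, h2, h3⟩
  have e1 : r.var .f = f := (hfr.var _ (by decide)).trans hsf
  have e2 : r.var .f0 = u := (hfr.var _ (by decide)).trans hsu
  have e3 : r.var .hb = 2 ^ t := (hfr.var _ (by decide)).trans hhb
  have e4 : r.var .N = s.arr .num u := (hfr.var _ (by decide)).trans hN
  have e5 : r.var .H = 2 ^ l := (hfr.var _ (by decide)).trans hs.H
  have e6 : r.arr .sum = s.arr .sum := hfr.arr _ (by decide)
  have hle := h1.le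
  have hle' := h1.le_length
  have hlu' : SortedSubmasks b u (row s (2 ^ l) u) (s.arr .num u) := hlu
  generalize hNdef : s.arr .num u = N at *
  refine ⟨by simp; omega, by simp; omega, fun hlt => ?_, fun hge => ?_⟩
  · simp [e4] at hlt
    have hbN : r.var .b < N := by omega
    have hrow : ∀ k < N, r.arr .list (u * 2 ^ l + k) = row s (2 ^ l) u k := fun k hk =>
      h2 u (by omega) k (by omega)
    obtain ⟨k, hk⟩ : ∃ k, r.var .a - (r.var .a + 1 - N) = k := ⟨_, rfl⟩
    have hkN : k < N := by omega
    have g1 := hrow k hkN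
    have g2 := hrow _ hbN
    have g3 : row s (2 ^ l) u k < 2 ^ l := lt_of_bits_subset (hsub k hkN) huC
    have hy : row s (2 ^ l) u (r.var .b) < 2 ^ t := lt_of_bits_subset (hsub _ hbN) hu
    have g4 := hs.sum _ g3
    have g5 := hs.sum (row s (2 ^ l) u (r.var .b) + 2 ^ t) (by omega)
    have g6 := hs.le _ g3
    have upd : ∀ v, (row (r.put .list (f * 2 ^ l + (r.var .a + r.var .b)) v 0) (2 ^ l) f) =
        Function.update (row r (2 ^ l) f) (r.var .a + r.var .b) v := by
      intro v
      funext j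
      simp only [row, Store.put_arr, if_true, Function.update_apply]
      simp
    have oth : ∀ v, ∀ f' ≠ f, ∀ k < 2 ^ l,
        Function.update (r.arr .list) (f * 2 ^ l + (r.var .a + r.var .b)) v (f' * 2 ^ l + k) =
          s.arr .list (f' * 2 ^ l + k) := by
      intro v f' hf' k hk
      rw [Function.update_of_ne (row_ne hk (by omega) hf'), h2 f' hf' k hk]
    simp only [wp_seq, wp_assign, wp_put, wp_ite]
    simp [e1, e2, e3, e4, e5, e6, hk, g1, g2, g4, g5]
    refine ⟨⟨by omega, by omega, by omega⟩, ⟨⟨by omega, by omega⟩, by omega⟩, ⟨by omega, by omega⟩,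
      by omega, fun h4 h5 => ⟨⟨by omega, by omega, by omega⟩, ⟨by omega, by omega⟩,
        fun _ => ⟨⟨?_, oth _, by omega⟩, by omega⟩⟩,
      fun h4 => ⟨⟨by omega, by omega, by omega⟩, ⟨by omega, by omega⟩,
        fun _ => ⟨⟨?_, oth _, by omega⟩, by omega⟩⟩⟩
    · have hka : k = r.var .a := by omega
      subst hka
      have := h1.takeLeft hlu' (by omega) (by omega)
      rw [← upd] at this
      exact this
    · have := h1.takeRight hu hlu' (by omega) (fun hlt => by
        have hka : k = r.var .a := by omega
        subst hka
        omega)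
      rw [← upd] at this
      exact this
  · simp [e4] at hge
    refine hQ _ ?_ h2 (by simp; omega)
    subst hf
    exact h1.sortedSubmasks hu hlu' (by omega)

/-- Used for the low half (g = 0) and then for the high half, where it must not destroy the low
lists. Each list is merged in time proportional to its length, and the lengths add up to 3^k by
`sum_subcount`. -/
theorem wp_buildCmd {b : ℕ → ℕ} {l : ℕ} {s : Store} (hs : HasSums b l U s) {g k : ℕ}
    (hgk : g + k ≤ l) (hunit : s.var .unit = 2 ^ g) (hlast : s.var .last = 2 ^ (g + k))
    (h0 : HasList b l s 0) :
    wp V buildCmd s fun t => (∀ d < 2 ^ k, HasList b l t (2 ^ g * d)) ∧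
      (∀ f < 2 ^ g, HasList b l s f → HasList b l t f) ∧ t.clk ≤ s.clk + 400 * 3 ^ k := by
  obtain ⟨hV, hV'⟩ := h.lt_V
  have hV0 : 0 < V := by omega
  have hV1 : 1 < V := by omega
  have hCU := hs.two_pow_le
  have hpg := Nat.two_pow_pos g
  have hpk := Nat.two_pow_pos k
  have hlast' : 2 ^ (g + k) ≤ 2 ^ l := Nat.pow_le_pow_right (by norm_num) hgk
  have hpow : 2 ^ (g + k) = 2 ^ g * 2 ^ k := pow_add 2 g k
  unfold buildCmd
  simp only [wp_seq, wp_assign]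
  refine ⟨by simp, by simp, ?_⟩
  refine wp_loop (fun t => ∃ d T, 0 < d ∧ d ≤ 2 ^ k ∧ t.var .f = 2 ^ g * d ∧ 2 ^ T ≤ d ∧
    d < 2 ^ (T + 1) ∧ t.var .hb = 2 ^ (g + T) ∧ (∀ d' < d, HasList b l t (2 ^ g * d')) ∧
    (∀ f < 2 ^ g, HasList b l s f → HasList b l t f) ∧
    t.clk ≤ s.clk + 20 + 350 * ∑ d' ∈ Finset.range d, subcount (2 ^ g * d'))
    (fun t => 2 ^ (g + k) - t.var .f) ?_ ?_
  · refine ⟨1, 0, by norm_num, hpk, by simp [hunit], by norm_num, by norm_num, by simp [hunit], ?_,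
      fun f _ hf => hf, ?_⟩
    · intro d' hd'
      obtain rfl : d' = 0 := by omega
      exact h0
    · simp; omega
  rintro t hf ⟨d, T, hd, hdk, h1, hTd, hdT, h2, h3, h4, h5⟩
  have e1 : t.var .unit = 2 ^ g := by simpa [hunit] using hf.var .unit (by decide)
  have e2 : t.var .last = 2 ^ (g + k) := by simpa [hlast] using hf.var .last (by decide)
  have e3 : t.var .H = 2 ^ l := by simpa [hs.H] using hf.var .H (by decide)
  have e4 : t.arr .sum = s.arr .sum := by simpa using hf.arr .sum (by decide)
  have hpT : 2 ^ (T + 1) = 2 ^ T + 2 ^ T := by ring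
  have hgT : 2 ^ (g + T) = 2 ^ g * 2 ^ T := pow_add 2 g T
  refine ⟨by simp, by simp, fun hlt => ?_, fun hge => ?_⟩
  · simp [e2] at hlt
    have hdk' : d < 2 ^ k := by
      rw [h1, hpow] at hlt
      exact lt_of_mul_lt_mul_left hlt (Nat.zero_le _)
    -- T is the top bit of d, and w is the rest; the list for w is available because w < d.
    obtain ⟨w, rfl⟩ : ∃ w, d = 2 ^ T + w := ⟨d - 2 ^ T, by omega⟩
    have hTk : T < k := (Nat.pow_lt_pow_iff_right (by norm_num)).1 (hTd.trans_lt hdk')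
    have hu : 2 ^ g * w < 2 ^ (g + T) := by
      rw [hgT]; exact Nat.mul_lt_mul_of_pos_left (by omega) hpg
    have hfu : 2 ^ g * (2 ^ T + w) = 2 ^ (g + T) + 2 ^ g * w := by rw [hgT]; ring
    have hfl : 2 ^ g * (2 ^ T + w) < 2 ^ l := by omega
    have hul : 2 ^ g * w < 2 ^ l := by omega
    have hsub : t.var .f - t.var .hb = 2 ^ g * w := by omega
    have hlist := h3 w (by omega)
    have hlen := hlist.length
    have hsc := subcount_two_pow_add hu
    have hspos := subcount_pos (2 ^ g * w)
    have hscl := subcount_le hul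
    have hgl : 2 ^ g ≤ 2 ^ l := Nat.pow_le_pow_right (by norm_num) (by omega)
    simp only [wp_seq, wp_assign, wp_put, wp_ite]
    simp only [Expr.eval_var, Expr.eval_sub, Expr.eval_get, Store.tick_var, Store.set_var,
      Store.tick_arr, Store.set_arr, if_true, reduceCtorEq, if_false, hsub]
    refine ⟨by simp, by simp, by simp; omega, by simp; omega, ?_⟩
    refine wp.mono (wp.frame (wp_mergeCmd h (b := b) (l := l) (t := g + T) (u := 2 ^ g * w)
      (f := 2 ^ g * (2 ^ T + w))
      ⟨by simpa [e4] using hs.sum, hs.le, hs.two_pow_le, by simp [e3]⟩ hu (by omega) hfu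
      (by simp [h1]) (by simp) (by simp [h2]) (by simp) (by exact hlist) (by simp) (by simp)
      (Q := fun r => SortedSubmasks b (2 ^ g * (2 ^ T + w)) (row r (2 ^ l) (2 ^ g * (2 ^ T + w)))
        (t.arr .num (2 ^ g * w) + t.arr .num (2 ^ g * w)) ∧
      (∀ f' ≠ 2 ^ g * (2 ^ T + w), ∀ k < 2 ^ l,
        r.arr .list (f' * 2 ^ l + k) = t.arr .list (f' * 2 ^ l + k)) ∧
      r.clk ≤ t.clk + 200 * (t.arr .num (2 ^ g * w) + t.arr .num (2 ^ g * w)) + 80)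
      (fun r r1 r2 r3 => ⟨r1, r2, r3.trans (by simp; omega)⟩))) ?_
    rintro r ⟨hfr, r1, r2, r3⟩
    have f1 : r.var .f = 2 ^ g * (2 ^ T + w) := by simpa [h1] using hfr.var .f (by decide)
    have f2 : r.var .unit = 2 ^ g := by simpa [e1] using hfr.var .unit (by decide)
    have f3 : r.var .hb = 2 ^ (g + T) := by simpa [h2] using hfr.var .hb (by decide)
    have f4 : r.var .N = t.arr .num (2 ^ g * w) := by simpa using hfr.var .N (by decide)
    have f5 : r.arr .num = t.arr .num := by simpa using hfr.arr .num (by decide)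
    have hnew : ∀ r', r'.arr .list = r.arr .list → r'.arr .num = Function.update (t.arr .num)
        (2 ^ g * (2 ^ T + w)) (t.arr .num (2 ^ g * w) + t.arr .num (2 ^ g * w)) →
        (∀ d' < 2 ^ T + w + 1, HasList b l r' (2 ^ g * d')) ∧
        (∀ f < 2 ^ g, HasList b l s f → HasList b l r' f) := by
      intro r' hr1 hr2
      have hold : ∀ f < 2 ^ l, f ≠ 2 ^ g * (2 ^ T + w) → HasList b l t f → HasList b l r' f := by
        intro f hfl hne hf
        refine hf.congr hfl (fun k hk => ?_) ?_
        · rw [hr1, r2 f hne k hk]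
        · rw [hr2, Function.update_of_ne hne]
      refine ⟨fun d' hd' => ?_, fun f hf hsf => hold f (by omega) ?_ (h4 f hf hsf)⟩
      · rcases (Nat.lt_succ_iff.1 hd').lt_or_eq with hd' | rfl
        · refine hold _ ?_ ?_ (h3 d' hd')
          · have := Nat.mul_lt_mul_of_pos_left hd' hpg
            omega
          · exact (Nat.mul_lt_mul_of_pos_left hd' hpg).ne
        · unfold HasList
          rw [hr2, Function.update_self]
          refine r1.congr fun k _ => ?_
          simp only [row, hr1]
      · have : 2 ^ g * 1 ≤ 2 ^ g * (2 ^ T + w) := Nat.mul_le_mul_left _ hd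
        omega
    have hnext : 2 ^ g * (2 ^ T + w) + 2 ^ g = 2 ^ g * (2 ^ T + w + 1) := by ring
    have hclk := Finset.sum_range_succ (fun d' => subcount (2 ^ g * d')) (2 ^ T + w)
    rw [hfu, hsc, ← hlen] at hclk
    rw [← hlen] at hspos hscl
    have hgT2 : 2 ^ (g + (T + 1)) = 2 ^ (g + T) + 2 ^ (g + T) := by ring
    have hcmp : 2 ^ g * (2 ^ T + w + 1) < 2 ^ (g + T) + 2 ^ (g + T) ↔ 2 ^ T + w + 1 < 2 ^ (T + 1) := by
      rw [← hgT2, pow_add 2 g (T + 1)]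
      exact Nat.mul_lt_mul_left hpg
    simp [f1, f2, f3, f4, hnext, hV0]
    refine ⟨by omega, by omega, by omega, fun hlt' _ => ⟨⟨hdk', by omega, hcmp.1 hlt',
      fun d' hd' => (hnew _ (by simp) (by simp [f5])).1 d' (Nat.lt_succ_of_le hd'),
      (hnew _ (by simp) (by simp [f5])).2, ?_⟩, ?_⟩,
      fun hge => ⟨by omega, fun _ => ⟨⟨hdk', T + 1, ?_, ?_, hgT2.symm,
      fun d' hd' => (hnew _ (by simp) (by simp [f5])).1 d' (Nat.lt_succ_of_le hd'),
      (hnew _ (by simp) (by simp [f5])).2, ?_⟩, ?_⟩⟩⟩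
    · rw [hclk]; omega
    · omega
    · by_contra hlt'
      exact absurd (hcmp.2 (not_le.1 hlt')) (not_lt.2 hge)
    · have : 2 ^ (T + 1 + 1) = 2 ^ (T + 1) + 2 ^ (T + 1) := by ring
      omega
    · rw [hclk]; omega
    · omega
  · simp [e2] at hge
    have hd' : d = 2 ^ k := by
      rw [h1, hpow] at hge
      exact le_antisymm hdk (le_of_mul_le_mul_left hge hpg)
    subst hd'
    rw [sum_subcount] at h5
    have : 1 ≤ 3 ^ k := Nat.one_le_pow _ _ (by norm_num)
    refine ⟨h3, h4, ?_⟩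
    simp; omega

theorem wp_searchCmd {b : ℕ → ℕ} {l : ℕ} {s : Store} (hs : HasSums b l U s) {k x : ℕ}
    (hk : k ≤ l) (hx : x < 2 ^ l) (hsx : s.var .x = x) (hg : s.var .g = 2 ^ k)
    (hlow : ∀ f < 2 ^ k, HasList b l s f) (hhigh : ∀ d < 2 ^ (l - k), HasList b l s (2 ^ k * d)) :
    wp V searchCmd s fun t => bits (t.var .bm) ⊆ bits x ∧
      2 * maskSum b (t.var .bm) ≤ maskSum b x ∧
      (∀ P, bits P ⊆ bits x → 2 * maskSum b P ≤ maskSum b x →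
        maskSum b P ≤ maskSum b (t.var .bm)) ∧
      t.clk ≤ s.clk + 250 * (subcount (x % 2 ^ k) + subcount (2 ^ k * (x / 2 ^ k))) := by
  obtain ⟨hV, hV'⟩ := h.lt_V
  have hV0 : 0 < V := by omega
  have hV1 : 1 < V := by omega
  have hCU := hs.two_pow_le
  have hpk := Nat.two_pow_pos k
  have hmod : x % 2 ^ k < 2 ^ k := Nat.mod_lt _ hpk
  have hma : x % 2 ^ k + 2 ^ k * (x / 2 ^ k) = x := Nat.mod_add_div x _
  have hpl : 2 ^ l = 2 ^ k * 2 ^ (l - k) := by rw [← pow_add, Nat.add_sub_cancel' hk]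
  have hL := hlow _ hmod
  have hM := hhigh (x / 2 ^ k) (Nat.div_lt_of_lt_mul (by rwa [← hpl]))
  generalize hc : x % 2 ^ k = c at *
  generalize hd : x / 2 ^ k = d at *
  have hd' : x / 2 ^ k * 2 ^ k = 2 ^ k * d := by rw [hd, mul_comm]
  have hc' : x - 2 ^ k * d = c := by omega
  have hL' : SortedSubmasks b c (row s (2 ^ l) c) (s.arr .num c) := hL
  have hM' : SortedSubmasks b (2 ^ k * d) (row s (2 ^ l) (2 ^ k * d)) (s.arr .num (2 ^ k * d)) := hM
  have hcl : c < 2 ^ l := by omega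
  have hdl : 2 ^ k * d < 2 ^ l := by omega
  have hNl := subcount_le hcl
  have hKl := subcount_le hdl
  have hNp := subcount_pos c
  have hKp := subcount_pos (2 ^ k * d)
  rw [← hL'.length] at hNl hNp ⊢
  rw [← hM'.length] at hKl hKp ⊢
  have m1 := h.mul_lt (hcl.le.trans hCU) hCU
  have m2 := h.mul_lt (hdl.le.trans hCU) hCU
  unfold searchCmd
  simp only [wp_seq, wp_assign]
  simp [hsx, hg, hd', hc']
  refine ⟨by omega, by omega, ?_⟩
  refine wp_loop (fun t => Searched b x (row s (2 ^ l) c) (s.arr .num c)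
      (row s (2 ^ l) (2 ^ k * d)) (s.arr .num (2 ^ k * d)) (t.var .a) (t.var .b) (t.var .bm) ∧
    -- Potential argument: every round advances `a` or lowers `b` by one, so the time is linear in
    -- the sum of the two list lengths.
    t.clk + 120 * t.var .b ≤ s.clk + 80 + 120 * (t.var .a + s.arr .num (2 ^ k * d)))
    (fun t => s.arr .num c - t.var .a + t.var .b) ?_ ?_
  · simp
    exact Searched.init
  rintro t hf ⟨h1, h2⟩
  have e1 : t.var .x = x := by simpa [hsx] using hf.var .x (by decide)
  have e2 : t.var .c = c := by simpa using hf.var .c (by decide)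
  have e3 : t.var .d = 2 ^ k * d := by simpa using hf.var .d (by decide)
  have e4 : t.var .N = s.arr .num c := by simpa using hf.var .N (by decide)
  have e5 : t.var .H = 2 ^ l := by simpa [hs.H] using hf.var .H (by decide)
  have e6 : t.arr .sum = s.arr .sum := by simpa using hf.arr .sum (by decide)
  have e7 : t.arr .list = s.arr .list := by simpa using hf.arr .list (by decide)
  have l1 := h1.le_left
  have l2 := h1.le_right
  refine ⟨by simp; omega, by simp [hV1], fun hlt => ?_, fun hge => ?_⟩
  · simp [e4] at hlt
    have ha : t.var .a < s.arr .num c := by omega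
    have hb : 0 < t.var .b := by omega
    have hb' : t.var .b - 1 < s.arr .num (2 ^ k * d) := by omega
    have g1 : s.arr .list (c * 2 ^ l + t.var .a) = row s (2 ^ l) c (t.var .a) := rfl
    have g2 : s.arr .list (2 ^ k * d * 2 ^ l + (t.var .b - 1)) =
      row s (2 ^ l) (2 ^ k * d) (t.var .b - 1) := rfl
    have g3 := bits_pair_subset hmod hL' hM' ha hb'
    rw [hma] at g3
    have g4 := lt_of_bits_subset g3 hx
    have g5 := hs.le _ g4
    have g6 := hs.sum _ g4
    have g7 := hs.sum _ hx
    have g8 := hs.sum _ (lt_of_bits_subset h1.sub hx)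
    simp only [wp_seq, wp_assign, wp_ite]
    simp [e1, e2, e3, e5, e6, e7, g1, g2, g6, g7, g8, hV0, hV1]
    refine ⟨by omega, by omega, fun hlt _ => ⟨⟨h1.moveRight hmod hL' hM' ha hb hlt, by omega⟩,
      by omega⟩, fun hge => ⟨fun hlt => ⟨by omega, fun _ => ⟨⟨h1.moveLeft hmod hL' hM' hma.symm
        ha hb hge (.inr rfl) hlt.le le_rfl, by omega⟩, by omega⟩⟩,
      fun hle => ⟨by omega, fun _ => ⟨⟨h1.moveLeft hmod hL' hM' hma.symm ha hb hge (.inl rfl)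
        le_rfl hle, by omega⟩, by omega⟩⟩⟩⟩
  · simp [e4] at hge
    refine ⟨h1.sub, h1.feasible, fun P hP hle => h1.le_best hmod hL' hM' hma.symm (by omega) hP hle, ?_⟩
    simp
    omega

end verification

end SubsetSumRatio

/-! ### From marks to candidates, and the Partition case -/

namespace SubsetSumRatio

theorem initial_nonempty (a : ℕ → ℕ) (i : ℕ) : (initial a (i + 1)).Nonempty :=
  ⟨a i, Finset.mem_image_of_mem _ (Finset.mem_range.2 (Nat.lt_succ_self i))⟩

section candidates
variable {a : ℕ → ℕ} {n p q U V : ℕ} (h : Setting a n p q U V)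
include h

theorem mem_pick {cm : ℕ → ℕ} {v j : ℕ} (hj : j < n) : a j ∈ pick a n cm v ↔ cm j = v := by
  simp only [pick, Finset.mem_image, Finset.mem_filter, Finset.mem_range]
  constructor
  · rintro ⟨k, ⟨hk, hkv⟩, he⟩
    rwa [← h.inj hk hj he]
  · exact fun hv => ⟨j, ⟨hj, hv⟩, rfl⟩

theorem pick_eq {cm : ℕ → ℕ} {v : ℕ} {S : Finset ℕ} (hS : S ⊆ initial a n)
    (hiff : ∀ j < n, cm j = v ↔ a j ∈ S) : pick a n cm v = S := by
  ext x
  constructor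
  · intro hx
    obtain ⟨j, hj, rfl⟩ := Finset.mem_image.1 hx
    obtain ⟨h1, h2⟩ := Finset.mem_filter.1 hj
    exact (hiff j (Finset.mem_range.1 h1)).1 h2
  · intro hx
    obtain ⟨j, hj, rfl⟩ := Finset.mem_image.1 (hS hx)
    exact (mem_pick h (Finset.mem_range.1 hj)).2 ((hiff j (Finset.mem_range.1 hj)).2 hx)

variable {i s₀ : ℕ} (hp : PrefixSetting a n p q i s₀)
include hp

theorem picks_of_collide {v y : ℕ} (hv : v < 2 ^ (i + 1 - s₀)) (hy : y < 2 ^ (i + 1 - s₀))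
    {cm : ℕ → ℕ} (hcm : CandidateMarks a n s₀ v y 0 0 0 cm) :
    picks a n cm = (elems a s₀ v \ elems a s₀ y, elems a s₀ y \ elems a s₀ v) := by
  obtain ⟨k, hk⟩ := hcm.small
  have hk0 : k = 0 := by rcases hk.not_before with h1 | h1 <;> omega
  have key : ∀ j < n, cm j = if s₀ ≤ j then
      markOf 0 (v.testBit (j - s₀)) (y.testBit (j - s₀)) else 0 := by
    intro j hj
    split_ifs with hs
    · exact hcm.large j hs hj
    · rw [hk.eq j (not_le.1 hs), hk0]; simp
  refine Prod.ext (pick_eq h (Finset.sdiff_subset.trans (elems_subset_initial h hp hv)) ?_)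
    (pick_eq h (Finset.sdiff_subset.trans (elems_subset_initial h hp hy)) ?_) <;>
  · intro j hj
    rw [key j hj, Finset.mem_sdiff, mem_elems h hp hv hj, mem_elems h hp hy hj]
    by_cases hs : s₀ ≤ j <;> cases v.testBit (j - s₀) <;> cases y.testBit (j - s₀) <;>
      simp [hs, markOf]

theorem picks_of_subset {v y r tg : ℕ} (hy : y < 2 ^ (i + 1 - s₀)) (hsub : bits v ⊆ bits y)
    {cm : ℕ → ℕ} (hcm : CandidateMarks a n s₀ v y 1 r tg cm) :
    ∃ k, SmallMarks a r tg s₀ cm k ∧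
      picks a n cm = (elems a s₀ v ∪ initial a k, elems a s₀ y \ elems a s₀ v) := by
  have hv := lt_of_bits_subset hsub hy
  have hlt := hp.lt
  have hle := hp.le
  obtain ⟨k, hk⟩ := hcm.small
  have hks := hk.le
  have key : ∀ j < n, cm j = if s₀ ≤ j then
      markOf 1 (v.testBit (j - s₀)) (y.testBit (j - s₀)) else if j < k then 1 else 0 := by
    intro j hj
    split_ifs with hs hjk
    · exact hcm.large j hs hj
    · rw [hk.eq j (not_le.1 hs)]; simp [hjk]
    · rw [hk.eq j (not_le.1 hs)]; simp [hjk]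
  refine ⟨k, hk, Prod.ext (pick_eq h (Finset.union_subset (elems_subset_initial h hp hv)
    (Finset.image_subset_image (Finset.range_subset_range.2 (by omega)))) ?_)
    (pick_eq h (Finset.sdiff_subset.trans (elems_subset_initial h hp hy)) ?_)⟩
  · intro j hj
    rw [key j hj, Finset.mem_union, mem_elems h hp hv hj, mem_initial h (by omega) hj]
    by_cases hs : s₀ ≤ j
    · have : ¬ j < k := by omega
      cases v.testBit (j - s₀) <;> cases y.testBit (j - s₀) <;> simp [hs, markOf, this]
    · simp [hs]
  · intro j hj
    rw [key j hj, Finset.mem_sdiff, mem_elems h hp hv hj, mem_elems h hp hy hj]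
    have hb : v.testBit (j - s₀) = true → y.testBit (j - s₀) = true := fun hb =>
      mem_bits.1 (hsub (mem_bits.2 hb))
    by_cases hs : s₀ ≤ j
    · revert hb
      cases v.testBit (j - s₀) <;> cases y.testBit (j - s₀) <;> simp [hs, markOf]
    · simp [hs]
      split_ifs <;> simp

theorem isPartition_elems {v y : ℕ} (hy : y < 2 ^ (i + 1 - s₀)) (hsub : bits v ⊆ bits y)
    (hle : 2 * maskSum (fun t => a (s₀ + t)) v ≤ maskSum (fun t => a (s₀ + t)) y)
    (hbest : ∀ P, bits P ⊆ bits y →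
      2 * maskSum (fun t => a (s₀ + t)) P ≤ maskSum (fun t => a (s₀ + t)) y →
      maskSum (fun t => a (s₀ + t)) P ≤ maskSum (fun t => a (s₀ + t)) v) :
    IsPartition (elems a s₀ y) (elems a s₀ v) := by
  have hv := lt_of_bits_subset hsub hy
  refine ⟨(elems_subset_iff h hp hv hy).2 hsub, ?_, fun Z hZ hZle => ?_⟩
  · rwa [total_elems h hp hv, total_elems h hp hy]
  · obtain ⟨w, hw, rfl⟩ := exists_elems_eq h hp (hZ.trans (elems_subset_large h hp hy))
    rw [total_elems h hp hw, total_elems h hp hy] at hZle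
    rw [total_elems h hp hw, total_elems h hp hv]
    exact hbest w ((elems_subset_iff h hp hw hy).1 hZ) hZle

theorem total_elems_sdiff {v y : ℕ} (hy : y < 2 ^ (i + 1 - s₀)) (hsub : bits v ⊆ bits y) :
    total (elems a s₀ y \ elems a s₀ v) =
      maskSum (fun t => a (s₀ + t)) y - maskSum (fun t => a (s₀ + t)) v := by
  have hv := lt_of_bits_subset hsub hy
  have := total_sdiff ((elems_subset_iff h hp hv hy).2 hsub)
  rw [total_elems h hp hv, total_elems h hp hy] at this
  omega

theorem total_elems_union {v k : ℕ} (hv : v < 2 ^ (i + 1 - s₀)) (hk : k ≤ s₀) :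
    total (elems a s₀ v ∪ initial a k) =
      maskSum (fun t => a (s₀ + t)) v + ∑ j ∈ Finset.range k, a j := by
  have hlt := hp.lt
  have hle := hp.le
  have hd : Disjoint (elems a s₀ v) (initial a k) := by
    refine Disjoint.mono (elems_subset_large h hp hv) ?_ (disjoint_large_small (ε := (p : ℝ) / q))
    rw [small_initial h hp]
    exact Finset.image_subset_image (Finset.range_subset_range.2 hk)
  rw [total_union hd, total_elems h hp hv, total_initial h (by omega)]

/-- Before the last added element P was still below Q, and that element is less than εm, which
bounds the overshoot. If the small elements do not suffice, the target is never reached, so all of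
them have been added. -/
theorem addSmall_elems {v y k : ℕ} (hy : y < 2 ^ (i + 1 - s₀)) (hsub : bits v ⊆ bits y)
    (hle : 2 * maskSum (fun t => a (s₀ + t)) v ≤ maskSum (fun t => a (s₀ + t)) y) {cm : ℕ → ℕ}
    (hk : SmallMarks a (maskSum (fun t => a (s₀ + t)) v)
      (maskSum (fun t => a (s₀ + t)) y - maskSum (fun t => a (s₀ + t)) v) s₀ cm k) :
    AddSmall (initial a (i + 1)) ((p : ℝ) / q) (elems a s₀ v) (elems a s₀ y \ elems a s₀ v)
      (elems a s₀ v ∪ initial a k) := by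
  have hv := lt_of_bits_subset hsub hy
  have hlt := hp.lt
  have hles := hp.le
  have hks := hk.le
  have hqpos : 0 < q := h.p_pos.trans h.p_lt
  unfold AddSmall
  rw [small_initial h hp, total_elems_sdiff h hp hy hsub, total_elems h hp hv,
    total_initial h (by omega)]
  split_ifs with hif
  · refine ⟨k, by rw [smallest_initial h (by omega) hks], ?_, ?_⟩
    · rw [total_elems_union h hp hv hks]
      rcases hk.stop_of with h1 | h1
      · rwa [h1]
      · exact h1
    · rw [total_elems_union h hp hv hks, maxElt_initial h hp]
      rcases Nat.eq_zero_or_pos k with rfl | hkpos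
      · have h2 : (maskSum (fun t => a (s₀ + t)) v : ℝ) ≤
            (maskSum (fun t => a (s₀ + t)) y - maskSum (fun t => a (s₀ + t)) v : ℕ) := by
          exact_mod_cast (by omega)
        have h3 : (0 : ℝ) ≤ (p : ℝ) / q * a i := by positivity
        simp
        linarith
      · have h1 := hk.not_before.resolve_left hkpos.ne'
        obtain ⟨k, rfl⟩ : ∃ k', k = k' + 1 := ⟨k - 1, by omega⟩
        rw [Nat.add_sub_cancel] at h1
        rw [Finset.sum_range_succ]
        have h2 := hp.small k (by omega)
        have h3 : (a k : ℝ) ≤ (p : ℝ) / q * a i := by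
          have hq : (0 : ℝ) < q := by exact_mod_cast hqpos
          rw [div_mul_eq_mul_div, le_div_iff₀ hq, mul_comm]
          exact_mod_cast h2.le
        have h4 : ((maskSum (fun t => a (s₀ + t)) v + ∑ j ∈ Finset.range k, a j : ℕ) : ℝ) ≤
          (maskSum (fun t => a (s₀ + t)) y - maskSum (fun t => a (s₀ + t)) v : ℕ) := by
          exact_mod_cast h1.le
        push_cast at h4 ⊢
        linarith
  · rcases hk.stop_of with rfl | h1
    · rfl
    · have : ∑ j ∈ Finset.range k, a j ≤ ∑ j ∈ Finset.range s₀, a j :=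
        Finset.sum_le_sum_of_subset (Finset.range_subset_range.2 hks)
      omega

theorem isCandidate_picks {v y : ℕ} (hy : y < 2 ^ (i + 1 - s₀)) (hsub : bits v ⊆ bits y)
    (hle : 2 * maskSum (fun t => a (s₀ + t)) v ≤ maskSum (fun t => a (s₀ + t)) y)
    (hbest : ∀ P, bits P ⊆ bits y →
      2 * maskSum (fun t => a (s₀ + t)) P ≤ maskSum (fun t => a (s₀ + t)) y →
      maskSum (fun t => a (s₀ + t)) P ≤ maskSum (fun t => a (s₀ + t)) v) {cm : ℕ → ℕ}
    (hcm : CandidateMarks a n s₀ v y 1 (maskSum (fun t => a (s₀ + t)) v)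
      (maskSum (fun t => a (s₀ + t)) y - maskSum (fun t => a (s₀ + t)) v) cm) :
    IsCandidate (initial a (i + 1)) ((p : ℝ) / q) (elems a s₀ y) (picks a n cm) := by
  obtain ⟨k, hk, hpk⟩ := picks_of_subset h hp hy hsub hcm
  -- Partition is solved exactly, which is within any admissible error margin.
  exact ⟨elems a s₀ v, _, (isPartition_elems h hp hy hsub hle hbest).isApproxPartition
    (by positivity), addSmall_elems h hp hy hsub hle hk, hpk⟩

/-- The set encoded by y has positive sum and v takes at most half of it, so the second set keeps a
positive sum. -/
theorem maxSum_picks_pos {v y : ℕ} (hy : y < 2 ^ (i + 1 - s₀)) (hy0 : 0 < y)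
    (hsub : bits v ⊆ bits y)
    (hle : 2 * maskSum (fun t => a (s₀ + t)) v ≤ maskSum (fun t => a (s₀ + t)) y) {r tg : ℕ}
    {cm : ℕ → ℕ} (hcm : CandidateMarks a n s₀ v y 1 r tg cm) : 0 < maxSum (picks a n cm) := by
  obtain ⟨k, hk, hpk⟩ := picks_of_subset h hp hy hsub hcm
  have hne : (bits y).Nonempty := by
    rw [Finset.nonempty_iff_ne_empty]
    intro h0
    exact hy0.ne' (bits_injective (h0.trans bits_zero.symm))
  have hpos : 0 < maskSum (fun t => a (s₀ + t)) y := by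
    refine Finset.sum_pos (fun t ht => ?_) hne
    have := lt_of_mem_bits hy ht
    have := hp.lt
    exact h.pos _ (by omega)
  rw [hpk, maxSum]
  refine lt_max_of_lt_right ?_
  rw [total_elems_sdiff h hp hy hsub]
  omega

theorem zero_notMem_initial : 0 ∉ initial a (i + 1) := by
  intro h0
  obtain ⟨j, hj, hj0⟩ := Finset.mem_image.1 h0
  have := hp.lt
  exact (h.pos j (by have := Finset.mem_range.1 hj; omega)).ne' hj0

theorem collide_elems {v y : ℕ} (hv : v < 2 ^ (i + 1 - s₀)) (hy : y < 2 ^ (i + 1 - s₀))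
    (hvy : v ≠ y) (hbin : binOf p q (a i) (maskSum (fun t => a (s₀ + t)) v) =
      binOf p q (a i) (maskSum (fun t => a (s₀ + t)) y)) :
    Collide (initial a (i + 1)) ((p : ℝ) / q) (elems a s₀ v) (elems a s₀ y) := by
  refine ⟨elems_subset_large h hp hv, elems_subset_large h hp hy, fun he => hvy ?_, ?_⟩
  · exact bits_injective (((elems_subset_iff h hp hv hy).1 he.subset).antisymm
      ((elems_subset_iff h hp hy hv).1 he.symm.subset))
  · rw [bin_elems h hp hv, bin_elems h hp hy, hbin]

theorem not_collide_of_injective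
    (hinj : ∀ v < 2 ^ (i + 1 - s₀), ∀ w < 2 ^ (i + 1 - s₀),
      binOf p q (a i) (maskSum (fun k => a (s₀ + k)) v) =
        binOf p q (a i) (maskSum (fun k => a (s₀ + k)) w) → v = w) (X Y : Finset ℕ) :
    ¬ Collide (initial a (i + 1)) ((p : ℝ) / q) X Y := by
  rintro ⟨hX, hY, hne, hb⟩
  obtain ⟨v, hv, rfl⟩ := exists_elems_eq h hp hX
  obtain ⟨w, hw, rfl⟩ := exists_elems_eq h hp hY
  rw [bin_elems h hp hv, bin_elems h hp hw] at hb
  exact hne (by rw [hinj v hv w hw hb])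

end candidates

theorem HasList.of_eq {b : ℕ → ℕ} {l f : ℕ} {s t : Store} (hl : HasList b l s f)
    (h1 : t.arr .list = s.arr .list) (h2 : t.arr .num = s.arr .num) : HasList b l t f := by
  unfold HasList row
  rw [h1, h2]
  exact hl

section verification
variable {a : ℕ → ℕ} {n p q U V : ℕ} (h : Setting a n p q U V)
include h
variable {i s₀ : ℕ} (hp : PrefixSetting a n p q i s₀)
include hp

theorem wp_partitionsCmd {s : Store} (hs : HasInput a n p q s) {G : Set (Finset ℕ × Finset ℕ)}
    (hb : Best a n G s) {l : ℕ} (hl : l = i + 1 - s₀) (hss : s.var .s = s₀) (hsl : s.var .l = l)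
    (hcnt : s.var .cnt = 2 ^ l)
    (hsum : ∀ v < 2 ^ l, s.arr .sum v = maskSum (fun k => a (s₀ + k)) v) (hlU : 2 ^ l ≤ U) :
    wp V partitionsCmd s fun t => ∃ F : Set (Finset ℕ × Finset ℕ),
      (∀ X, IsLargeSubset (initial a (i + 1)) ((p : ℝ) / q) X →
        ∃ S ∈ F, IsCandidate (initial a (i + 1)) ((p : ℝ) / q) X S) ∧
      (∀ S ∈ F, ∃ X, IsLargeSubset (initial a (i + 1)) ((p : ℝ) / q) X ∧
        IsCandidate (initial a (i + 1)) ((p : ℝ) / q) X S) ∧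
      Best a n (F ∪ G) t ∧ t.clk ≤ s.clk + 1500 * (n * 2 ^ l +
        (2 ^ (l - l / 2) * 3 ^ (l / 2) + 2 ^ (l / 2) * 3 ^ (l - l / 2))) := by
  obtain ⟨hV, hV'⟩ := h.lt_V
  have hn := h.n_add_two_le
  have hn2 := h.two_le
  have hV0 : 0 < V := by omega
  have hV1 : 1 < V := by omega
  have hlt := hp.lt
  have hle := hp.le
  set b : ℕ → ℕ := fun k => a (s₀ + k) with hbdef
  have hsU : ∀ v < 2 ^ l, maskSum b v ≤ U := fun v hv => maskSum_le_U h hp (hl ▸ hv)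
  have hl1 : 2 ^ l = 2 ^ (l - 1) + 2 ^ (l - 1) := by
    rw [← two_mul, ← pow_succ']; congr 1; omega
  have hl1' : 1 ≤ 2 ^ (l - 1) := Nat.one_le_two_pow
  have hll : l < 2 ^ l := Nat.lt_two_pow_self
  have hgl : 2 ^ (l / 2) ≤ 2 ^ (l - 1) := Nat.pow_le_pow_right (by norm_num) (by omega)
  unfold partitionsCmd
  simp only [wp_seq, wp_assign]
  refine ⟨by simp [hV1], by simp [hV0], ?_⟩
  refine wp.mono (wp.frame (wp_loop (fun t => t.var .t ≤ l / 2 ∧ t.var .g = 2 ^ t.var .t ∧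
    t.clk ≤ s.clk + 30 * t.var .t + 10) (fun t => l / 2 - t.var .t) (Q := fun t =>
    t.var .g = 2 ^ (l / 2) ∧ t.clk ≤ s.clk + 30 * (l / 2) + 20) ?_ ?_)) ?_
  · simp
  · rintro t hf ⟨h1, h2, h3⟩
    have e1 : t.var .l = l := by simpa [hsl] using hf.var .l (by decide)
    refine ⟨by simp, by simp; omega, fun hlt => ?_, fun hge => ?_⟩
    · simp [e1] at hlt
      have h4 : 2 ^ t.var .t ≤ 2 ^ (l / 2) := Nat.pow_le_pow_right (by norm_num) h1
      have h5 : 2 ^ (t.var .t + 1) = 2 ^ t.var .t + 2 ^ t.var .t := by ring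
      simp [wp_seq, wp_assign, h2, h5]
      refine ⟨by omega, by omega, fun _ => ⟨⟨by omega, by omega⟩, by omega⟩⟩
    · simp [e1] at hge
      have : t.var .t = l / 2 := by omega
      rw [this] at h2 h3
      simp [h2]
      omega
  rintro t₁ ⟨hf₁, hg₁, hclk₁⟩
  have hin₁ : HasInput a n p q t₁ := HasInput.frame (by simp [hs]) hf₁
    (by decide) (by decide) (by decide)
  have hbest₁ : Best a n G t₁ := hb.congr (by simpa using hf₁.var .bn (by decide))
    (by simpa using hf₁.var .bd (by decide)) (hf₁.arr _ (by decide))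
  have hcnt₁ : t₁.var .cnt = 2 ^ l := by simpa [hcnt] using hf₁.var .cnt (by decide)
  have hss₁ : t₁.var .s = s₀ := by simpa [hss] using hf₁.var .s (by decide)
  have hsum₁ : t₁.arr .sum = s.arr .sum := hf₁.arr _ (by decide)
  simp only [wp_put]
  refine ⟨by simp, by simp [hV0], by simp [hV0], by simp, by simp [hV0], by simp [hV1], by simp,
    by simp [hV1], by simp, ?_⟩
  refine wp.mono (wp.frame (wp_buildCmd h (b := b) (l := l) (g := 0) (k := l / 2)
    ⟨by simpa [hsum₁] using hsum, hsU, hlU, by simp [hcnt₁]⟩ (by omega) (by simp) (by simp [hg₁])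
    (sortedSubmasks_zero _ (by simp [row])))) ?_
  rintro t₂ ⟨hf₂, hlow₂, -, hclk₂⟩
  simp only [pow_zero, one_mul] at hlow₂
  have hin₂ : HasInput a n p q t₂ := HasInput.frame (by simp [hin₁]) hf₂
    (by decide) (by decide) (by decide)
  have hbest₂ : Best a n G t₂ := hbest₁.congr (by simpa using hf₂.var .bn (by decide))
    (by simpa using hf₂.var .bd (by decide)) (hf₂.arr _ (by decide))
  have hcnt₂ : t₂.var .cnt = 2 ^ l := by simpa [hcnt₁] using hf₂.var .cnt (by decide)
  have hss₂ : t₂.var .s = s₀ := by simpa [hss₁] using hf₂.var .s (by decide)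
  have hg₂ : t₂.var .g = 2 ^ (l / 2) := by simpa [hg₁] using hf₂.var .g (by decide)
  have hH₂ : t₂.var .H = 2 ^ l := by simpa [hcnt₁] using hf₂.var .H (by decide)
  have hsum₂ : t₂.arr .sum = s.arr .sum := by simpa [hsum₁] using hf₂.arr .sum (by decide)
  refine ⟨by simp, by simp, ?_⟩
  refine wp.mono (wp.frame (wp_buildCmd h (b := b) (l := l) (g := l / 2) (k := l - l / 2)
    ⟨by simpa [hsum₂] using hsum, hsU, hlU, by simp [hH₂]⟩ (by omega) (by simp [hg₂])
    (by simp [hcnt₂, show l / 2 + (l - l / 2) = l by omega])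
    (hlow₂ 0 (Nat.two_pow_pos _)))) ?_
  rintro t₃ ⟨hf₃, hhigh₃, hlow₃, hclk₃⟩
  replace hlow₃ : ∀ f < 2 ^ (l / 2), HasList b l t₃ f := fun f hf => hlow₃ f hf (hlow₂ f hf)
  have hin₃ : HasInput a n p q t₃ := HasInput.frame (by simp [hin₂]) hf₃
    (by decide) (by decide) (by decide)
  have hbest₃ : Best a n G t₃ := hbest₂.congr (by simpa using hf₃.var .bn (by decide))
    (by simpa using hf₃.var .bd (by decide)) (hf₃.arr _ (by decide))
  have hcnt₃ : t₃.var .cnt = 2 ^ l := by simpa [hcnt₂] using hf₃.var .cnt (by decide)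
  have hss₃ : t₃.var .s = s₀ := by simpa [hss₂] using hf₃.var .s (by decide)
  have hg₃ : t₃.var .g = 2 ^ (l / 2) := by simpa [hg₂] using hf₃.var .g (by decide)
  have hH₃ : t₃.var .H = 2 ^ l := by simpa [hH₂] using hf₃.var .H (by decide)
  have hsum₃ : t₃.arr .sum = s.arr .sum := by simpa [hsum₂] using hf₃.arr .sum (by decide)
  have hsplit := sum_subcount_split (l / 2) (l - l / 2)
  rw [show l / 2 + (l - l / 2) = l by omega] at hsplit
  have hclk : t₃.clk ≤ s.clk + 30 * (l / 2) + 100 + 400 * 3 ^ (l / 2) + 400 * 3 ^ (l - l / 2) := by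
    simp at hclk₂ hclk₃
    omega
  clear hclk₁ hclk₂ hclk₃
  have hhalf : 2 ^ l / 2 = 2 ^ (l - 1) := by omega
  refine ⟨by simp; omega, ?_⟩
  -- The search costs are bounded by a sum over all masks below x, including those without the top
  -- bit, which are never searched. The slack is harmless, and the complete sum is the one that
  -- `sum_subcount_split` evaluates.
  refine wp_loop (fun t => 2 ^ (l - 1) ≤ t.var .x ∧ t.var .x ≤ 2 ^ l ∧
    (∃ F : Set (Finset ℕ × Finset ℕ),
      (∀ y, 2 ^ (l - 1) ≤ y → y < t.var .x →
        ∃ S ∈ F, IsCandidate (initial a (i + 1)) ((p : ℝ) / q) (elems a s₀ y) S) ∧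
      (∀ S ∈ F, ∃ y, 2 ^ (l - 1) ≤ y ∧ y < 2 ^ l ∧
        IsCandidate (initial a (i + 1)) ((p : ℝ) / q) (elems a s₀ y) S) ∧
      Best a n (F ∪ G) t) ∧
    t.clk ≤ t₃.clk + 20 + (300 * (n + 1) + 80) * (t.var .x - 2 ^ (l - 1)) +
      250 * ∑ y ∈ Finset.range (t.var .x),
        (subcount (y % 2 ^ (l / 2)) + subcount (2 ^ (l / 2) * (y / 2 ^ (l / 2)))))
    (fun t => 2 ^ l - t.var .x) ?_ ?_
  · simp [hcnt₃, hhalf]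
    refine ⟨by omega, ⟨∅, fun y h1 h2 => absurd h1 (by omega), by simp, ?_⟩, by omega⟩
    rw [Set.empty_union]
    exact hbest₃.congr (by simp) (by simp) rfl
  rintro t hf ⟨h1, h2, ⟨F, hF1, hF2, hF3⟩, h3⟩
  have hin : HasInput a n p q t := HasInput.frame (by simp [hin₃]) hf
    (by decide) (by decide) (by decide)
  have e1 : t.var .cnt = 2 ^ l := by simpa [hcnt₃] using hf.var .cnt (by decide)
  have e2 : t.var .s = s₀ := by simpa [hss₃] using hf.var .s (by decide)
  have e3 : t.var .g = 2 ^ (l / 2) := by simpa [hg₃] using hf.var .g (by decide)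
  have e4 : t.var .H = 2 ^ l := by simpa [hH₃] using hf.var .H (by decide)
  have e5 : t.arr .sum = s.arr .sum := by simpa [hsum₃] using hf.arr .sum (by decide)
  have e6 : t.arr .list = t₃.arr .list := by simpa using hf.arr .list (by decide)
  have e7 : t.arr .num = t₃.arr .num := by simpa using hf.arr .num (by decide)
  refine ⟨by simp, by simp, fun hlt => ?_, fun hge => ?_⟩
  · simp [e1] at hlt
    have hx := Finset.sum_range_succ (fun y => subcount (y % 2 ^ (l / 2)) +
      subcount (2 ^ (l / 2) * (y / 2 ^ (l / 2)))) (t.var .x)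
    obtain ⟨x, hxdef⟩ : ∃ x, t.var .x = x := ⟨_, rfl⟩
    rw [hxdef] at h1 h2 h3 hF1 hlt hx
    simp only [wp_seq, wp_assign]
    refine wp.mono (wp.frame (wp_searchCmd h (b := b) (l := l) (k := l / 2) (x := x)
      ⟨by simpa [e5] using hsum, hsU, hlU, by simp [e4]⟩ (by omega) hlt (by simp [hxdef])
      (by simp [e3]) (fun f hf => (hlow₃ f hf).of_eq e6 e7)
      (fun d hd => (hhigh₃ d hd).of_eq e6 e7))) ?_
    rintro u ⟨hfu, hu1, hu2, hu3, hu4⟩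
    have hinu : HasInput a n p q u := HasInput.frame (by simp [hin]) hfu
      (by decide) (by decide) (by decide)
    have f1 : u.var .x = x := by simpa [hxdef] using hfu.var .x (by decide)
    have f2 : u.var .s = s₀ := by simpa [e2] using hfu.var .s (by decide)
    have f3 : u.arr .sum = s.arr .sum := by simpa [e5] using hfu.arr .sum (by decide)
    have hbu : Best a n (F ∪ G) u := hF3.congr (by simpa using hfu.var .bn (by decide))
      (by simpa using hfu.var .bd (by decide)) (hfu.arr _ (by decide))
    generalize hbm : u.var .bm = v at hu1 hu2 hu3
    have hvl := lt_of_bits_subset hu1 hlt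
    have g1 := hsum _ hvl
    have g2 := hsum _ hlt
    have g3 := hsU _ hvl
    have g4 := hsU _ hlt
    refine ⟨by simp, by simp, by simp [hV1], by simp, by simp, ?_⟩
    refine wp.mono (wp.frame (wp_candidateCmd h (by simp [hinu]) (hbu.congr (by simp) (by simp) (by simp))
      (s₀ := s₀) (v := v) (y := x) (z := 1) (r := maskSum b v) (tg := maskSum b x - maskSum b v)
      (by simp [f2]) (by simp [hbm]) (by simp [f1]) (by simp) (by simp [hbm, f3, g1])
      (by simp [hbm, f1, f3, g1, g2]) (by omega) (by omega) (by omega) le_rfl (by omega)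
      (fun cm hcm => maxSum_picks_pos h hp (hl ▸ hlt) (by omega) hu1 hu2 hcm))) ?_
    rintro w ⟨hfw, cm, hcm, hbw, hclkw⟩
    have k1 : w.var .x = x := by simpa [f1] using hfw.var .x (by decide)
    have hcand := isCandidate_picks h hp (hl ▸ hlt) hu1 hu2 hu3 hcm
    refine ⟨by simp [k1]; omega, fun _ => ⟨⟨by simp [k1]; omega, by simp [k1]; omega,
      ⟨insert (picks a n cm) F, ?_, ?_, ?_⟩, ?_⟩, by simp [k1, hxdef]; omega⟩⟩
    · intro y hy1 hy2
      simp [k1] at hy2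
      rcases hy2.lt_or_eq with hy2 | rfl
      · obtain ⟨S, hS, hS'⟩ := hF1 y hy1 hy2
        exact ⟨S, Set.mem_insert_of_mem _ hS, hS'⟩
      · exact ⟨_, Set.mem_insert _ _, hcand⟩
    · rintro S (rfl | hS)
      · exact ⟨x, h1, hlt, hcand⟩
      · exact hF2 S hS
    · rw [Set.insert_union]
      exact hbw.congr (by simp) (by simp) rfl
    · simp [k1, hx]
      simp at hu4 hclkw
      have : x + 1 - 2 ^ (l - 1) = x - 2 ^ (l - 1) + 1 := by omega
      rw [this, mul_add]
      omega
  · simp [e1] at hge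
    have hx : t.var .x = 2 ^ l := by omega
    rw [hx] at h3 hF1
    refine ⟨F, fun X hX => ?_, fun S hS => ?_, hF3.congr (by simp) (by simp) rfl, ?_⟩
    · obtain ⟨v, hv, rfl⟩ := exists_elems_eq h hp hX.1
      have h4 := (isLargeSubset_elems h hp hv).1 hX
      rw [← hl] at hv
      exact hF1 v (by rwa [hl, show i + 1 - s₀ - 1 = i - s₀ by omega]) hv
    · obtain ⟨y, hy1, hy2, hy3⟩ := hF2 S hS
      refine ⟨_, (isLargeSubset_elems h hp (hl ▸ hy2)).2 ?_, hy3⟩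
      rwa [hl, show i + 1 - s₀ - 1 = i - s₀ by omega] at hy1
    · rw [hsplit] at h3
      have h5 : 3 ^ (l / 2) ≤ 2 ^ (l - l / 2) * 3 ^ (l / 2) :=
        Nat.le_mul_of_pos_left _ (Nat.two_pow_pos _)
      have h6 : 3 ^ (l - l / 2) ≤ 2 ^ (l / 2) * 3 ^ (l - l / 2) :=
        Nat.le_mul_of_pos_left _ (Nat.two_pow_pos _)
      have h7 : 2 ^ l - 2 ^ (l - 1) = 2 ^ (l - 1) := by omega
      have h8 : (300 * (n + 1) + 80) * 2 ^ (l - 1) ≤ (300 * (n + 1) + 80) * 2 ^ l :=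
        Nat.mul_le_mul_left _ (by omega)
      have h9 : 2 * 2 ^ l ≤ n * 2 ^ l := Nat.mul_le_mul_right _ hn2
      rw [h7] at h3
      simp
      ring_nf at h3 h8 h9 ⊢
      omega

end verification

end SubsetSumRatio

/-! ### One prefix, and the whole program -/

namespace SubsetSumRatio

section verification
variable {a : ℕ → ℕ} {n p q U V : ℕ} (h : Setting a n p q U V)
include h

/-- D is any common bound for the cost of a prefix. `hD` covers the enumeration and a collision;
`hD'` covers the Partition case, but only for those l that the pigeonhole principle permits when no
collision occurs. -/
theorem wp_prefixCmd {s : Store} (hs : HasInput a n p q s) {G : Set (Finset ℕ × Finset ℕ)}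
    (hb : Best a n G s) {i : ℕ} (hi : i < n) (hsi : s.var .i = i) {D : ℕ}
    (hD : n + n * (q * q) / (p * p) ≤ D)
    (hD' : ∀ l, 1 ≤ l → l ≤ n → 2 ^ l ≤ l * (q * q) / (p * p) + 1 →
      n * 2 ^ l + (2 ^ (l - l / 2) * 3 ^ (l / 2) + 2 ^ (l / 2) * 3 ^ (l - l / 2)) ≤ D) :
    wp V prefixCmd s fun t => ∃ F, CandidateFamily (initial a (i + 1)) ((p : ℝ) / q) F ∧
      Best a n (F ∪ G) t ∧ t.clk ≤ s.clk + 4000 * D := by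
  obtain ⟨hV, hV'⟩ := h.lt_V
  have hn := h.n_add_two_le
  have hn2 := h.two_le
  have hV0 : 0 < V := by omega
  have hV1 : 1 < V := by omega
  have hq := h.q_le
  have hpq := h.p_lt
  unfold prefixCmd
  simp only [wp_seq, wp_assign]
  refine ⟨by simp [hsi, hi, hs.len], by simp [hV0], ?_⟩
  refine wp.mono (wp.frame (wp_loop (fun t => t.var .s ≤ i ∧
    (∀ j < t.var .s, q * a j < p * a i) ∧ t.clk ≤ s.clk + 40 * t.var .s + 20)
    (fun t => n - t.var .s) (Q := fun t => PrefixSetting a n p q i (t.var .s) ∧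
    t.clk ≤ s.clk + 40 * n + 60) ?_ ?_)) ?_
  · simp
  · rintro t hf ⟨h1, h2, h3⟩
    have hin : HasInput a n p q t := HasInput.frame (by simp [hs]) hf
      (by decide) (by decide) (by decide)
    have htm : t.var .m = a i := by simpa [hsi, hs.inp i hi] using hf.var .m (by decide)
    have hsn : t.var .s < n := by omega
    have m1 := h.mul_lt hq (h.le_U hsn)
    have m2 := h.mul_lt (hpq.le.trans hq) (h.le_U hi)
    refine ⟨by simp [hin.len, hin.q, hin.inp _ hsn, hsn]; omega, by simp [hin.p, htm]; omega,
      fun hlt => ?_, fun hge => ?_⟩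
    · simp [hin.q, hin.p, htm, hin.inp _ hsn] at hlt
      -- The scan for the first large element stops at i at the latest, since p < q makes `a i`
      -- itself large.
      have hne : t.var .s ≠ i := by
        intro he
        rw [he] at hlt
        exact absurd hlt (not_lt.2 (Nat.mul_le_mul_right _ hpq.le))
      simp [wp_assign]
      refine ⟨by omega, fun _ => ⟨⟨by omega, fun j hj => ?_, by omega⟩, by omega⟩⟩
      rcases hj.lt_or_eq with hj | rfl
      · exact h2 j hj
      · exact hlt
    · simp [hin.q, hin.p, htm, hin.inp _ hsn] at hge
      exact ⟨⟨hi, h1, h2, hge⟩, by simp; omega⟩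
  rintro t₁ ⟨hf₁, hp, hclk₁⟩
  have hle := hp.le
  obtain ⟨s₀, hs₀⟩ : ∃ s₀, t₁.var .s = s₀ := ⟨_, rfl⟩
  rw [hs₀] at hp hle
  have hin₁ : HasInput a n p q t₁ := HasInput.frame (by simp [hs]) hf₁
    (by decide) (by decide) (by decide)
  have hbest₁ : Best a n G t₁ := hb.congr (by simpa using hf₁.var .bn (by decide))
    (by simpa using hf₁.var .bd (by decide)) (hf₁.arr _ (by decide))
  have hi₁ : t₁.var .i = i := by simpa [hsi] using hf₁.var .i (by decide)
  have hm₁ : t₁.var .m = a i := by simpa [hsi, hs.inp i hi] using hf₁.var .m (by decide)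
  refine ⟨by simp [hi₁, hV1]; omega, ?_⟩
  refine wp.mono (wp.frame (wp_enumerateCmd h hp (by simp [hin₁]) (by simp [hm₁]) (by simp [hs₀])
    (by simp [hi₁, hs₀]))) ?_
  rintro t₂ ⟨hf₂, henum, hclk₂⟩
  have hin₂ : HasInput a n p q t₂ := HasInput.frame (by simp [hin₁]) hf₂
    (by decide) (by decide) (by decide)
  have hbest₂ : Best a n G t₂ := hbest₁.congr (by simpa using hf₂.var .bn (by decide))
    (by simpa using hf₂.var .bd (by decide)) (hf₂.arr _ (by decide))
  have hs₂ : t₂.var .s = s₀ := by simpa [hs₀] using hf₂.var .s (by decide)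
  have hl₂ : t₂.var .l = i + 1 - s₀ := by simpa [hi₁, hs₀] using hf₂.var .l (by decide)
  have hcb := count_bound_lt h hp
  have hcnt := henum.cnt_le
  have hlD : (i + 1 - s₀) * (q * q) / (p * p) ≤ n * (q * q) / (p * p) :=
    Nat.div_le_div_right (Nat.mul_le_mul_right _ (by omega))
  have hclk : t₂.clk ≤ s.clk + 40 * n + 700 + 300 * (n * (q * q) / (p * p)) := by
    simp at hclk₂
    omega
  rw [wp_ite]
  refine ⟨by simp, by simp [hV1], fun hlt => ?_, fun hge => ?_⟩
  · simp at hlt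
    rcases henum.result with ⟨-, hv, hc, hbin⟩ | ⟨he, -⟩
    swap
    · omega
    have hcol := collide_elems h hp (hv.trans hc) hc hv.ne hbin
    have hε : (0 : ℝ) < (p : ℝ) / q := by
      have := h.p_pos
      have hq : 0 < q := by omega
      positivity
    have hε1 : (p : ℝ) / q < 1 := by
      rw [div_lt_one (by exact_mod_cast (by omega : 0 < q))]
      exact_mod_cast hpq
    have hpos : ∀ cm, CandidateMarks a n s₀ (t₂.var .v) (t₂.var .cnt) 0 0 0 cm →
        0 < maxSum (picks a n cm) := by
      intro cm hcm
      rw [picks_of_collide h hp (hv.trans hc) hc hcm]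
      exact lt_max_of_lt_right ((ConstrainedSSR.collision _ _ hcol).subset
        (zero_notMem_initial h hp) (initial_nonempty a i) hε hε1).2.2.2
    simp only [wp_seq, wp_assign]
    refine ⟨by simp, by simp [hV0], by simp [hV0], by simp [hV0], ?_⟩
    refine wp.mono (wp_candidateCmd h (by simp [hin₂]) (hbest₂.congr (by simp) (by simp) (by simp))
      (s₀ := s₀) (v := t₂.var .v) (y := t₂.var .cnt) (z := 0) (r := 0) (tg := 0)
      (by simp [hs₂]) (by simp) (by simp) (by simp) (by simp) (by simp) (by omega) (by omega)
      (by omega) (by omega) (by omega) hpos) ?_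
    rintro u ⟨cm, hcm, hbu, hcu⟩
    refine ⟨_, candidateFamily_of_collide hcol, ?_, ?_⟩
    · rw [← picks_of_collide h hp (hv.trans hc) hc hcm]
      exact hbu
    · simp at hcu
      omega
  · simp at hge
    rcases henum.result with ⟨he, -⟩ | ⟨-, hc, hinj⟩
    · omega
    rw [hc] at hcnt hinj
    refine wp.mono (wp_partitionsCmd h hp (s := t₂.tick _) (by simp [hin₂])
      (hbest₂.congr (by simp) (by simp) (by simp)) rfl (by simp [hs₂]) (by simp [hl₂])
      (by simp [hc]) (by simpa [hc] using henum.sum) (by omega)) ?_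
    rintro u ⟨F, hF1, hF2, hbu, hcu⟩
    refine ⟨F, candidateFamily_of_forall_not_collide (initial_nonempty a i) ?_
      (not_collide_of_injective h hp hinj) hF1 hF2, hbu, ?_⟩
    · rw [div_le_one (by exact_mod_cast (by omega : 0 < q))]
      exact_mod_cast hpq.le
    · have := hD' (i + 1 - s₀) (by omega) (by omega) hcnt
      simp at hcu
      omega

theorem wp_mainCmd {s : Store} (hs : HasInput a n p q s) (hbn : s.var .bn = 0)
    (hbd : s.var .bd = 0) {D : ℕ} (hD : n + n * (q * q) / (p * p) ≤ D)
    (hD' : ∀ l, 1 ≤ l → l ≤ n → 2 ^ l ≤ l * (q * q) / (p * p) + 1 →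
      n * 2 ^ l + (2 ^ (l - l / 2) * 3 ^ (l / 2) + 2 ^ (l / 2) * 3 ^ (l - l / 2)) ≤ D) :
    wp V mainCmd s fun t => ∃ (F : ℕ → Set (Finset ℕ × Finset ℕ)),
      (∀ i < n, CandidateFamily (initial a (i + 1)) ((p : ℝ) / q) (F i)) ∧
      (∃ i < n, picks a n (t.arr .inp) ∈ F i) ∧
      (∀ i < n, ∀ T ∈ F i, ratio (picks a n (t.arr .inp)) ≤ ratio T) ∧
      t.clk ≤ s.clk + 5000 * (n * D) := by
  obtain ⟨hV, hV'⟩ := h.lt_V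
  have hn := h.n_add_two_le
  have hn2 := h.two_le
  have hV0 : 0 < V := by omega
  have hnD : n * 2 ≤ n * D := Nat.mul_le_mul_left _
    (hn2.trans ((Nat.le_add_right _ _).trans hD))
  unfold mainCmd
  simp only [wp_seq, wp_assign]
  refine ⟨by simp [hV0], ?_⟩
  refine wp.mono (wp.frame (wp_loop (fun t => t.var .i ≤ n ∧
    (∃ F : ℕ → Set (Finset ℕ × Finset ℕ),
      (∀ i < t.var .i, CandidateFamily (initial a (i + 1)) ((p : ℝ) / q) (F i)) ∧
      Best a n {S | ∃ i < t.var .i, S ∈ F i} t) ∧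
    t.clk ≤ s.clk + 10 + (4000 * D + 20) * t.var .i) (fun t => n - t.var .i) (Q := fun t =>
    (∃ F : ℕ → Set (Finset ℕ × Finset ℕ),
      (∀ i < n, CandidateFamily (initial a (i + 1)) ((p : ℝ) / q) (F i)) ∧
      Best a n {S | ∃ i < n, S ∈ F i} t) ∧
    t.clk ≤ s.clk + 20 + (4000 * D + 20) * n) ?_ ?_)) ?_
  · simp
    exact .inl ⟨by simp, by simp [hbn], by simp [hbd]⟩
  · rintro t hf ⟨h1, ⟨F, hF, hbest⟩, h2⟩
    have hin : HasInput a n p q t := HasInput.frame (by simp [hs]) hf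
      (by decide) (by decide) (by decide)
    refine ⟨by simp, by simp, fun hlt => ?_, fun hge => ?_⟩
    · simp [hin.len] at hlt
      rw [wp_seq]
      refine wp.mono (wp.frame (wp_prefixCmd h (by simp [hin]) (hbest.congr (by simp) (by simp)
        (by simp)) hlt (by simp) hD hD')) ?_
      rintro u ⟨hfu, F', hF', hbu, hcu⟩
      have f1 : u.var .i = t.var .i := by simpa using hfu.var .i (by decide)
      simp at hcu
      rw [wp_assign]
      refine ⟨by simp [f1]; omega, fun _ => ⟨⟨by simp [f1]; omega,
        ⟨Function.update F (t.var .i) F', fun j hj => ?_, ?_⟩, ?_⟩, by simp [f1]; omega⟩⟩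
      · simp [f1] at hj
        rcases hj.lt_or_eq with hj | rfl
        · rw [Function.update_of_ne hj.ne]
          exact hF j hj
        · simpa using hF'
      · have he : {S | ∃ j < t.var .i + 1, S ∈ Function.update F (t.var .i) F' j} =
            F' ∪ {S | ∃ j < t.var .i, S ∈ F j} := by
          ext S
          simp only [Set.mem_ofPred_eq, Set.mem_union]
          constructor
          · rintro ⟨j, hj, hS⟩
            rcases (Nat.lt_succ_iff.1 hj).lt_or_eq with hj | rfl
            · rw [Function.update_of_ne hj.ne] at hS
              exact .inr ⟨j, hj, hS⟩
            · exact .inl (by simpa using hS)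
          · rintro (hS | ⟨j, hj, hS⟩)
            · exact ⟨_, Nat.lt_succ_self _, by simpa using hS⟩
            · exact ⟨j, hj.trans (Nat.lt_succ_self _), by rwa [Function.update_of_ne hj.ne]⟩
        simp only [Store.set_var, if_true, Expr.eval_add, Expr.eval_var, Expr.eval_ofNat, f1]
        rw [he]
        exact hbu.congr (by simp) (by simp) (by simp)
      · simp [f1, mul_add]
        omega
    · simp [hin.len] at hge
      have : t.var .i = n := by omega
      rw [this] at hF hbest h2
      exact ⟨⟨F, hF, hbest.congr (by simp) (by simp) (by simp)⟩, by simp; omega⟩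
  rintro t ⟨hf, ⟨F, hF, hbest⟩, hclk⟩
  have hlen : t.len = n := by simpa [hs.len] using hf.len
  refine ⟨by simp [hV0], ?_⟩
  refine wp.mono (wp_loop (fun u => u.var .j ≤ n ∧
    (∀ k < u.var .j, u.arr .inp k = t.arr .bm k) ∧ u.clk ≤ t.clk + 10 + 40 * u.var .j)
    (fun u => n - u.var .j) (Q := fun u => (∀ k < n, u.arr .inp k = t.arr .bm k) ∧
      u.clk ≤ t.clk + 20 + 40 * n) ?_ ?_) ?_
  · simp
  · rintro u hfu ⟨h1, h2, h3⟩
    have hlenu : u.len = n := by simpa [hlen] using hfu.len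
    have hbm : u.arr .bm = t.arr .bm := by simpa using hfu.arr .bm (by decide)
    refine ⟨by simp, by simp, fun hlt => ?_, fun hge => ?_⟩
    · simp [hlenu] at hlt
      simp [wp_seq, wp_put, wp_assign, hlenu, hbm]
      refine ⟨hlt, by omega, fun _ => ⟨⟨by omega, fun k hk => ?_, by omega⟩, by omega⟩⟩
      rcases hk.lt_or_eq with hk | rfl
      · rw [Function.update_of_ne hk.ne, h2 k hk]
      · simp
    · simp [hlenu] at hge
      have : u.var .j = n := by omega
      rw [this] at h2 h3
      exact ⟨h2, by simp; omega⟩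
  rintro u ⟨hu, hclku⟩
  rw [picks_congr hu]
  refine ⟨F, hF, ?_⟩
  -- Some pair has been stored, because the family of the first prefix is nonempty.
  rcases hbest with ⟨h0, -⟩ | ⟨hmem, -, -, -, hmin⟩
  · obtain ⟨S, hS, -⟩ := (hF 0 (by omega)).1
    exact absurd (h0 ▸ (show S ∈ {S | ∃ i < n, S ∈ F i} from ⟨0, by omega, hS⟩)) (by simp)
  · refine ⟨hmem, fun i hi T hT => hmin T ⟨i, hi, hT⟩, ?_⟩
    have : (4000 * D + 20) * n = 4000 * (n * D) + 20 * n := by ring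
    omega

end verification

end SubsetSumRatio

namespace SubsetSumRatio

/-! ### The running time -/

theorem timeBound_inv {N x : ℝ} (hx : 0 < x) : timeBound N x⁻¹ =
    min (N ^ (23 / 10 : ℝ) * x ^ (26 / 10 : ℝ) * Real.logb 2 (N * x ^ 2))
      (min (N ^ 2 * x ^ 3 * Real.logb 2 (N * x ^ 2))
        (N ^ 2 * x ^ 2 * (Real.logb 2 (N * x ^ 2) +
          x ^ (3 / 2 : ℝ) * Real.logb 2 (Real.logb 2 (N * x ^ 2) * x) ^ 2))) := by
  simp only [timeBound, Real.inv_rpow hx.le, inv_pow, div_inv_eq_mul, one_mul]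

section
variable {N x : ℝ} (hN : 2 ≤ N) (hx : 1 ≤ x)
include hN hx

theorem one_le_logb : 1 ≤ Real.logb 2 (N * x ^ 2) := by
  rw [Real.le_logb_iff_rpow_le (by norm_num) (by positivity), Real.rpow_one]
  nlinarith [one_le_pow₀ hx (n := 2)]

/-- N²x² log(Nx²), with x = 1/ε, lies below each of the three terms, since 2 ≤ 2.3 and 2 ≤ 2.6. It
pays for all work outside the Partition searches. -/
theorem mul_logb_le_timeBound : N ^ 2 * x ^ 2 * Real.logb 2 (N * x ^ 2) ≤ timeBound N x⁻¹ := by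
  have hx0 : 0 < x := by linarith
  have hL := one_le_logb hN hx
  have h1 : N ^ 2 ≤ N ^ (23 / 10 : ℝ) := by
    rw [← Real.rpow_natCast]
    exact Real.rpow_le_rpow_of_exponent_le (by linarith) (by norm_num)
  have h2 : x ^ 2 ≤ x ^ (26 / 10 : ℝ) := by
    rw [← Real.rpow_natCast]
    exact Real.rpow_le_rpow_of_exponent_le hx (by norm_num)
  rw [timeBound_inv hx0]
  refine le_min (by gcongr) (le_min (by gcongr; norm_num) ?_)
  gcongr
  exact le_add_of_nonneg_right (by positivity)

/-- The exponents 2.3 and 2.6 leave room for a factor (N + x)^0.05 below exponent 5, and this factor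
absorbs the logarithm. -/
theorem timeBound_le : timeBound N x⁻¹ ≤ 120 * (N + x) ^ (495 / 100 : ℝ) := by
  have hx0 : 0 < x := by linarith
  have hs : 0 < N + x := by linarith
  have hL1 := one_le_logb hN hx
  have hL : Real.logb 2 (N * x ^ 2) ≤ 120 * (N + x) ^ (5 / 100 : ℝ) := by
    have h1 : N * x ^ 2 ≤ (N + x) ^ 3 := by
      have h2 : x ^ 2 ≤ (N + x) ^ 2 := by gcongr; linarith
      calc N * x ^ 2 ≤ (N + x) * (N + x) ^ 2 := by gcongr; linarith
        _ = _ := by ring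
    have h2 : Real.log (N * x ^ 2) ≤ 3 * Real.log (N + x) := by
      calc _ ≤ Real.log ((N + x) ^ 3) := Real.log_le_log (by positivity) h1
        _ = _ := by rw [Real.log_pow]; norm_num
    have h3 := Real.log_le_rpow_div hs.le (show (0 : ℝ) < 5 / 100 by norm_num)
    have h4 := Real.log_two_gt_d9
    have h5 : 0 < (N + x) ^ (5 / 100 : ℝ) := by positivity
    rw [Real.logb, div_le_iff₀ (by linarith)]
    nlinarith
  rw [timeBound_inv hx0]
  refine (min_le_left _ _).trans ?_
  have e : (N + x) ^ (495 / 100 : ℝ) =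
      (N + x) ^ (23 / 10 : ℝ) * (N + x) ^ (26 / 10 : ℝ) * (N + x) ^ (5 / 100 : ℝ) := by
    rw [← Real.rpow_add hs, ← Real.rpow_add hs]
    norm_num
  rw [e]
  calc N ^ (23 / 10 : ℝ) * x ^ (26 / 10 : ℝ) * Real.logb 2 (N * x ^ 2)
      ≤ (N + x) ^ (23 / 10 : ℝ) * (N + x) ^ (26 / 10 : ℝ) * (120 * (N + x) ^ (5 / 100 : ℝ)) := by
        gcongr <;> linarith
    _ = _ := by ring

end

theorem six_pow_le (l : ℕ) : (6 : ℝ) ^ (l / 2) ≤ ((2 : ℝ) ^ l) ^ (13 / 10 : ℝ) := by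
  have h1 : (6 : ℝ) ^ (l / 2) ≤ ((2 : ℝ) ^ (13 / 5 : ℝ)) ^ (l / 2) := by
    refine pow_le_pow_left₀ (by norm_num) ?_ _
    -- Taking fifth powers reduces the claim to 6^5 = 7776 ≤ 8192 = 2^13.
    refine le_of_pow_le_pow_left₀ (n := 5) (by norm_num) (by positivity) ?_
    rw [← Real.rpow_natCast (n := 5), ← Real.rpow_natCast (n := 5), ← Real.rpow_mul (by norm_num)]
    norm_num
  refine h1.trans ?_
  rw [← Real.rpow_natCast, ← Real.rpow_natCast, ← Real.rpow_mul (by norm_num),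
    ← Real.rpow_mul (by norm_num)]
  refine Real.rpow_le_rpow_of_exponent_le (by norm_num) ?_
  have : ((l / 2 : ℕ) : ℝ) ≤ l / 2 := Nat.cast_div_le
  linarith

/-- Combined with 2^l ≤ 2lx², this yields l ≤ 4x², a bound in terms of ε alone. -/
theorem sq_le_two_mul_two_pow (l : ℕ) : l ^ 2 ≤ 2 * 2 ^ l := by
  induction l with
  | zero => simp
  | succ l ih =>
    rcases Nat.lt_or_ge l 3 with h | h
    · interval_cases l <;> norm_num
    · rw [pow_succ 2 l]
      nlinarith

/-- The number of large elements is small if their subset sums are all in different bins. -/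
theorem le_two_mul_logb {N x : ℝ} (hN : 2 ≤ N) (hx : 1 ≤ x) {l : ℕ} (hlN : (l : ℝ) ≤ N)
    (h : (2 : ℝ) ^ l ≤ 2 * l * x ^ 2) : (l : ℝ) ≤ 2 * Real.logb 2 (N * x ^ 2) := by
  have hL := one_le_logb hN hx
  have h1 : (l : ℝ) = Real.logb 2 (2 ^ l) := by
    rw [Real.logb_pow, Real.logb_self_eq_one (by norm_num), mul_one]
  have h2 : (2 : ℝ) ^ l ≤ 2 * (N * x ^ 2) := by
    refine h.trans ?_
    rw [mul_assoc]
    gcongr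
  have h3 := Real.logb_le_logb_of_le (b := 2) (by norm_num) (by positivity) h2
  rw [← h1, Real.logb_mul (by norm_num) (by positivity), Real.logb_self_eq_one (by norm_num)] at h3
  linarith

/-- The left side is O(N·l·l^0.3·x^2.6), and one factor l is replaced by N. The factor l^0.3 is
bounded by N^0.3 for the first term and by 2 log(Nx²) for the second, where also x^0.6 ≤ x. For the
third term it is at most 4x^0.6 by l ≤ 4x², so the powers of x beyond x² amount to x^1.2 ≤ x^1.5. -/
theorem mul_six_pow_le {N x : ℝ} (hN : 2 ≤ N) (hx : 1 ≤ x) {l : ℕ} (hl : 1 ≤ l) (hlN : (l : ℝ) ≤ N)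
    (h : (2 : ℝ) ^ l ≤ 2 * l * x ^ 2) : N * 6 ^ (l / 2) ≤ 12 * timeBound N x⁻¹ := by
  have hx0 : 0 < x := by linarith
  have hl0 : (1 : ℝ) ≤ l := by exact_mod_cast hl
  have hL := one_le_logb hN hx
  have hlL := le_two_mul_logb hN hx hlN h
  have hlx : (l : ℝ) ≤ 4 * x ^ 2 := by
    have h1 : (l : ℝ) ^ 2 ≤ 2 * 2 ^ l := by exact_mod_cast sq_le_two_mul_two_pow l
    have h2 : (l : ℝ) * l ≤ l * (4 * x ^ 2) := by linarith [h, h1, sq (l : ℝ)]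
    exact le_of_mul_le_mul_left h2 (by linarith)
  have h26 : x ^ (26 / 10 : ℝ) = x ^ 2 * x ^ (6 / 10 : ℝ) := by
    rw [← Real.rpow_natCast, ← Real.rpow_add hx0]; norm_num
  have h13 : (l : ℝ) ^ (13 / 10 : ℝ) = l * (l : ℝ) ^ (3 / 10 : ℝ) := by
    conv_rhs => lhs; rw [← Real.rpow_one (l : ℝ)]
    rw [← Real.rpow_add (by linarith)]; norm_num
  have h6 : (6 : ℝ) ^ (l / 2) ≤ 3 * ((l : ℝ) ^ (13 / 10 : ℝ) * x ^ (26 / 10 : ℝ)) := by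
    have h2 : (2 * l * x ^ 2 : ℝ) ^ (13 / 10 : ℝ) =
        (2 : ℝ) ^ (13 / 10 : ℝ) * ((l : ℝ) ^ (13 / 10 : ℝ) * x ^ (26 / 10 : ℝ)) := by
      rw [mul_assoc, Real.mul_rpow (by positivity) (by positivity),
        Real.mul_rpow (by positivity) (by positivity), ← Real.rpow_natCast x,
        ← Real.rpow_mul hx0.le]
      norm_num
    have h3 : (2 : ℝ) ^ (13 / 10 : ℝ) ≤ 3 := by
      refine le_of_pow_le_pow_left₀ (n := 10) (by norm_num) (by positivity) ?_
      rw [← Real.rpow_natCast, ← Real.rpow_mul (by norm_num)]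
      norm_num
    calc (6 : ℝ) ^ (l / 2) ≤ ((2 : ℝ) ^ l) ^ (13 / 10 : ℝ) := six_pow_le l
      _ ≤ (2 * l * x ^ 2) ^ (13 / 10 : ℝ) := Real.rpow_le_rpow (by positivity) h (by norm_num)
      _ ≤ _ := by rw [h2]; gcongr
  have hl3 : (l : ℝ) ^ (3 / 10 : ℝ) ≤ l := by
    conv_rhs => rw [← Real.rpow_one (l : ℝ)]
    exact Real.rpow_le_rpow_of_exponent_le hl0 (by norm_num)
  have hl3' : (l : ℝ) ^ (3 / 10 : ℝ) ≤ 2 * Real.logb 2 (N * x ^ 2) := hl3.trans hlL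
  have key : ∀ B, N * (N * (l : ℝ) ^ (3 / 10 : ℝ)) * (x ^ 2 * x ^ (6 / 10 : ℝ)) ≤ 4 * B →
      N * 6 ^ (l / 2) ≤ 12 * B := by
    intro B hB
    calc N * 6 ^ (l / 2) ≤ N * (3 * ((l : ℝ) ^ (13 / 10 : ℝ) * x ^ (26 / 10 : ℝ))) := by gcongr
      _ = 3 * (N * (l * (l : ℝ) ^ (3 / 10 : ℝ)) * (x ^ 2 * x ^ (6 / 10 : ℝ))) := by
        rw [h13, h26]; ring
      _ ≤ 3 * (N * (N * (l : ℝ) ^ (3 / 10 : ℝ)) * (x ^ 2 * x ^ (6 / 10 : ℝ))) := by gcongr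
      _ ≤ 12 * B := by linarith
  rw [timeBound_inv hx0]
  generalize Real.logb 2 (N * x ^ 2) = L at *
  rw [mul_min_of_nonneg _ _ (by norm_num), mul_min_of_nonneg _ _ (by norm_num)]
  refine le_min (key _ ?_) (le_min (key _ ?_) (key _ ?_))
  · have h1 : N ^ (23 / 10 : ℝ) = N * N * N ^ (3 / 10 : ℝ) := by
      rw [← sq, ← Real.rpow_natCast, ← Real.rpow_add (by linarith)]; norm_num
    have h2 : (l : ℝ) ^ (3 / 10 : ℝ) ≤ N ^ (3 / 10 : ℝ) :=
      Real.rpow_le_rpow (by linarith) hlN (by norm_num)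
    rw [h1, h26]
    calc N * (N * (l : ℝ) ^ (3 / 10 : ℝ)) * (x ^ 2 * x ^ (6 / 10 : ℝ))
        ≤ N * (N * N ^ (3 / 10 : ℝ)) * (x ^ 2 * x ^ (6 / 10 : ℝ)) := by gcongr
      _ = N * N * N ^ (3 / 10 : ℝ) * (x ^ 2 * x ^ (6 / 10 : ℝ)) * 1 := by ring
      _ ≤ N * N * N ^ (3 / 10 : ℝ) * (x ^ 2 * x ^ (6 / 10 : ℝ)) * (4 * L) := by
        gcongr; linarith
      _ = _ := by ring
  · have h1 : x ^ (6 / 10 : ℝ) ≤ x := by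
      conv_rhs => rw [← Real.rpow_one x]
      exact Real.rpow_le_rpow_of_exponent_le hx (by norm_num)
    calc N * (N * (l : ℝ) ^ (3 / 10 : ℝ)) * (x ^ 2 * x ^ (6 / 10 : ℝ))
        ≤ N * (N * (2 * L)) * (x ^ 2 * x) := by gcongr
      _ = 2 * (N ^ 2 * x ^ 3 * L) := by ring
      _ ≤ _ := by
        have : 0 ≤ N ^ 2 * x ^ 3 * L := by positivity
        linarith
  -- For x near 1 the iterated logarithm may vanish, but then x^0.6 ≤ 2 and the plain logarithmic
  -- summand suffices. For x ≥ 2 the iterated logarithm is at least 1.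
  · rcases le_total x 2 with hx2 | hx2
    · have h1 : x ^ (6 / 10 : ℝ) ≤ 2 := by
        calc x ^ (6 / 10 : ℝ) ≤ x ^ (1 : ℝ) :=
              Real.rpow_le_rpow_of_exponent_le hx (by norm_num)
          _ ≤ 2 := by rwa [Real.rpow_one]
      calc N * (N * (l : ℝ) ^ (3 / 10 : ℝ)) * (x ^ 2 * x ^ (6 / 10 : ℝ))
          ≤ N * (N * (2 * L)) * (x ^ 2 * 2) := by gcongr
        _ = 4 * (N ^ 2 * x ^ 2 * L) := by ring
        _ ≤ _ := by
          gcongr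
          exact le_add_of_nonneg_right (by positivity)
    · have h1 : (l : ℝ) ^ (3 / 10 : ℝ) ≤ 4 * x ^ (6 / 10 : ℝ) := by
        calc (l : ℝ) ^ (3 / 10 : ℝ) ≤ (4 * x ^ 2) ^ (3 / 10 : ℝ) :=
              Real.rpow_le_rpow (by linarith) hlx (by norm_num)
          _ = 4 ^ (3 / 10 : ℝ) * x ^ (6 / 10 : ℝ) := by
            rw [Real.mul_rpow (by norm_num) (by positivity), ← Real.rpow_natCast x,
              ← Real.rpow_mul hx0.le]
            norm_num
          _ ≤ 4 * x ^ (6 / 10 : ℝ) := by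
            gcongr
            calc (4 : ℝ) ^ (3 / 10 : ℝ) ≤ 4 ^ (1 : ℝ) :=
                  Real.rpow_le_rpow_of_exponent_le (by norm_num) (by norm_num)
              _ = 4 := Real.rpow_one _
      have h2 : x ^ (6 / 10 : ℝ) * x ^ (6 / 10 : ℝ) ≤ x ^ (3 / 2 : ℝ) := by
        rw [← Real.rpow_add hx0]
        exact Real.rpow_le_rpow_of_exponent_le hx (by norm_num)
      have h3 : 1 ≤ Real.logb 2 (L * x) := by
        rw [Real.le_logb_iff_rpow_le (by norm_num) (by positivity), Real.rpow_one]
        nlinarith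
      calc N * (N * (l : ℝ) ^ (3 / 10 : ℝ)) * (x ^ 2 * x ^ (6 / 10 : ℝ))
          ≤ N * (N * (4 * x ^ (6 / 10 : ℝ))) * (x ^ 2 * x ^ (6 / 10 : ℝ)) := by gcongr
        _ = 4 * (N ^ 2 * x ^ 2 * (x ^ (6 / 10 : ℝ) * x ^ (6 / 10 : ℝ))) := by ring
        _ ≤ 4 * (N ^ 2 * x ^ 2 * (x ^ (3 / 2 : ℝ) * 1)) := by rw [mul_one]; gcongr
        _ ≤ _ := by
          gcongr
          have h4 : x ^ (3 / 2 : ℝ) * 1 ≤ x ^ (3 / 2 : ℝ) * Real.logb 2 (L * x) ^ 2 := by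
            gcongr
            exact one_le_pow₀ h3
          linarith

theorem split_le (l : ℕ) : 2 ^ (l - l / 2) * 3 ^ (l / 2) + 2 ^ (l / 2) * 3 ^ (l - l / 2) ≤
    5 * 6 ^ (l / 2) := by
  have h6 : 6 ^ (l / 2) = 2 ^ (l / 2) * 3 ^ (l / 2) := mul_pow 2 3 (l / 2)
  have h : l - l / 2 = l / 2 ∨ l - l / 2 = l / 2 + 1 := by omega
  rcases h with h | h <;> rw [h, h6]
  · nlinarith [Nat.zero_le (2 ^ (l / 2) * 3 ^ (l / 2))]
  · rw [pow_succ, pow_succ]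
    exact le_of_eq (by ring)

/-- A bound on the time for one prefix. -/
theorem exists_prefix_bound {n p q : ℕ} (hn : 2 ≤ n) (hp : 0 < p) (hpq : p < q) :
    ∃ D : ℕ, n + n * (q * q) / (p * p) ≤ D ∧
      (∀ l, 1 ≤ l → l ≤ n → 2 ^ l ≤ l * (q * q) / (p * p) + 1 →
        n * 2 ^ l + (2 ^ (l - l / 2) * 3 ^ (l / 2) + 2 ^ (l / 2) * 3 ^ (l - l / 2)) ≤ D) ∧
      (n * D : ℝ) ≤ 100 * timeBound n ((p : ℝ) / q) := by
  have hp0 : (0 : ℝ) < p := by exact_mod_cast hp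
  have hx : (1 : ℝ) ≤ (q : ℝ) / p := by
    rw [one_le_div hp0]
    exact_mod_cast hpq.le
  have hN : (2 : ℝ) ≤ n := by exact_mod_cast hn
  have hn0 : (0 : ℝ) < n := by linarith
  have hdiv : ∀ k : ℕ, ((k * (q * q) / (p * p) : ℕ) : ℝ) ≤ k * ((q : ℝ) / p) ^ 2 := by
    intro k
    refine Nat.cast_div_le.trans (le_of_eq ?_)
    push_cast
    field_simp
  rw [← inv_div (q : ℝ) p]
  generalize (q : ℝ) / p = x at *
  have hx2 : 1 ≤ x ^ 2 := one_le_pow₀ hx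
  have hL := one_le_logb hN hx
  have hβ := mul_logb_le_timeBound hN hx
  have hβ0 : n ^ 2 * x ^ 2 ≤ timeBound n x⁻¹ :=
    (le_mul_of_one_le_right (by positivity) hL).trans hβ
  have hpos : 0 ≤ timeBound n x⁻¹ := le_trans (by positivity) hβ0
  -- The largest natural D with nD within the bound; the costs to be covered, times n, are at most 4
  -- + 5·12 = 64 multiples of `timeBound`.
  refine ⟨⌊100 * timeBound n x⁻¹ / n⌋₊, Nat.le_floor ?_, fun l hl hln h => Nat.le_floor ?_, ?_⟩
  · rw [le_div_iff₀ hn0]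
    push_cast
    have h1 := hdiv n
    have h2 : (n : ℝ) + ((n * (q * q) / (p * p) : ℕ) : ℝ) ≤ 2 * (n * x ^ 2) := by nlinarith
    calc ((n : ℝ) + ((n * (q * q) / (p * p) : ℕ) : ℝ)) * n ≤ 2 * (n * x ^ 2) * n := by gcongr
      _ = 2 * (n ^ 2 * x ^ 2) := by ring
      _ ≤ _ := by linarith
  · rw [le_div_iff₀ hn0]
    have hlN : (l : ℝ) ≤ n := by exact_mod_cast hln
    have hl1 : (1 : ℝ) ≤ l := by exact_mod_cast hl
    have h1 : (2 : ℝ) ^ l ≤ 2 * l * x ^ 2 := by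
      have h2 : ((2 ^ l : ℕ) : ℝ) ≤ ((l * (q * q) / (p * p) + 1 : ℕ) : ℝ) := by exact_mod_cast h
      have h3 := hdiv l
      push_cast at h2
      nlinarith
    have h2 := le_two_mul_logb hN hx hlN h1
    have h3 := mul_six_pow_le hN hx hl hlN h1
    have h4 : ((2 ^ (l - l / 2) * 3 ^ (l / 2) + 2 ^ (l / 2) * 3 ^ (l - l / 2) : ℕ) : ℝ) ≤
        5 * 6 ^ (l / 2) := by exact_mod_cast split_le l
    have h5 : (n : ℝ) * n * 2 ^ l ≤ 4 * timeBound n x⁻¹ := by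
      calc (n : ℝ) * n * 2 ^ l ≤ n * n * (2 * (2 * Real.logb 2 (n * x ^ 2)) * x ^ 2) := by
            gcongr
            exact h1.trans (by gcongr)
        _ = 4 * (n ^ 2 * x ^ 2 * Real.logb 2 (n * x ^ 2)) := by ring
        _ ≤ _ := by linarith
    rw [Nat.cast_add, add_mul]
    have h6 : ((2 ^ (l - l / 2) * 3 ^ (l / 2) + 2 ^ (l / 2) * 3 ^ (l - l / 2) : ℕ) : ℝ) * n ≤
        5 * 6 ^ (l / 2) * n := by gcongr
    push_cast at h6 ⊢
    linarith
  · have := Nat.floor_le (show 0 ≤ 100 * timeBound n x⁻¹ / n by positivity)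
    rw [le_div_iff₀ hn0] at this
    linarith

end SubsetSumRatio

namespace SubsetSumRatio

/-! ### Input and output -/

/-- The `j`-th smallest element, counting from `0`. -/
def nth (A : Finset ℕ) (j : ℕ) : ℕ := (A.sort (· ≤ ·)).getD j 0

section
variable {A : Finset ℕ}

theorem nth_eq_getElem {j : ℕ} (hj : j < A.card) :
    nth A j = (A.sort (· ≤ ·))[j]'(by rwa [Finset.length_sort]) :=
  List.getD_eq_getElem _ _ _

theorem nth_mem {j : ℕ} (hj : j < A.card) : nth A j ∈ A := by
  rw [nth_eq_getElem hj]
  exact (Finset.mem_sort _).1 (List.getElem_mem _)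

theorem nth_lt_nth {i j : ℕ} (hij : i < j) (hj : j < A.card) : nth A i < nth A j := by
  have hi := hij.trans hj
  have hle : nth A i ≤ nth A j := by
    rw [nth_eq_getElem hi, nth_eq_getElem hj]
    exact List.pairwise_iff_getElem.1 (Finset.pairwise_sort A (· ≤ ·)) _ _ _ _ hij
  refine hle.lt_of_ne fun he => ?_
  rw [nth_eq_getElem hi, nth_eq_getElem hj] at he
  exact hij.ne ((Finset.sort_nodup A (· ≤ ·)).getElem_inj_iff.1 he)

theorem nth_le_nth_iff {i j : ℕ} (hi : i < A.card) (hj : j < A.card) :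
    nth A i ≤ nth A j ↔ i ≤ j := by
  constructor
  · intro hle
    by_contra hlt
    exact absurd (nth_lt_nth (not_le.1 hlt) hi) (not_lt.2 hle)
  · intro hle
    rcases hle.lt_or_eq with h | rfl
    · exact (nth_lt_nth h hj).le
    · exact le_rfl

theorem exists_nth_eq {x : ℕ} (hx : x ∈ A) : ∃ j < A.card, nth A j = x := by
  obtain ⟨j, hj, he⟩ := List.mem_iff_getElem.1 ((Finset.mem_sort (· ≤ ·)).2 hx)
  rw [Finset.length_sort] at hj
  exact ⟨j, hj, (nth_eq_getElem hj).trans he⟩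

theorem initial_nth {k : ℕ} (hk : k ≤ A.card) {P : ℕ → Prop} [DecidablePred P]
    (hP : ∀ j < A.card, P (nth A j) ↔ j < k) : initial (nth A) k = {x ∈ A | P x} := by
  ext x
  simp only [initial, Finset.mem_image, Finset.mem_range, Finset.mem_filter]
  constructor
  · rintro ⟨j, hj, rfl⟩
    exact ⟨nth_mem (hj.trans_le hk), (hP j (hj.trans_le hk)).2 hj⟩
  · rintro ⟨hx, hPx⟩
    obtain ⟨j, hj, rfl⟩ := exists_nth_eq hx
    exact ⟨j, (hP j hj).1 hPx, rfl⟩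

theorem initial_nth_succ {i : ℕ} (hi : i < A.card) :
    initial (nth A) (i + 1) = {x ∈ A | x ≤ nth A i} :=
  initial_nth hi fun j hj => by rw [nth_le_nth_iff hj hi]; omega

theorem injOn_nth : Set.InjOn (nth A) (Finset.range A.card) := by
  intro i hi j hj he
  have hi' := Finset.mem_range.1 (Finset.mem_coe.1 hi)
  have hj' := Finset.mem_range.1 (Finset.mem_coe.1 hj)
  exact le_antisymm ((nth_le_nth_iff hi' hj').1 he.le) ((nth_le_nth_iff hj' hi').1 he.ge)

/-- Identifies the rank that `marked` uses as a cell number with the position in the sorted list. -/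
theorem card_filter_lt_nth {j : ℕ} (hj : j < A.card) : {y ∈ A | y < nth A j}.card = j := by
  rw [← initial_nth hj.le (P := (· < nth A j)) fun i hi => by
      rw [← not_le, nth_le_nth_iff hj hi, not_le],
    initial, Finset.card_image_of_injOn (injOn_nth.mono ?_), Finset.card_range]
  exact Finset.coe_subset.2 (Finset.range_subset_range.2 hj.le)

theorem marked_eq_pick {σ : State} {f : ℕ → ℕ} (hf : ∀ j < A.card, σ.mem j = f j) (v : ℕ) :
    marked A σ v = pick (nth A) A.card f v := by
  ext x
  simp only [marked, pick, Finset.mem_filter, Finset.mem_image, Finset.mem_range]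
  constructor
  · rintro ⟨hx, hv⟩
    obtain ⟨j, hj, rfl⟩ := exists_nth_eq hx
    rw [card_filter_lt_nth hj, hf j hj] at hv
    exact ⟨j, ⟨hj, hv⟩, rfl⟩
  · rintro ⟨j, ⟨hj, hv⟩, rfl⟩
    rw [card_filter_lt_nth hj, hf j hj]
    exact ⟨nth_mem hj, hv⟩

/-- The program state at the beginning. -/
def startStore (A : Finset ℕ) (p q : ℕ) : Store where
  len := A.card
  var x := (input A p q).reg x.reg
  arr b i := (input A p q).mem (addr A.card b i)
  clk := 0

variable {p q : ℕ}

theorem le_maxElt_of_nth (j : ℕ) : nth A j ≤ maxElt A := by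
  rcases lt_or_ge j A.card with h | h
  · exact le_maxElt (nth_mem h)
  · rw [nth, List.getD_eq_default _ _ (by rwa [Finset.length_sort])]
    exact Nat.zero_le _

/-- The length, the variables `p`, `q` and the input array were given exactly the registers and
cells of the machine's input convention, so these clauses hold by definition. -/
theorem rel_startStore {V : ℕ} (hV : magnitude A p q < V) :
    Rel V (input A p q) (startStore A p q) where
  len := rfl
  var _ := rfl
  arr _ _ _ := rfl
  len_lt := by
    have : (startStore A p q).len = A.card := rfl
    unfold magnitude at hV
    omega
  var_lt x := by
    change (if _ then _ else _) < V
    unfold magnitude at hV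
    split_ifs <;> omega
  arr_lt b i := by
    have := le_maxElt_of_nth (A := A) (addr A.card b i)
    change nth A (addr A.card b i) < V
    unfold magnitude at hV
    omega

theorem hasInput_startStore : HasInput (nth A) A.card p q (startStore A p q) where
  len := rfl
  p := rfl
  q := rfl
  inp j _ := by
    change nth A (addr A.card .inp j) = nth A j
    congr 1
    simp [addr, Arr.ctorIdx]

/-- The word bound that the program needs. -/
def word (A : Finset ℕ) (p q : ℕ) : ℕ :=
  16 * (magnitude A p q ^ 4 * magnitude A p q ^ 4)

variable (h0 : 0 ∉ A) (hcard : 2 ≤ A.card) (hp : 0 < p) (hpq : p < q)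
include h0 hcard hp hpq

theorem six_le_magnitude : 6 ≤ magnitude A p q := by
  have := maxElt_pos h0 (Finset.card_pos.1 (by omega))
  unfold magnitude
  omega

theorem setting_nth : Setting (nth A) A.card p q (magnitude A p q ^ 4) (word A p q) where
  two_le := hcard
  pos j hj := Nat.pos_of_ne_zero fun he => h0 (he ▸ nth_mem hj)
  lt _ _ hij hj := nth_lt_nth hij hj
  p_pos := hp
  p_lt := hpq
  sum_le := by
    have h6 := six_le_magnitude h0 hcard hp hpq
    have h1 : ∑ j ∈ Finset.range A.card, nth A j ≤ A.card * maxElt A := by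
      refine (Finset.sum_le_card_nsmul _ _ _ fun j _ => le_maxElt_of_nth j).trans_eq ?_
      simp
    refine h1.trans ?_
    have h2 : A.card ≤ magnitude A p q := by unfold magnitude; omega
    have h3 : maxElt A ≤ magnitude A p q := by unfold magnitude; omega
    calc A.card * maxElt A ≤ magnitude A p q * magnitude A p q := Nat.mul_le_mul h2 h3
      _ = magnitude A p q ^ 2 := (sq _).symm
      _ ≤ _ := Nat.pow_le_pow_right (by omega) (by norm_num)
  count_le := by
    have h6 := six_le_magnitude h0 hcard hp hpq
    have h2 : A.card ≤ magnitude A p q := by unfold magnitude; omega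
    have h3 : q ≤ magnitude A p q := by unfold magnitude; omega
    have h4 : A.card * (q * q) ≤ magnitude A p q ^ 3 := by
      calc _ ≤ magnitude A p q * (magnitude A p q * magnitude A p q) :=
            Nat.mul_le_mul h2 (Nat.mul_le_mul h3 h3)
        _ = _ := by ring
    have h5 : 1 ≤ magnitude A p q ^ 3 := Nat.one_le_pow _ _ (by omega)
    have h7 : magnitude A p q ^ 3 * 6 ≤ magnitude A p q ^ 4 := by
      rw [pow_succ _ 3]
      exact Nat.mul_le_mul_left _ h6
    omega
  word := le_rfl

theorem word_le : 18 * word A p q + 32 ≤ magnitude A p q ^ 12 := by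
  have h6 := six_le_magnitude h0 hcard hp hpq
  have h1 : magnitude A p q ^ 4 * magnitude A p q ^ 4 = magnitude A p q ^ 8 := by ring
  have h2 : magnitude A p q ^ 8 * 6 ^ 4 ≤ magnitude A p q ^ 12 := by
    rw [show 12 = 8 + 4 from rfl, pow_add]
    exact Nat.mul_le_mul_left _ (Nat.pow_le_pow_left h6 4)
  have h3 : 1 ≤ magnitude A p q ^ 8 := Nat.one_le_pow _ _ (by omega)
  rw [word, h1]
  omega

theorem magnitude_lt_word : magnitude A p q < word A p q := by
  have h6 := six_le_magnitude h0 hcard hp hpq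
  have h1 : magnitude A p q ^ 4 * magnitude A p q ^ 4 = magnitude A p q ^ 8 := by ring
  have h2 : magnitude A p q ^ 1 ≤ magnitude A p q ^ 8 :=
    Nat.pow_le_pow_right (by omega) (by norm_num)
  rw [pow_one] at h2
  rw [word, h1]
  omega

/-- The compiled program computes a possible output of `SSR` within the claimed time. -/
theorem exec_mainCmd : ∃ T τ, Exec (magnitude A p q ^ 12) mainCmd.compile (input A p q) T τ ∧
    SSR A ((p : ℝ) / q) (output A τ) ∧
    (T : ℝ) ≤ 500000 * timeBound A.card ((p : ℝ) / q) := by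
  obtain ⟨D, hD, hD', hnD⟩ := exists_prefix_bound hcard hp hpq
  obtain ⟨t, hrun, F, hF, ⟨i, hi, hmem⟩, hmin, hclk⟩ :=
    wp_mainCmd (setting_nth h0 hcard hp hpq) hasInput_startStore rfl rfl hD hD'
  have hlen : t.len = A.card := hrun.frame.len
  obtain ⟨T, τ, hexec, hrel, hT⟩ := hrun.exec (word_le h0 hcard hp hpq)
    (rel_startStore (magnitude_lt_word h0 hcard hp hpq))
  have hmemory : ∀ j < A.card, τ.mem j = t.arr .inp j := by
    intro j hj
    rw [← hrel.arr .inp j fun _ => by omega]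
    simp [addr, Arr.ctorIdx]
  have hout : output A τ = picks (nth A) A.card (t.arr .inp) :=
    Prod.ext (marked_eq_pick hmemory 1) (marked_eq_pick hmemory 2)
  refine ⟨T, τ, hexec, ?_, ?_⟩
  · rw [hout]
    refine SSR_of_candidateFamily (F := fun x => F {y ∈ A | y < x}.card) ?_ (nth_mem hi) ?_ ?_
    · intro x hx
      obtain ⟨j, hj, rfl⟩ := exists_nth_eq hx
      rw [card_filter_lt_nth hj, ← initial_nth_succ hj]
      exact hF j hj
    · rwa [card_filter_lt_nth hi]
    · intro x hx S hS
      obtain ⟨j, hj, rfl⟩ := exists_nth_eq hx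
      rw [card_filter_lt_nth hj] at hS
      exact hmin j hj S hS
  · have h1 : T ≤ 5000 * (A.card * D) := by
      rw [hT] at hclk
      omega
    have h2 : (T : ℝ) ≤ 5000 * (A.card * D) := by exact_mod_cast h1
    linarith

end

end SubsetSumRatio

theorem mainTheorem1 :
    -- every run of the algorithm returns a `(1 + ε)`-approximate solution
    (∀ (A : Finset ℕ) (ε : ℝ), 0 ∉ A → 2 ≤ A.card → 0 < ε → ε < 1 →
      (∃ S, SubsetSumRatio.SSR A ε S) ∧
      ∀ S, SubsetSumRatio.SSR A ε S → SubsetSumRatio.IsApproxSolution A ε S) ∧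
    -- and the algorithm can be implemented on a word RAM within the claimed time
    ∃ (prog : SubsetSumRatio.Prog) (K : ℕ) (C c : ℝ), c < 5 ∧
      ∀ (A : Finset ℕ) (p q : ℕ), 0 ∉ A → 2 ≤ A.card → 0 < p → p < q →
        ∃ (T : ℕ) (τ : SubsetSumRatio.State),
          SubsetSumRatio.Exec (SubsetSumRatio.magnitude A p q ^ K) prog
            (SubsetSumRatio.input A p q) T τ ∧
          SubsetSumRatio.SSR A ((p : ℝ) / (q : ℝ)) (SubsetSumRatio.output A τ) ∧
          SubsetSumRatio.IsApproxSolution A ((p : ℝ) / (q : ℝ)) (SubsetSumRatio.output A τ) ∧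
          (T : ℝ) ≤ C * SubsetSumRatio.timeBound (A.card : ℝ) ((p : ℝ) / (q : ℝ)) ∧
          (T : ℝ) ≤ C * ((A.card : ℝ) + 1 / ((p : ℝ) / (q : ℝ))) ^ c := by
  refine ⟨fun A ε h0 hcard hε hε1 => ⟨SubsetSumRatio.exists_SSR (Finset.card_pos.1 (by omega)) hε hε1.le,
    fun S hS => hS.isApproxSolution h0 hcard hε hε1⟩, SubsetSumRatio.mainCmd.compile, 12, 500000 * 120, 495 / 100,
    by norm_num, fun A p q h0 hcard hp hpq => ?_⟩
  obtain ⟨T, τ, hexec, hSSR, hT⟩ := SubsetSumRatio.exec_mainCmd h0 hcard hp hpq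
  have hp0 : (0 : ℝ) < p := by exact_mod_cast hp
  have hpq' : (p : ℝ) < q := by exact_mod_cast hpq
  have hx : (1 : ℝ) ≤ (q : ℝ) / p := by rw [one_le_div hp0]; exact hpq'.le
  have hN : (2 : ℝ) ≤ A.card := by exact_mod_cast hcard
  have hb := SubsetSumRatio.timeBound_le hN hx
  -- Since T ≥ 0, the bound on T makes `timeBound` nonnegative, so the constant 500000 may be
  -- enlarged by the factor 120 that the second estimate needs.
  have hT0 : (0 : ℝ) ≤ T := Nat.cast_nonneg T
  rw [inv_div] at hb
  refine ⟨T, τ, hexec, hSSR, hSSR.isApproxSolution h0 hcard (div_pos hp0 (hp0.trans hpq')) ?_, by linarith, ?_⟩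
  · rw [div_lt_one (by linarith)]
    exact hpq'
  · rw [one_div_div]
    linarith
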